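/- **Setting.** Let $\Omega\subset\mathbb R^d$ be compact, let $D\subseteq\mathbb R^k$, and let $\varphi(\theta,x)$ be real-valued for $\theta\in D$, $x\in\Omega$. Assume that for every $x\in\Omega$ the function $\varphi(\cdot,x)$ is $C^2$ (in a neighbourhood of each point of $D$), and that $\nabla_\theta\nabla_\theta\varphi(\cdot,x)$ is Lipschitz on $D$ with a constant independent of $x$. Let $x_1,\dots,x_n\in\Omega$ ($n\ge1$), $\hat\nu=\frac1n\sum_{l}\delta_{x_l}$, let $f_*$ be a real function, $\lambda\in\mathbb R$, and $r$ a real function that is $C^2$ near each point of $D$. Put $$F(\theta)=\int f_*\,\varphi(\theta,\cdot)\,d\hat\nu-\lambda r(\theta),\quad K(\theta,\theta')=\int\varphi(\theta,\cdot)\varphi(\theta',\cdot)\,d\hat\nu,\quad V(\theta,\mu)=-F(\theta)+\int K(\theta,\theta')\,\mu(d\theta').$$ Below $\nabla$ is the derivative in the first argument $\theta$, and $\nabla'$ the derivative in $\theta'$. Let $\mu_0$ be a probability measure on $D$ with compact support, let $D_0$ be a set of initial points with $\operatorname{supp}\mu_0\subseteq D_0\subseteq D$ (for instance $D_0=D$),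 and let $\theta^0_1,\theta^0_2,\dots$ be i.i.d. with law $\mu_0$; their joint law is $\mathbb P_0$. Suppose given: * for every $m$, the particle gradient flow: random paths $\theta_1(t),\dots,\theta_m(t)$ in $D$, $t\ge0$, with $\theta_i(0)=\theta_i^0$ and, almost surely, $\dot\theta_i=-\nabla V(\theta_i,\mu^{(m)}_t)$ for all $t\ge 0$, where $\mu^{(m)}_t=\frac1m\sum_{i=1}^m\delta_{\theta_i(t)}$; * the mean-field characteristic flow: $\Theta_t(\theta)\in D$, jointly continuous in $(t,\theta)\in[0,\infty)\times D_0$, with $\Theta_0(\theta)=\theta$ and $\dot\Theta_t(\theta)=-\nabla V(\Theta_t(\theta),\mu_t)$, where $\mu_t$ is the image of $\mu_0$ under $\Theta_t$; * the flow $\Theta^{(m)}_t$, with $\Theta_0^{(m)}(\theta)=\theta$ and $\dot\Theta^{(m)}_t(\theta)=-\nabla V(\Theta^{(m)}_t(\theta),\mu^{(m)}_t)$: for every $\theta\in D_0$ and $\tau>0$, almost surely, this holds in $D$ on $[0,\tau]$ for all sufficiently large $m$. For a test function $\chi$ (real, $C^1$ near each point of $D$) let $\int\chi\,d\omega^{(m)}_t=m^{1/2}\big(\int\chi\,d\mu^{(m)}_t-\int\chi\,d\mu_t\big)$.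 **Claim.** There are, on some probability space, a Gaussian random measure $\omega_0$ with mean zero and covariance $$\mathbb E[\omega_0(d\theta)\,\omega_0(d\theta')]=\mu_0(d\theta)\,\delta_\theta(d\theta')-\mu_0(d\theta)\,\mu_0(d\theta')$$ (that is, a centered Gaussian process $f\mapsto\int f\,d\omega_0$ on the square-integrable functions with covariance $\int fg\,d\mu_0-\int f\,d\mu_0\int g\,d\mu_0$), and a random field $T_t(\theta)$, $t\ge0$, $\theta\in D_0$, which almost surely is continuous in $(t,\theta)$, has $T_0=0$, and solves for all $t\ge 0$ and $\theta\in D_0$ $$\dot T_t(\theta)=-\nabla\nabla V(\Theta_t(\theta),\mu_t)\,T_t(\theta)-\int\nabla\nabla'K(\Theta_t(\theta),\Theta_t(\theta'))\,T_t(\theta')\,\mu_0(d\theta')-\int\nabla K(\Theta_t(\theta),\Theta_t(\theta'))\,\omega_0(d\theta'),$$ where $\nabla\nabla V(\Theta_t(\theta),\mu_t)=-\nabla\nabla F(\Theta_t(\theta))+\int\nabla\nabla K(\Theta_t(\theta),\Theta_t(\theta'))\,\mu_0(d\theta')$ and the last integral is taken in its version continuous in $(t,\theta)$, such that the following holds.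 Define $$\int\chi\,d\omega_t=\int\chi(\Theta_t(\theta))\,\omega_0(d\theta)+\int\nabla\chi(\Theta_t(\theta))\cdot T_t(\theta)\,\mu_0(d\theta).$$ Then for every $t\ge0$, as $m\to\infty$, $\omega^{(m)}_t$ converges weakly to $\omega_t$ in law and $T_t$ is the limit of $m^{1/2}(\Theta^{(m)}_t-\Theta_t)$ in law, jointly: for all finite families of test functions $\chi_1,\dots,\chi_a$ and of points $\vartheta_1,\dots,\vartheta_b\in D_0$, the random vector $$\Big(\big(\textstyle\int\chi_i\,d\omega^{(m)}_t\big)_{i\le a},\ \big(m^{1/2}(\Theta^{(m)}_t(\vartheta_j)-\Theta_t(\vartheta_j))\big)_{j\le b}\Big)$$ converges in distribution to $\big((\int\chi_i\,d\omega_t)_{i\le a},(T_t(\vartheta_j))_{j\le b}\big)$. -/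

import Mathlib

open MeasureTheory ProbabilityTheory Filter Topology Set
open scoped Gradient NNReal ENNReal

noncomputable section

/-- `ℝ^k` with its Euclidean norm. -/
abbrev Euc (k : ℕ) : Type := EuclideanSpace ℝ (Fin k)

/-- The empirical measure `(1/m) ∑ i, δ_{p i}` of finitely many points. -/
def empiricalMeasure {m : ℕ} {α : Type*} [MeasurableSpace α] (p : Fin m → α) : Measure α :=
  (m : ℝ≥0∞)⁻¹ • ∑ i, Measure.dirac (p i)

/-- The data of the regularized least-squares problem with `n` data points in `ℝ^d` and
parameters in `ℝ^k`: activation `φ(θ, x)`, data points `x_l`, target `f_*`,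
regularizer `r` and regularization strength `λ`. -/
structure RegressionProblem (k d n : ℕ) where
  phi : Euc k → Euc d → ℝ
  data : Fin n → Euc d
  target : Euc d → ℝ
  reg : Euc k → ℝ
  lam : ℝ

namespace RegressionProblem

variable {k d n : ℕ} (p : RegressionProblem k d n)

/-- The empirical data measure. -/
def dataMeasure : Measure (Euc d) := empiricalMeasure p.data

/-- `F(θ) = ∫ f_*(x) φ(θ, x) ν(dx) - λ r(θ)`. -/
def F (θ : Euc k) : ℝ := ∫ x, p.target x * p.phi θ x ∂p.dataMeasure - p.lam * p.reg θ

/-- `K(θ, θ') = ∫ φ(θ, x) φ(θ', x) ν(dx)`. -/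
def K (θ θ' : Euc k) : ℝ := ∫ x, p.phi θ x * p.phi θ' x ∂p.dataMeasure

/-- `V(θ, μ) = -F(θ) + ∫ K(θ, θ') μ(dθ')`. -/
def V (θ : Euc k) (μ : Measure (Euc k)) : ℝ := -p.F θ + ∫ θ', p.K θ θ' ∂μ

/-- `∇V(θ, μ)`, the gradient in `θ` for a fixed measure `μ`. -/
def gradV (θ : Euc k) (μ : Measure (Euc k)) : Euc k := ∇ (fun a => p.V a μ) θ

/-- `∇∇F(θ)`. -/
def hessF (θ : Euc k) : Euc k →L[ℝ] Euc k := fderiv ℝ (∇ p.F) θ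

/-- `∇K(θ, θ')`, the gradient in the first argument. -/
def gradK (θ θ' : Euc k) : Euc k := ∇ (fun a => p.K a θ') θ

/-- `∇∇K(θ, θ')`, the Hessian in the first argument. -/
def hessK (θ θ' : Euc k) : Euc k →L[ℝ] Euc k := fderiv ℝ (fun a => p.gradK a θ') θ

/-- The mixed derivative of `K`: the derivative in the second argument of the gradient
in the first argument. -/
def mixedK (θ θ' : Euc k) : Euc k →L[ℝ] Euc k := fderiv ℝ (fun a' => p.gradK θ a') θ'

end RegressionProblem

/-- `γ` is a trajectory in `D`, over the time interval `I`, of the ODE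
`dγ/dt = b t (γ t)` with `γ 0 = x₀`. -/
def IsTrajectory {k : ℕ} (b : ℝ → Euc k → Euc k) (D : Set (Euc k)) (I : Set ℝ)
    (x₀ : Euc k) (γ : ℝ → Euc k) : Prop :=
  γ 0 = x₀ ∧ ∀ t ∈ I, γ t ∈ D ∧ HasDerivWithinAt γ (b t (γ t)) I t

section Flows

variable {k d n : ℕ} (p : RegressionProblem k d n) (D D₀ : Set (Euc k)) (μ₀ : Measure (Euc k))

/-- Gradient descent flow of `m` particles in `D`: `dθ_i/dt = -∇V(θ_i, μ_t^{(m)})`, where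
`μ_t^{(m)}` is the empirical measure of the particles at time `t`. -/
def IsParticleFlow {m : ℕ} (θ₀ : Fin m → Euc k) (ϑ : Fin m → ℝ → Euc k) : Prop :=
  ∀ i, IsTrajectory (fun t a => -p.gradV a (empiricalMeasure fun j => ϑ j t)) D (Ici 0)
    (θ₀ i) (ϑ i)

/-- Mean-field characteristic flow started from the points of `D₀`:
`dΘ_t(θ)/dt = -∇V(Θ_t(θ), μ_t)` and `Θ_0(θ) = θ`, where `μ_t` is the image of `μ₀`
under `Θ_t`. As usual for a flow, `Θ_t(θ)` is jointly continuous in `(t, θ)`. -/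
structure IsMeanFieldFlow (Θ : ℝ → Euc k → Euc k) : Prop where
  continuousOn : ContinuousOn (fun q : ℝ × Euc k => Θ q.1 q.2) (Ici 0 ×ˢ D₀)
  trajectory : ∀ θ ∈ D₀, IsTrajectory (fun t a => -p.gradV a (μ₀.map (Θ t))) D (Ici 0)
    θ (fun t => Θ t θ)

/-- `∇∇V(Θ_t(θ), μ_t) = -∇∇F(Θ_t(θ)) + ∫ ∇∇K(Θ_t(θ), Θ_t(θ')) μ₀(dθ')`, with `Θt = Θ_t`. -/
def hessVAlong (Θt : Euc k → Euc k) (θ : Euc k) : Euc k →L[ℝ] Euc k :=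
  -p.hessF (Θt θ) + ∫ θ', p.hessK (Θt θ) (Θt θ') ∂μ₀

variable {S : Type*} [MeasurableSpace S] (P : Measure S)

/-- `W f` stands for `∫ f dω₀`, where `ω₀` is the Gaussian random measure with mean zero and
covariance `μ₀(dθ) δ_θ(dθ') - μ₀(dθ) μ₀(dθ')`: a centered Gaussian process indexed by the
square-integrable functions, with `Cov(W f, W g) = ∫ f g dμ₀ - ∫ f dμ₀ ∫ g dμ₀`. -/
structure IsGaussianFluctuation (W : (Euc k → ℝ) → S → ℝ) : Prop where
  gaussian : IsGaussianProcess (fun f : {f : Euc k → ℝ // MemLp f 2 μ₀} => W f.1) P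
  mean_eq_zero : ∀ f, MemLp f 2 μ₀ → ∫ s, W f s ∂P = 0
  covariance_eq : ∀ f g, MemLp f 2 μ₀ → MemLp g 2 μ₀ →
    covariance (W f) (W g) P = ∫ θ, f θ * g θ ∂μ₀ - (∫ θ, f θ ∂μ₀) * ∫ θ, g θ ∂μ₀

/-- The random vector `Y` is the integral `∫ f dω₀` of a vector-valued function `f`
(almost surely, coordinate by coordinate). -/
def IsVectorIntegral (W : (Euc k → ℝ) → S → ℝ) (f : Euc k → Euc k) (Y : S → Euc k) : Prop :=
  ∀ v : Euc k, ∀ᵐ s ∂P, inner ℝ v (Y s) = W (fun θ' => inner ℝ v (f θ')) s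

/-- `T` solves, with `T_0 = 0`, the linear equation
`dT_t(θ)/dt = -∇∇V(Θ_t(θ), μ_t) T_t(θ) - ∫ ∇∇'K(Θ_t(θ), Θ_t(θ')) T_t(θ') μ₀(dθ')
  - ∫ ∇K(Θ_t(θ), Θ_t(θ')) ω₀(dθ')`.
The equation holds along almost every sample path; `N t θ` is the version of the last integral
that is continuous in `(t, θ)`. -/
def IsFluctuationFlow (Θ : ℝ → Euc k → Euc k) (W : (Euc k → ℝ) → S → ℝ)
    (T : ℝ → Euc k → S → Euc k) : Prop :=
  ∃ N : ℝ → Euc k → S → Euc k,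
    (∀ t, 0 ≤ t → ∀ θ ∈ D₀,
      IsVectorIntegral P W (fun θ' => p.gradK (Θ t θ) (Θ t θ')) (N t θ)) ∧
    (∀ᵐ s ∂P, ContinuousOn (fun q : ℝ × Euc k => N q.1 q.2 s) (Ici 0 ×ˢ D₀)) ∧
    (∀ᵐ s ∂P, ContinuousOn (fun q : ℝ × Euc k => T q.1 q.2 s) (Ici 0 ×ˢ D₀)) ∧
    ∀ᵐ s ∂P, ∀ θ ∈ D₀, T 0 θ s = 0 ∧ ∀ t, 0 ≤ t →
      HasDerivWithinAt (fun u => T u θ s)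
        (-(hessVAlong p μ₀ (Θ t) θ (T t θ s))
          - ∫ θ', p.mixedK (Θ t θ) (Θ t θ') (T t θ' s) ∂μ₀
          - N t θ s)
        (Ici 0) t

/-- `∫ χ dω_t = ∫ χ(Θ_t(θ)) ω₀(dθ) + ∫ ∇χ(Θ_t(θ)) · T_t(θ) μ₀(dθ)`. -/
def limitFluctuation (Θ : ℝ → Euc k → Euc k) (W : (Euc k → ℝ) → S → ℝ)
    (T : ℝ → Euc k → S → Euc k) (t : ℝ) (χ : Euc k → ℝ) (s : S) : ℝ :=
  W (fun θ => χ (Θ t θ)) s + ∫ θ, inner ℝ (∇ χ (Θ t θ)) (T t θ s) ∂μ₀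

/-- `∫ χ dω^{(m)} = m^{1/2} (∫ χ dμ^{(m)} - ∫ χ dμ)`, where `μ^{(m)}` is the empirical measure of
the points `ϑ`. -/
def discrepancy {m : ℕ} (ϑ : Fin m → Euc k) (μ : Measure (Euc k)) (χ : Euc k → ℝ) : ℝ :=
  √(m : ℝ) * (∫ θ, χ θ ∂(empiricalMeasure ϑ) - ∫ θ, χ θ ∂μ)

end Flows

end

/-!
# Gaussian fluctuations of the particle gradient flow around its mean-field limit

Only finitely many data points enter the problem, so a population acts on a particle through
finitely many numbers. With `Φ θ = (φ(θ, x_l))_l` (`RegressionProblem.observable`), the velocity of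
a particle at `x` in a population `μ` is `∇F(x) + b₁(x) (∫ Φ dμ)`, where `b₁(x)` is a linear map with
`∇K(x, θ') = -b₁(x) (Φ θ')` (`RegressionProblem.gradK_eq`, `RegressionProblem.gradV_eq`). Both the
particle system and the mean-field flow thus have the form studied as `IsMeanFieldSolution`, with
`C¹` coefficients near `D`.

The paths `t ↦ Φ (Θ_t θ)`, for `θ` in the support of `μ₀`, are encoded by vectors `Ψ θ` of one
Hilbert space, from which continuous evaluation operators `G t` recover them
(`exists_path_embedding`). A fluctuation of the initial population then becomes a vector `η` of that
space, and the linearization of the flow in the direction of this fluctuation becomes a linear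
equation for operators `T_t(θ)` acting on `η`, which is solved by Picard iteration
(`exists_linear_flow`, `IsMeanFieldSolution.exists_response`). Randomness enters linearly
afterwards, so no regularity theory for stochastic processes is needed: if the random vector `Y`
represents the Gaussian measure `ω₀`, in the sense that every dual functional `L` satisfies
`L Y = ∫ L ∘ Ψ dω₀` almost surely (`exists_hilbert_counterpart`), then `T_t(θ) Y` solves the
fluctuation equation path by path (`isFluctuationFlow_response`).

For `m` particles the sampling error is `Δ = (1/m) ∑ Ψ(θ_i⁰) - ∫ Ψ dμ₀`. A Grönwall argument
(`particle_linearization`) and laws of large numbers in Banach spaces show that, almost surely, the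
trajectories follow the mean-field flow up to `T_t Δ + o(‖Δ‖)`, uniformly over the particles.
Consequently the rescaled fluctuation of an observable `χ` is, up to `o(√m ‖Δ‖)`, the normalized sum
of a fixed function of the initial points
(`IsMeanFieldSolution.eventually_observable_expansion`). Since `√m Δ` is bounded in `L²`, the
central limit theorem and Slutsky's lemma give the joint limit
(`IsMeanFieldSolution.tendstoInDistribution_fluctuation`).
-/

noncomputable section

/-! ### A linear evolution equation with a nonlocal term -/

section LinearFlow

variable {𝒳 𝒦 : Type*} [MeasurableSpace 𝒦]
  {E E' : Type*} [NormedAddCommGroup E] [NormedSpace ℝ E] [NormedAddCommGroup E'] [NormedSpace ℝ E']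

/-- The right-hand side `A x + B ∫ C x dν` of a linear evolution equation for a field
`x (t, θ)`, `θ : 𝒳`; the integral is over a space `𝒦` mapped into `𝒳` by `ι`. -/
def nonlocalOp (ν : Measure 𝒦) (ι : 𝒦 → 𝒳) (A : ℝ × 𝒳 → E →L[ℝ] E) (B : ℝ × 𝒳 → E' →L[ℝ] E)
    (C : ℝ × 𝒦 → E →L[ℝ] E') (x : ℝ × 𝒳 → E) (q : ℝ × 𝒳) : E :=
  A q (x q) + B q (∫ k, C (q.1, k) (x (q.1, ι k)) ∂ν)

/-- The terms of the Picard series of the equation `∂ₜ x = nonlocalOp x + h`, `x (0, ·) = 0`,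
continued to negative times by `0`. -/
def picardTerm (ν : Measure 𝒦) (ι : 𝒦 → 𝒳) (A : ℝ × 𝒳 → E →L[ℝ] E) (B : ℝ × 𝒳 → E' →L[ℝ] E)
    (C : ℝ × 𝒦 → E →L[ℝ] E') (h : ℝ × 𝒳 → E) : ℕ → ℝ × 𝒳 → E
  | 0 => fun q => ∫ s in (0 : ℝ)..max q.1 0, h (s, q.2)
  | j + 1 => fun q => ∫ s in (0 : ℝ)..max q.1 0,
      nonlocalOp ν ι A B C (picardTerm ν ι A B C h j) (s, q.2)

variable {ν : Measure 𝒦} [IsFiniteMeasure ν] {ι : 𝒦 → 𝒳} {A : ℝ × 𝒳 → E →L[ℝ] E}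
  {B : ℝ × 𝒳 → E' →L[ℝ] E} {C : ℝ × 𝒦 → E →L[ℝ] E'} {h : ℝ × 𝒳 → E}

lemma norm_nonlocalOp_le {N : Set 𝒳} (hN : ∀ k, ι k ∈ N) {t M b : ℝ} (hM : 0 ≤ M)
    (hA : ∀ θ ∈ N, ‖A (t, θ)‖ ≤ M) (hB : ∀ θ ∈ N, ‖B (t, θ)‖ ≤ M) (hC : ∀ k, ‖C (t, k)‖ ≤ M)
    {x : ℝ × 𝒳 → E} (hx : ∀ θ ∈ N, ‖x (t, θ)‖ ≤ b) {θ : 𝒳} (hθ : θ ∈ N) :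
    ‖nonlocalOp ν ι A B C x (t, θ)‖ ≤ (M + M * M * ν.real univ) * b := by
  have h1 : ‖∫ k, C (t, k) (x (t, ι k)) ∂ν‖ ≤ M * b * ν.real univ :=
    norm_integral_le_of_norm_le_const <| ae_of_all _ fun k =>
      ((C (t, k)).le_opNorm _).trans (mul_le_mul (hC k) (hx _ (hN k)) (norm_nonneg _) hM)
  calc ‖nonlocalOp ν ι A B C x (t, θ)‖
      ≤ ‖A (t, θ) (x (t, θ))‖ + ‖B (t, θ) (∫ k, C (t, k) (x (t, ι k)) ∂ν)‖ := norm_add_le _ _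
    _ ≤ M * b + M * (M * b * ν.real univ) := by
        gcongr
        · exact ((A (t, θ)).le_opNorm _).trans
            (mul_le_mul (hA θ hθ) (hx _ hθ) (norm_nonneg _) hM)
        · exact ((B (t, θ)).le_opNorm _).trans (mul_le_mul (hB θ hθ) h1 (norm_nonneg _) hM)
    _ = _ := by ring

/-- Geometric decay of the Picard terms in an exponentially weighted norm. -/
lemma norm_picardTerm_le {N : Set 𝒳} (hN : ∀ k, ι k ∈ N) {τ M : ℝ} (hM : 0 ≤ M)
    (hA : ∀ t ∈ Icc 0 τ, ∀ θ ∈ N, ‖A (t, θ)‖ ≤ M) (hB : ∀ t ∈ Icc 0 τ, ∀ θ ∈ N, ‖B (t, θ)‖ ≤ M)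
    (hC : ∀ t ∈ Icc 0 τ, ∀ k, ‖C (t, k)‖ ≤ M) (hh : ∀ t ∈ Icc 0 τ, ∀ θ ∈ N, ‖h (t, θ)‖ ≤ M) :
    ∃ l : ℝ, ∀ j : ℕ, ∀ t ≤ τ, 0 ≤ τ → ∀ θ ∈ N,
      ‖picardTerm ν ι A B C h j (t, θ)‖ ≤ M * (1 / 2) ^ j * Real.exp (l * τ) := by
  set κ : ℝ := M + M * M * ν.real univ with hκ
  have hκ0 : 0 ≤ κ := by positivity
  set l : ℝ := 2 * κ + 1 with hl
  have hl0 : 0 < l := by positivity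
  have key : ∀ j : ℕ, ∀ t ∈ Icc 0 τ, ∀ θ ∈ N,
      ‖picardTerm ν ι A B C h j (t, θ)‖ ≤ M * (1 / 2) ^ j * Real.exp (l * t) := by
    intro j
    induction j with
    | zero =>
      intro t ht θ hθ
      have h1 : ‖∫ s in (0 : ℝ)..t, h (s, θ)‖ ≤ M * |t - 0| :=
        intervalIntegral.norm_integral_le_of_norm_le_const fun s hs => by
          rw [uIoc_of_le ht.1] at hs
          exact hh s ⟨hs.1.le, hs.2.trans ht.2⟩ θ hθ
      simp only [picardTerm, max_eq_left ht.1]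
      rw [sub_zero, abs_of_nonneg ht.1] at h1
      have h2 : t ≤ Real.exp (l * t) := by
        have := Real.add_one_le_exp (l * t)
        nlinarith [ht.1]
      calc _ ≤ M * t := h1
        _ ≤ M * Real.exp (l * t) := by gcongr
        _ = _ := by ring
    | succ j ih =>
      intro t ht θ hθ
      simp only [picardTerm, max_eq_left ht.1]
      have h1 : ‖∫ s in (0 : ℝ)..t, nonlocalOp ν ι A B C (picardTerm ν ι A B C h j) (s, θ)‖
          ≤ ∫ s in (0 : ℝ)..t, κ * (M * (1 / 2) ^ j * Real.exp (l * s)) := by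
        refine intervalIntegral.norm_integral_le_of_norm_le ht.1 (ae_of_all _ fun s hs => ?_)
          (Continuous.intervalIntegrable (by fun_prop) _ _)
        have hs' : s ∈ Icc 0 τ := ⟨hs.1.le, hs.2.trans ht.2⟩
        exact norm_nonlocalOp_le hN hM (hA s hs') (hB s hs') (hC s hs')
          (ih s hs') hθ
      have h2 : ∫ s in (0 : ℝ)..t, κ * (M * (1 / 2) ^ j * Real.exp (l * s))
          = κ * (M * (1 / 2) ^ j) * ((Real.exp (l * t) - 1) / l) := by
        have : ∫ s in (0 : ℝ)..t, Real.exp (l * s) = (Real.exp (l * t) - 1) / l := by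
          rw [intervalIntegral.integral_comp_mul_left (fun s => Real.exp s) hl0.ne']
          simp [div_eq_inv_mul]
        simp_rw [← mul_assoc κ]
        rw [intervalIntegral.integral_const_mul, this]
      refine h1.trans (h2.le.trans ?_)
      rw [pow_succ, mul_div_assoc', div_le_iff₀ hl0]
      have : κ * (Real.exp (l * t) - 1) ≤ 1 / 2 * Real.exp (l * t) * l := by
        have := Real.exp_pos (l * t)
        rw [hl]; nlinarith
      calc _ = M * (1 / 2) ^ j * (κ * (Real.exp (l * t) - 1)) := by ring
        _ ≤ M * (1 / 2) ^ j * (1 / 2 * Real.exp (l * t) * l) := by gcongr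
        _ = _ := by ring
  refine ⟨l, fun j t ht hτ θ hθ => ?_⟩
  have hmax : picardTerm ν ι A B C h j (t, θ) = picardTerm ν ι A B C h j (max t 0, θ) := by
    cases j <;> simp [picardTerm]
  rw [hmax]
  refine (key j (max t 0) ⟨le_max_right _ _, max_le ht hτ⟩ θ hθ).trans ?_
  gcongr
  exact max_le ht hτ

variable [TopologicalSpace 𝒳] [TopologicalSpace 𝒦] [CompactSpace 𝒦] [OpensMeasurableSpace 𝒦]
  [SecondCountableTopology 𝒦]

lemma continuous_nonlocalOp (hι : Continuous ι) (hA : Continuous A) (hB : Continuous B)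
    (hC : Continuous C) {x : ℝ × 𝒳 → E} (hx : Continuous x) :
    Continuous (nonlocalOp ν ι A B C x) := by
  have h1 : Continuous fun t : ℝ => ∫ k, C (t, k) (x (t, ι k)) ∂ν := by
    have := continuous_parametric_integral_of_continuous (μ := ν) (X := ℝ) (Y := 𝒦)
      (f := fun t k => C (t, k) (x (t, ι k))) (s := univ)
      (by unfold Function.uncurry; exact hC.clm_apply (by fun_prop)) isCompact_univ
    simpa using this
  unfold nonlocalOp
  exact (hA.clm_apply hx).add (hB.clm_apply (h1.comp continuous_fst))

lemma continuous_picardTerm (hι : Continuous ι) (hA : Continuous A) (hB : Continuous B)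
    (hC : Continuous C) (hh : Continuous h) (j : ℕ) :
    Continuous (picardTerm ν ι A B C h j) := by
  induction j with
  | zero =>
    exact intervalIntegral.continuous_parametric_intervalIntegral_of_continuous
      (f := fun (q : ℝ × 𝒳) s => h (s, q.2)) (by unfold Function.uncurry; fun_prop) (by fun_prop)
  | succ j ih =>
    have := continuous_nonlocalOp (ν := ν) hι hA hB hC ih
    exact intervalIntegral.continuous_parametric_intervalIntegral_of_continuous
      (f := fun (q : ℝ × 𝒳) s => nonlocalOp ν ι A B C (picardTerm ν ι A B C h j) (s, q.2))
      (by unfold Function.uncurry; fun_prop) (by fun_prop)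

/-- Continuous maps are bounded, locally uniformly in a parameter and uniformly over a compact
set of parameters. -/
lemma exists_eventually_norm_le {G : Type*} [NormedAddCommGroup G] {f : ℝ × 𝒳 → G}
    (hf : Continuous f) (τ : ℝ) (θ₀ : 𝒳) {K : Set 𝒳} (hK : IsCompact K) :
    ∃ M, ∀ᶠ θ in 𝓝 θ₀, ∀ θ' ∈ insert θ K, ∀ t ∈ Icc 0 τ, ‖f (t, θ')‖ ≤ M := by
  obtain ⟨M₁, h₁⟩ := (isCompact_Icc (a := (0 : ℝ)) (b := τ)).exists_bound_of_continuousOn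
    (f := fun t => f (t, θ₀)) (by fun_prop)
  have h₁' : ∀ᶠ θ in 𝓝 θ₀, ∀ t ∈ Icc 0 τ, ‖f (t, θ)‖ ≤ M₁ + 1 := by
    refine isCompact_Icc.eventually_forall_of_forall_eventually fun t ht => ?_
    have hc : Continuous fun z : 𝒳 × ℝ => ‖f (z.2, z.1)‖ := by fun_prop
    have h1 : ‖f (t, θ₀)‖ < M₁ + 1 := (h₁ t ht).trans_lt (lt_add_one M₁)
    exact (hc.continuousAt.eventually_lt continuousAt_const h1).mono fun z hz => hz.le
  obtain ⟨M₂, h₂⟩ := ((isCompact_Icc (a := (0 : ℝ)) (b := τ)).prod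
    hK).exists_bound_of_continuousOn hf.continuousOn
  refine ⟨max (M₁ + 1) M₂, h₁'.mono fun θ hθ θ' hθ' t ht => ?_⟩
  rcases hθ' with rfl | hθ'
  · exact (hθ t ht).trans (le_max_left _ _)
  · exact (h₂ (t, θ') ⟨ht, hθ'⟩).trans (le_max_right _ _)

/-- Global solvability of the linear equation `∂ₜ x = A x + B ∫ C x dν + h`, `x (0, ·) = 0`, with
a solution that is jointly continuous in time and in the (possibly non-compact) parameter. -/
theorem exists_linear_flow [CompleteSpace E] (hι : Continuous ι) (hA : Continuous A)
    (hB : Continuous B) (hC : Continuous C) (hh : Continuous h) :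
    ∃ x : ℝ × 𝒳 → E, Continuous x ∧ (∀ θ, x (0, θ) = 0) ∧ ∀ t, 0 ≤ t → ∀ θ,
      HasDerivWithinAt (fun u => x (u, θ))
        (A (t, θ) (x (t, θ)) + B (t, θ) (∫ k, C (t, k) (x (t, ι k)) ∂ν) + h (t, θ)) (Ici 0) t := by
  set d := picardTerm ν ι A B C h with hd
  have hdc : ∀ j, Continuous (d j) := continuous_picardTerm hι hA hB hC hh
  -- local bounds, uniform along the image of `𝒦`
  have loc : ∀ τ : ℝ, 0 ≤ τ → ∀ θ₀ : 𝒳, ∃ V ∈ 𝓝 θ₀, ∃ R : ℝ, ∀ j : ℕ, ∀ t ≤ τ,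
      ∀ θ ∈ V ∪ range ι, ‖d j (t, θ)‖ ≤ R * (1 / 2) ^ j := by
    intro τ hτ θ₀
    obtain ⟨M₁, h₁⟩ := exists_eventually_norm_le hA τ θ₀ (isCompact_range hι)
    obtain ⟨M₂, h₂⟩ := exists_eventually_norm_le hB τ θ₀ (isCompact_range hι)
    obtain ⟨M₃, h₃⟩ := exists_eventually_norm_le hh τ θ₀ (isCompact_range hι)
    obtain ⟨M₄, h₄⟩ := ((isCompact_Icc (a := (0 : ℝ)) (b := τ)).prod
      (isCompact_univ (X := 𝒦))).exists_bound_of_continuousOn hC.continuousOn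
    set M := max (max M₁ M₂) (max (max M₃ M₄) 0) with hM
    have e1 : M₁ ≤ M := (le_max_left _ _).trans (le_max_left _ _)
    have e2 : M₂ ≤ M := (le_max_right _ _).trans (le_max_left _ _)
    have e3 : M₃ ≤ M := (le_max_left _ _).trans ((le_max_left _ _).trans (le_max_right _ _))
    have e4 : M₄ ≤ M := (le_max_right _ _).trans ((le_max_left _ _).trans (le_max_right _ _))
    have e0 : 0 ≤ M := (le_max_right _ _).trans (le_max_right _ _)
    set V := {θ | (∀ θ' ∈ insert θ (range ι), ∀ t ∈ Icc 0 τ, ‖A (t, θ')‖ ≤ M₁) ∧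
      (∀ θ' ∈ insert θ (range ι), ∀ t ∈ Icc 0 τ, ‖B (t, θ')‖ ≤ M₂) ∧
      (∀ θ' ∈ insert θ (range ι), ∀ t ∈ Icc 0 τ, ‖h (t, θ')‖ ≤ M₃)} with hV
    have hVn : V ∈ 𝓝 θ₀ := by
      filter_upwards [h₁, h₂, h₃] with θ a b c using ⟨a, b, c⟩
    have hθ₀ : θ₀ ∈ V := mem_of_mem_nhds hVn
    have get : ∀ θ ∈ V ∪ range ι, (∀ t ∈ Icc 0 τ, ‖A (t, θ)‖ ≤ M₁) ∧
        (∀ t ∈ Icc 0 τ, ‖B (t, θ)‖ ≤ M₂) ∧ (∀ t ∈ Icc 0 τ, ‖h (t, θ)‖ ≤ M₃) := by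
      rintro θ (hθ | hθ)
      · exact ⟨hθ.1 θ (mem_insert _ _), hθ.2.1 θ (mem_insert _ _), hθ.2.2 θ (mem_insert _ _)⟩
      · exact ⟨hθ₀.1 θ (mem_insert_of_mem _ hθ), hθ₀.2.1 θ (mem_insert_of_mem _ hθ),
          hθ₀.2.2 θ (mem_insert_of_mem _ hθ)⟩
    obtain ⟨l, hl⟩ := norm_picardTerm_le (ν := ν) (ι := ι) (A := A) (B := B) (C := C) (h := h)
      (N := V ∪ range ι) (τ := τ) (M := M) (fun k => Or.inr ⟨k, rfl⟩) e0
      (fun t ht θ hθ => ((get θ hθ).1 t ht).trans e1)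
      (fun t ht θ hθ => ((get θ hθ).2.1 t ht).trans e2)
      (fun t ht k => (h₄ (t, k) ⟨ht, mem_univ _⟩).trans e4)
      (fun t ht θ hθ => ((get θ hθ).2.2 t ht).trans e3)
    refine ⟨V, hVn, M * Real.exp (l * τ), fun j t ht θ hθ => (hl j t ht hτ θ hθ).trans (le_of_eq ?_)⟩
    ring
  have hgeo : ∀ R : ℝ, Summable fun j : ℕ => R * (1 / 2 : ℝ) ^ j := fun R =>
    (summable_geometric_of_lt_one (by norm_num) (by norm_num)).mul_left R
  set x : ℝ × 𝒳 → E := fun q => ∑' j, d j q with hx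
  have hsum : ∀ q, HasSum (fun j => d j q) (x q) := by
    intro q
    obtain ⟨V, hV, R, hR⟩ := loc (max q.1 0) (le_max_right _ _) q.2
    exact (Summable.of_norm_bounded (hgeo R) fun j =>
      hR j q.1 (le_max_left _ _) q.2 (Or.inl (mem_of_mem_nhds hV))).hasSum
  have hxc : Continuous x := by
    refine continuous_iff_continuousAt.2 fun q => ?_
    obtain ⟨V, hV, R, hR⟩ := loc (max q.1 0 + 1) (by positivity) q.2
    have hmem : Iic (max q.1 0 + 1) ×ˢ V ∈ 𝓝 q :=
      prod_mem_nhds (Iic_mem_nhds ((le_max_left _ _).trans_lt (lt_add_one _))) hV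
    exact (continuousOn_tsum (fun j => (hdc j).continuousOn) (hgeo R)
      fun j z hz => hR j z.1 hz.1 z.2 (Or.inl hz.2)).continuousAt hmem
  have hLsum : ∀ q, HasSum (fun j => nonlocalOp ν ι A B C (d j) q) (nonlocalOp ν ι A B C x q) := by
    intro q
    obtain ⟨V, hV, R, hR⟩ := loc (max q.1 0) (le_max_right _ _) q.2
    refine ((A q).hasSum (hsum q)).add ((B q).hasSum ?_)
    refine hasSum_integral_of_dominated_convergence
      (fun j k => ‖C (q.1, k)‖ * (R * (1 / 2) ^ j)) (fun j => ?_) (fun j => ae_of_all _ fun k => ?_)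
      (ae_of_all _ fun k => (hgeo R).mul_left _) ?_ (ae_of_all _ fun k => ?_)
    · exact Continuous.aestronglyMeasurable
        ((hC.comp (by fun_prop)).clm_apply ((hdc j).comp (by fun_prop)))
    · exact ((C (q.1, k)).le_opNorm _).trans (by
        gcongr
        exact hR j q.1 (le_max_left _ _) _ (Or.inr ⟨k, rfl⟩))
    · simp_rw [tsum_mul_left]
      have : Continuous fun k => ‖C (q.1, k)‖ * (R * ∑' j : ℕ, (1 / 2 : ℝ) ^ j) := by fun_prop
      exact this.integrable_of_hasCompactSupport (HasCompactSupport.of_compactSpace _)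
    · exact (C (q.1, k)).hasSum (hsum _)
  have hLc : Continuous (nonlocalOp ν ι A B C x) := continuous_nonlocalOp hι hA hB hC hxc
  -- the integral equation
  have hint : ∀ t, 0 ≤ t → ∀ θ,
      x (t, θ) = ∫ s in (0 : ℝ)..t, (nonlocalOp ν ι A B C x (s, θ) + h (s, θ)) := by
    intro t ht θ
    obtain ⟨V, hV, R, hR⟩ := loc t ht θ
    have hLd : ∀ j, Continuous (nonlocalOp ν ι A B C (d j)) := fun j =>
      continuous_nonlocalOp hι hA hB hC (hdc j)
    obtain ⟨M, hM⟩ := (isCompact_Icc (a := (0 : ℝ)) (b := t)).exists_bound_of_continuousOn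
      (f := fun s => A (s, θ)) (by fun_prop)
    obtain ⟨M', hM'⟩ := (isCompact_Icc (a := (0 : ℝ)) (b := t)).exists_bound_of_continuousOn
      (f := fun s => B (s, θ)) (by fun_prop)
    obtain ⟨M'', hM''⟩ := ((isCompact_Icc (a := (0 : ℝ)) (b := t)).prod
      (isCompact_univ (X := 𝒦))).exists_bound_of_continuousOn hC.continuousOn
    set S := max (max M M') (max M'' 0) with hS
    have e1 : M ≤ S := (le_max_left _ _).trans (le_max_left _ _)
    have e2 : M' ≤ S := (le_max_right _ _).trans (le_max_left _ _)
    have e3 : M'' ≤ S := (le_max_left _ _).trans (le_max_right _ _)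
    have e0 : 0 ≤ S := (le_max_right _ _).trans (le_max_right _ _)
    have hRj : ∀ j : ℕ, 0 ≤ R * (1 / 2 : ℝ) ^ j := fun j =>
      (norm_nonneg _).trans (hR j t le_rfl θ (Or.inl (mem_of_mem_nhds hV)))
    have hs : HasSum (fun j => d (j + 1) (t, θ)) (∫ s in (0 : ℝ)..t, nonlocalOp ν ι A B C x (s, θ)) := by
      have : (fun j => d (j + 1) (t, θ)) =
          fun j => ∫ s in (0 : ℝ)..t, nonlocalOp ν ι A B C (d j) (s, θ) := by
        funext j
        simp only [hd, picardTerm, max_eq_left ht]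
      rw [this]
      refine intervalIntegral.hasSum_integral_of_dominated_convergence
        (fun j _ => (S + S * S * ν.real univ) * (R * (1 / 2) ^ j)) (fun j => ?_)
        (fun j => ae_of_all _ fun s hs => ?_)
        (ae_of_all _ fun s _ => (hgeo R).mul_left _) ?_ (ae_of_all _ fun s _ => hLsum _)
      · exact Continuous.aestronglyMeasurable ((hLd j).comp (by fun_prop))
      · rw [uIoc_of_le ht] at hs
        have hs' : s ∈ Icc 0 t := ⟨hs.1.le, hs.2⟩
        refine (norm_add_le _ _).trans ?_
        have i1 : ‖∫ k, C (s, k) (d j (s, ι k)) ∂ν‖ ≤ S * (R * (1 / 2) ^ j) * ν.real univ :=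
          norm_integral_le_of_norm_le_const <| ae_of_all _ fun k =>
            ((C (s, k)).le_opNorm _).trans (mul_le_mul ((hM'' (s, k) ⟨hs', mem_univ _⟩).trans e3)
              (hR j s hs.2 _ (Or.inr ⟨k, rfl⟩)) (norm_nonneg _) e0)
        have i2 : ‖A (s, θ) (d j (s, θ))‖ ≤ S * (R * (1 / 2) ^ j) :=
          ((A (s, θ)).le_opNorm _).trans (mul_le_mul ((hM s hs').trans e1)
            (hR j s hs.2 _ (Or.inl (mem_of_mem_nhds hV))) (norm_nonneg _) e0)
        have i3 := ((B (s, θ)).le_opNorm (∫ k, C (s, k) (d j (s, ι k)) ∂ν)).trans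
          (mul_le_mul ((hM' s hs').trans e2) i1 (norm_nonneg _) e0)
        refine (add_le_add i2 i3).trans (le_of_eq ?_)
        ring
      · exact intervalIntegrable_const
    have h0 := (hsum (t, θ))
    rw [hasSum_nat_add_iff' 1 |>.symm] at h0
    have := h0.unique hs
    rw [intervalIntegral.integral_add (Continuous.intervalIntegrable (by fun_prop) _ _)
      (Continuous.intervalIntegrable (by fun_prop) _ _), ← this]
    simp [hd, picardTerm, max_eq_left ht]
  refine ⟨x, hxc, fun θ => by simpa using hint 0 le_rfl θ, fun t ht θ => ?_⟩
  have hc : Continuous fun s => nonlocalOp ν ι A B C x (s, θ) + h (s, θ) := by fun_prop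
  have hder := (intervalIntegral.integral_hasDerivAt_right (hc.intervalIntegrable 0 t)
    (hc.stronglyMeasurableAtFilter _ _) hc.continuousAt)
  exact (hder.hasDerivWithinAt (s := Ici 0)).congr (fun u hu => hint u hu θ) (hint t ht θ)

end LinearFlow

/-! ### Linearization of an interacting particle system around reference paths -/

section Linearization

variable {E F G : Type*} [NormedAddCommGroup E] [NormedSpace ℝ E] [NormedAddCommGroup F]
  [NormedSpace ℝ F] [NormedAddCommGroup G] [NormedSpace ℝ G]

/-- The average of finitely many vectors, `0` for the empty family. -/
def avg {m : ℕ} (a : Fin m → G) : G := (m : ℝ)⁻¹ • ∑ l, a l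

lemma norm_avg_le {m : ℕ} {a : Fin m → G} {c : ℝ} (hc : 0 ≤ c) (h : ∀ l, ‖a l‖ ≤ c) :
    ‖avg a‖ ≤ c := by
  rcases Nat.eq_zero_or_pos m with rfl | hm
  · simpa [avg] using hc
  have hm' : (0 : ℝ) < m := by exact_mod_cast hm
  rw [avg, norm_smul, norm_inv, Real.norm_natCast, inv_mul_le_iff₀ hm']
  exact (norm_sum_le_of_le _ fun l _ => h l).trans (by simp)

lemma avg_add {m : ℕ} (a b : Fin m → G) : avg (fun l => a l + b l) = avg a + avg b := by
  simp [avg, Finset.sum_add_distrib]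

lemma avg_sub {m : ℕ} (a b : Fin m → G) : avg (fun l => a l - b l) = avg a - avg b := by
  simp [avg, Finset.sum_sub_distrib, smul_sub]

lemma map_avg {m : ℕ} (L : F →L[ℝ] G) (a : Fin m → F) : L (avg a) = avg fun l => L (a l) := by
  simp [avg]

lemma ContDiffAt.continuousAt_fderiv_one {f : E → G} {x : E} (hf : ContDiffAt ℝ 1 f x) :
    ContinuousAt (fderiv ℝ f) x :=
  (hf.fderiv_right (m := 0) (by norm_num)).continuousAt

/-- A map that is `C¹` near a compact set is differentiable uniformly over that set. -/
lemma exists_uniform_differentiable {f : E → G} {C : Set E} (hC : IsCompact C)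
    (hf : ∀ x ∈ C, ContDiffAt ℝ 1 f x) {ε : ℝ} (hε : 0 < ε) :
    ∃ r > 0, ∀ x ∈ C, ∀ y, ‖y - x‖ ≤ r → ‖f y - f x - fderiv ℝ f x (y - x)‖ ≤ ε * ‖y - x‖ := by
  have key : ∀ᶠ v in 𝓝 (0 : E), ∀ x ∈ C, ‖f (x + v) - f x - fderiv ℝ f x v‖ ≤ ε * ‖v‖ := by
    refine hC.eventually_forall_of_forall_eventually fun x hx => ?_
    have h1 := ((hf x hx).hasStrictFDerivAt (by norm_num)).isLittleO.def (half_pos hε)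
    have hm : Tendsto (fun z : E × E => (z.2 + z.1, z.2)) (𝓝 (0, x)) (𝓝 (x, x)) := by
      have : Continuous fun z : E × E => (z.2 + z.1, z.2) := by fun_prop
      simpa using this.tendsto (0, x)
    have h2 : ∀ᶠ z : E × E in 𝓝 (0, x), ‖fderiv ℝ f z.2 - fderiv ℝ f x‖ < ε / 2 := by
      have : Tendsto (fun z : E × E => fderiv ℝ f z.2) (𝓝 (0, x)) (𝓝 (fderiv ℝ f x)) :=
        (hf x hx).continuousAt_fderiv_one.tendsto.comp continuous_snd.continuousAt
      simpa [dist_eq_norm] using this.eventually (Metric.ball_mem_nhds _ (half_pos hε))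
    filter_upwards [hm.eventually h1, h2] with z hz1 hz2
    simp only [add_sub_cancel_left] at hz1
    have hz3 : ‖(fderiv ℝ f z.2 - fderiv ℝ f x) z.1‖ ≤ ε / 2 * ‖z.1‖ :=
      ((fderiv ℝ f z.2 - fderiv ℝ f x).le_opNorm _).trans (by gcongr)
    calc _ = ‖(f (z.2 + z.1) - f z.2 - fderiv ℝ f x z.1)
          - (fderiv ℝ f z.2 - fderiv ℝ f x) z.1‖ := by
          congr 1; simp only [sub_apply]; abel
      _ ≤ ε / 2 * ‖z.1‖ + ε / 2 * ‖z.1‖ := (norm_sub_le _ _).trans (add_le_add hz1 hz3)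
      _ = _ := by ring
  obtain ⟨r, hr, h⟩ := Metric.eventually_nhds_iff.1 key
  refine ⟨r / 2, half_pos hr, fun x hx y hy => ?_⟩
  have := h (y := y - x) (by rw [dist_zero_right]; linarith) x hx
  simpa using this

lemma exists_fderiv_bound {f : E → G} {C : Set E} (hC : IsCompact C)
    (hf : ∀ x ∈ C, ContDiffAt ℝ 1 f x) : ∃ M, ∀ x ∈ C, ‖fderiv ℝ f x‖ ≤ M :=
  hC.exists_bound_of_continuousOn fun x hx =>
    (hf x hx).continuousAt_fderiv_one.continuousWithinAt

/-- Grönwall's inequality when the differential inequality is only known while `‖f‖ ≤ r`: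
if the resulting bound is smaller than `r`, then `f` never leaves that region. -/
lemma norm_le_of_gronwall_bootstrap {f f' : ℝ → G} {K δ r τ : ℝ} (hK : 1 ≤ K) (hδ : 0 ≤ δ)
    (hf : ContinuousOn f (Icc 0 τ)) (hf' : ∀ t ∈ Ico 0 τ, HasDerivWithinAt f (f' t) (Ici t) t)
    (h0 : f 0 = 0) (hb : ∀ t ∈ Ico 0 τ, ‖f t‖ ≤ r → ‖f' t‖ ≤ K * ‖f t‖ + δ)
    (hr : δ * Real.exp (K * τ) < r) : ∀ t ∈ Icc 0 τ, ‖f t‖ ≤ δ * Real.exp (K * τ) := by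
  have hK0 : 0 < K := by linarith
  have step : ∀ t₁ ∈ Icc 0 τ, (∀ t ∈ Ico 0 t₁, ‖f t‖ ≤ r) → ‖f t₁‖ ≤ δ * Real.exp (K * τ) := by
    intro t₁ ht₁ hlt
    have h1 := norm_le_gronwallBound_of_norm_deriv_right_le (δ := 0) (K := K) (ε := δ)
      (hf.mono (Icc_subset_Icc_right ht₁.2))
      (fun t ht => hf' t ⟨ht.1, ht.2.trans_le ht₁.2⟩) (by simp [h0])
      (fun t ht => hb t ⟨ht.1, ht.2.trans_le ht₁.2⟩ (hlt t ht)) t₁ ⟨ht₁.1, le_rfl⟩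
    simp only [gronwallBound_of_K_ne_0 hK0.ne', sub_zero, zero_mul, zero_add] at h1
    have h2 : Real.exp (K * t₁) ≤ Real.exp (K * τ) := by
      gcongr; exact ht₁.2
    have h3 : 1 ≤ Real.exp (K * t₁) := Real.one_le_exp (mul_nonneg hK0.le ht₁.1)
    refine h1.trans (mul_le_mul (div_le_self hδ hK) (by linarith) (by linarith) hδ)
  have hle : ∀ t ∈ Icc 0 τ, ‖f t‖ ≤ r := by
    by_contra! hcon
    obtain ⟨t₂, ht₂, hrt₂⟩ := hcon
    have hbad : IsCompact (Icc 0 τ ∩ (fun t => ‖f t‖) ⁻¹' Ici r) :=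
      isCompact_Icc.of_isClosed_subset
        (hf.norm.preimage_isClosed_of_isClosed isClosed_Icc isClosed_Ici) inter_subset_left
    obtain ⟨t₁, ht₁, hmin⟩ := hbad.exists_isLeast ⟨t₂, ht₂, hrt₂.le⟩
    have h1 := step t₁ ht₁.1 fun t ht => by
      by_contra! h
      exact absurd (hmin ⟨⟨ht.1, ht.2.le.trans ht₁.1.2⟩, h.le⟩) (not_le.2 ht.2)
    exact absurd ht₁.2 (not_le.2 (h1.trans_lt hr))
  exact fun t ht => step t ht fun s hs => hle s ⟨hs.1, hs.2.le.trans ht.2⟩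

lemma norm_sub_le_of_linear_approx {a b : G} {L : E →L[ℝ] G} {v : E} {M : ℝ}
    (h : ‖a - b - L v‖ ≤ 1 * ‖v‖) (hL : ‖L‖ ≤ M) : ‖a - b‖ ≤ (M + 1) * ‖v‖ := by
  calc ‖a - b‖ = ‖(a - b - L v) + L v‖ := by congr 1; abel
    _ ≤ 1 * ‖v‖ + M * ‖v‖ :=
        (norm_add_le _ _).trans (add_le_add h ((L.le_opNorm v).trans (by gcongr)))
    _ = (M + 1) * ‖v‖ := by ring

lemma le_opNorm_of_le' {L : F →L[ℝ] G} {v : F} {M c : ℝ} (hL : ‖L‖ ≤ M) (hv : ‖v‖ ≤ c) :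
    ‖L v‖ ≤ M * c :=
  (L.le_opNorm v).trans (mul_le_mul hL hv (norm_nonneg _) ((norm_nonneg _).trans hL))

set_option maxHeartbeats 1000000 in
/-- A system of particles `x i` with drift `b₀ + b₁ v`, where `v` is the average of `Φ` over some of
the particles, compared with reference paths `X i` driven by `u`. If `u` differs from the average
of `Φ` over the reference paths by `g = O(δ)`, and if `T i` solves the linearized system up to a
relative error `η`, then `‖x i - X i‖ = O(δ)` and `‖x i - X i - T i‖ ≤ ε δ` as soon as `δ` and `η` are
small. All constants are uniform in the number of particles. -/
theorem particle_linearization {b₀ : E → E} {b₁ : E → F →L[ℝ] E} {Φ : E → F} {C : Set E}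
    (hC : IsCompact C) (hb₀ : ∀ x ∈ C, ContDiffAt ℝ 1 b₀ x) (hb₁ : ∀ x ∈ C, ContDiffAt ℝ 1 b₁ x)
    (hΦ : ∀ x ∈ C, ContDiffAt ℝ 1 Φ x) {τ U : ℝ} (hU : 0 ≤ U) :
    ∃ R : ℝ, 0 ≤ R ∧ ∀ ε > 0, ∃ η > 0, ∀ (ι : Type) [Fintype ι] (m : ℕ) (j : Fin m → ι)
      (x X T : ι → ℝ → E) (u g w : ℝ → F) (δ : ℝ), 0 ≤ δ → δ ≤ η →
      (∀ i, ∀ t ∈ Icc 0 τ, X i t ∈ C) → (∀ t ∈ Icc 0 τ, ‖u t‖ ≤ U) →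
      (∀ i, X i 0 = x i 0) → (∀ i, T i 0 = 0) →
      (∀ i, ∀ t ∈ Icc 0 τ,
        HasDerivWithinAt (X i) (b₀ (X i t) + b₁ (X i t) (u t)) (Icc 0 τ) t) →
      (∀ i, ∀ t ∈ Icc 0 τ, HasDerivWithinAt (x i)
        (b₀ (x i t) + b₁ (x i t) (avg fun l => Φ (x (j l) t))) (Icc 0 τ) t) →
      (∀ i, ∀ t ∈ Icc 0 τ, HasDerivWithinAt (T i)
        (fderiv ℝ b₀ (X i t) (T i t) + fderiv ℝ b₁ (X i t) (T i t) (u t) + b₁ (X i t) (w t))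
        (Icc 0 τ) t) →
      (∀ t ∈ Icc 0 τ, (avg fun l => Φ (X (j l) t)) - u t = g t) → (∀ t ∈ Icc 0 τ, ‖g t‖ ≤ δ) →
      (∀ t ∈ Icc 0 τ, ‖w t - g t - avg fun l => fderiv ℝ Φ (X (j l) t) (T (j l) t)‖ ≤ η * δ) →
      ∀ i, ∀ t ∈ Icc 0 τ, ‖x i t - X i t‖ ≤ R * δ ∧ ‖x i t - X i t - T i t‖ ≤ ε * δ := by
  obtain ⟨M₀, hM₀⟩ := exists_fderiv_bound hC hb₀
  obtain ⟨M₁, hM₁⟩ := exists_fderiv_bound hC hb₁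
  obtain ⟨M₂, hM₂⟩ := exists_fderiv_bound hC hΦ
  obtain ⟨M₃, hM₃⟩ := hC.exists_bound_of_continuousOn (f := b₁)
    fun x hx => (hb₁ x hx).continuousAt.continuousWithinAt
  obtain ⟨M, hM1, hMM₀, hMM₁, hMM₂, hMM₃⟩ : ∃ M : ℝ, 1 ≤ M ∧ M₀ ≤ M ∧ M₁ ≤ M ∧ M₂ ≤ M ∧ M₃ ≤ M :=
    ⟨max 1 (max (max M₀ M₁) (max M₂ M₃)), by simp, by simp, by simp, by simp, by simp⟩
  set L : ℝ := M + 1 with hL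
  have hL0 : 0 < L := by linarith
  -- uniform first-order expansions
  have expand : ∀ ε > 0, ∃ r > 0, r ≤ 1 ∧ ∀ x ∈ C, ∀ y, ‖y - x‖ ≤ r →
      ‖b₀ y - b₀ x - fderiv ℝ b₀ x (y - x)‖ ≤ ε * ‖y - x‖ ∧
      ‖b₁ y - b₁ x - fderiv ℝ b₁ x (y - x)‖ ≤ ε * ‖y - x‖ ∧
      ‖Φ y - Φ x - fderiv ℝ Φ x (y - x)‖ ≤ ε * ‖y - x‖ := by
    intro ε hε
    obtain ⟨r₀, hr₀, h₀⟩ := exists_uniform_differentiable hC hb₀ hε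
    obtain ⟨r₁, hr₁, h₁⟩ := exists_uniform_differentiable hC hb₁ hε
    obtain ⟨r₂, hr₂, h₂⟩ := exists_uniform_differentiable hC hΦ hε
    refine ⟨min 1 (min r₀ (min r₁ r₂)), by positivity, min_le_left _ _, fun x hx y hy => ?_⟩
    simp only [le_min_iff] at hy
    exact ⟨h₀ x hx y hy.2.1, h₁ x hx y hy.2.2.1, h₂ x hx y hy.2.2.2⟩
  obtain ⟨r₁, hr₁, hr₁1, hexp₁⟩ := expand 1 one_pos
  have hlip : ∀ x ∈ C, ∀ y, ‖y - x‖ ≤ r₁ → ‖b₀ y - b₀ x‖ ≤ L * ‖y - x‖ ∧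
      ‖b₁ y - b₁ x‖ ≤ L * ‖y - x‖ ∧ ‖Φ y - Φ x‖ ≤ L * ‖y - x‖ := by
    intro x hx y hy
    obtain ⟨h₀, h₁, h₂⟩ := hexp₁ x hx y hy
    exact ⟨norm_sub_le_of_linear_approx h₀ ((hM₀ x hx).trans hMM₀),
      norm_sub_le_of_linear_approx h₁ ((hM₁ x hx).trans hMM₁),
      norm_sub_le_of_linear_approx h₂ ((hM₂ x hx).trans hMM₂)⟩
  set K₁ : ℝ := L + L * U + 2 * L * L + 1 with hK₁
  have hK₁1 : 1 ≤ K₁ := by rw [hK₁]; nlinarith [mul_nonneg hL0.le hU, mul_pos hL0 hL0]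
  set R : ℝ := 2 * L * Real.exp (K₁ * τ) with hR
  have hR0 : 0 < R := by positivity
  set K₂ : ℝ := M * (1 + U) + M * M with hK₂
  have hK₂1 : 1 ≤ K₂ := by rw [hK₂]; nlinarith
  set Q := Real.exp (K₂ * τ) with hQ
  have hQ0 : 0 < Q := Real.exp_pos _
  refine ⟨R, hR0.le, fun ε hε => ?_⟩
  set ε' : ℝ := ε / (2 * Q * (R * (1 + U + M))) with hε'
  have hden : 0 < 2 * Q * (R * (1 + U + M)) := by positivity
  have hε'0 : 0 < ε' := by positivity
  obtain ⟨r₂, hr₂, -, hexp₂⟩ := expand ε' hε'0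
  set S : ℝ := L * R * (1 + L * R) + M with hS
  have hS0 : 0 < S := by positivity
  set η : ℝ := min (min (r₁ / (2 * R)) (r₂ / R)) (ε / (2 * Q * S)) with hη
  refine ⟨η, by positivity, ?_⟩
  intro ι _ m j x X T u g w δ hδ hδη hXC hu h0 hT0 hX hx hT hg hgδ hw
  have hη1 : R * δ < r₁ := by
    have : δ ≤ r₁ / (2 * R) := hδη.trans ((min_le_left _ _).trans (min_le_left _ _))
    rw [le_div_iff₀ (by positivity)] at this
    nlinarith
  have hη2 : R * δ ≤ r₂ := by
    have : δ ≤ r₂ / R := hδη.trans ((min_le_left _ _).trans (min_le_right _ _))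
    rw [le_div_iff₀ (by positivity)] at this
    linarith
  have hη3 : Q * S * η ≤ ε / 2 := by
    have : η ≤ ε / (2 * Q * S) := min_le_right _ _
    rw [le_div_iff₀ (by positivity)] at this
    linarith
  have hη0 : 0 < η := by positivity
  have hnhds : ∀ t ∈ Ico 0 τ, Icc 0 τ ∈ 𝓝[Ici t] t := fun t ht =>
    Icc_mem_nhdsGE_of_mem ht
  set v : ℝ → F := fun t => (avg fun l => Φ (x (j l) t)) - u t with hv
  have hv_eq : ∀ t ∈ Icc 0 τ,
      v t = g t + avg fun l => Φ (x (j l) t) - Φ (X (j l) t) := by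
    intro t ht
    rw [avg_sub, ← hg t ht]
    simp only [hv]; abel
  -- the distance to the reference paths
  set e : ℝ → ι → E := fun t i => x i t - X i t with he
  have hv_le : ∀ t ∈ Icc 0 τ, ‖e t‖ ≤ r₁ → ‖v t‖ ≤ δ + L * ‖e t‖ := by
    intro t ht hr
    rw [hv_eq t ht]
    refine (norm_add_le _ _).trans (add_le_add (hgδ t ht) (norm_avg_le (by positivity) fun l => ?_))
    have hl : ‖x (j l) t - X (j l) t‖ ≤ ‖e t‖ := norm_le_pi_norm (e t) (j l)
    refine (hlip _ (hXC (j l) t ht) _ (hl.trans hr)).2.2.trans ?_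
    gcongr
  have hsplit : ∀ i t, (b₀ (x i t) + b₁ (x i t) (avg fun l => Φ (x (j l) t)))
      - (b₀ (X i t) + b₁ (X i t) (u t)) = (b₀ (x i t) - b₀ (X i t))
        + (b₁ (x i t) - b₁ (X i t)) (u t) + b₁ (x i t) (v t) := by
    intro i t
    simp only [hv, map_sub, sub_apply]
    abel
  have he_der : ∀ i, ∀ t ∈ Icc 0 τ, HasDerivWithinAt (fun t => e t i) ((b₀ (x i t) - b₀ (X i t))
        + (b₁ (x i t) - b₁ (X i t)) (u t) + b₁ (x i t) (v t)) (Icc 0 τ) t := by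
    intro i t ht
    rw [← hsplit]
    exact (hx i t ht).sub (hX i t ht)
  have he_le : ∀ t ∈ Icc 0 τ, ‖e t‖ ≤ R * δ := by
    have := norm_le_of_gronwall_bootstrap (f := e) (f' := fun t i => (b₀ (x i t) - b₀ (X i t))
        + (b₁ (x i t) - b₁ (X i t)) (u t) + b₁ (x i t) (v t)) (K := K₁) (δ := 2 * L * δ) (r := r₁)
      (τ := τ) hK₁1 (by positivity)
      (continuousOn_pi.2 fun i t ht => (he_der i t ht).continuousWithinAt)
      (fun t ht => hasDerivWithinAt_pi.2 fun i =>
        (he_der i t ⟨ht.1, ht.2.le⟩).mono_of_mem_nhdsWithin (hnhds t ht))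
      (funext fun i => by simp [he, h0 i]) (fun t ht hr => ?_) ?_
    · intro t ht
      exact (this t ht).trans (le_of_eq (by rw [hR]; ring))
    · refine (pi_norm_le_iff_of_nonneg (by positivity)).2 fun i => ?_
      have ht' : t ∈ Icc 0 τ := ⟨ht.1, ht.2.le⟩
      have hi : ‖x i t - X i t‖ ≤ ‖e t‖ := norm_le_pi_norm (e t) i
      obtain ⟨l₀, l₁, -⟩ := hlip _ (hXC i t ht') _ (hi.trans hr)
      have hb : ‖b₁ (x i t)‖ ≤ 2 * L := by
        have : ‖b₁ (x i t)‖ ≤ ‖b₁ (x i t) - b₁ (X i t)‖ + ‖b₁ (X i t)‖ := by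
          simpa using norm_add_le (b₁ (x i t) - b₁ (X i t)) (b₁ (X i t))
        have h3 := (hM₃ _ (hXC i t ht')).trans hMM₃
        have h4 : L * ‖x i t - X i t‖ ≤ L * 1 := by gcongr; exact (hi.trans hr).trans hr₁1
        linarith
      calc _ ≤ ‖b₀ (x i t) - b₀ (X i t)‖ + ‖(b₁ (x i t) - b₁ (X i t)) (u t)‖
              + ‖b₁ (x i t) (v t)‖ := norm_add₃_le
        _ ≤ L * ‖e t‖ + L * ‖e t‖ * U + 2 * L * (δ + L * ‖e t‖) := by
            refine add_le_add (add_le_add (l₀.trans (by gcongr)) ?_) ?_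
            · exact (le_opNorm_of_le' (l₁.trans (by gcongr)) (hu t ht'))
            · exact le_opNorm_of_le' hb (hv_le t ht' hr)
        _ ≤ K₁ * ‖e t‖ + 2 * L * δ := by
            rw [hK₁]; nlinarith [norm_nonneg (e t)]
    · calc 2 * L * δ * Real.exp (K₁ * τ) = R * δ := by rw [hR]; ring
        _ < r₁ := hη1
  -- the error of the linearization
  set q : ℝ → ι → E := fun t i => x i t - X i t - T i t with hq
  have hq_der : ∀ i, ∀ t ∈ Icc 0 τ, HasDerivWithinAt (fun t => q t i) ((b₀ (x i t) - b₀ (X i t))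
        + (b₁ (x i t) - b₁ (X i t)) (u t) + b₁ (x i t) (v t) - (fderiv ℝ b₀ (X i t) (T i t)
        + fderiv ℝ b₁ (X i t) (T i t) (u t) + b₁ (X i t) (w t))) (Icc 0 τ) t :=
    fun i t ht => (he_der i t ht).sub (hT i t ht)
  have hvw : ∀ t ∈ Icc 0 τ, ‖v t - w t‖ ≤ ε' * (R * δ) + M * ‖q t‖ + η * δ := by
    intro t ht
    have : v t - w t =
        (avg fun l => Φ (x (j l) t) - Φ (X (j l) t)
          - fderiv ℝ Φ (X (j l) t) (x (j l) t - X (j l) t))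
        + (avg fun l => fderiv ℝ Φ (X (j l) t) (q t (j l)))
        - (w t - g t - avg fun l => fderiv ℝ Φ (X (j l) t) (T (j l) t)) := by
      have h1 : (fun l => fderiv ℝ Φ (X (j l) t) (q t (j l))) = fun l =>
          fderiv ℝ Φ (X (j l) t) (x (j l) t - X (j l) t) - fderiv ℝ Φ (X (j l) t) (T (j l) t) := by
        funext l; simp only [hq, map_sub]
      rw [hv_eq t ht, h1]
      simp only [avg_sub]
      abel
    rw [this]
    refine (norm_sub_le _ _).trans (add_le_add ((norm_add_le _ _).trans (add_le_add ?_ ?_)) (hw t ht))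
    · refine norm_avg_le (by positivity) fun l => ?_
      have hl : ‖x (j l) t - X (j l) t‖ ≤ R * δ := (norm_le_pi_norm (e t) (j l)).trans (he_le t ht)
      exact (hexp₂ _ (hXC _ t ht) _ (hl.trans hη2)).2.2.trans (by gcongr)
    · refine norm_avg_le (by positivity) fun l => ?_
      exact le_opNorm_of_le' ((hM₂ _ (hXC _ t ht)).trans hMM₂) (norm_le_pi_norm (q t) (j l))
  have hq_le : ∀ t ∈ Icc 0 τ, ‖q t‖ ≤ ε * δ := by
    set κ : ℝ := (ε' * (R * (1 + U + M)) + S * η) * δ with hκ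
    have hκ0 : 0 ≤ κ := by positivity
    have hκε : κ * Q ≤ ε * δ := by
      have h1 : ε' * (R * (1 + U + M)) * Q = ε / 2 := by
        rw [hε']; field_simp
      calc κ * Q = (ε' * (R * (1 + U + M)) * Q + Q * S * η) * δ := by rw [hκ]; ring
        _ ≤ (ε / 2 + ε / 2) * δ := by rw [h1]; gcongr
        _ = ε * δ := by ring
    have := norm_le_of_gronwall_bootstrap (f := q) (K := K₂) (δ := κ) (r := κ * Q + 1)
      (τ := τ) hK₂1 hκ0
      (continuousOn_pi.2 fun i t ht => (hq_der i t ht).continuousWithinAt)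
      (fun t ht => hasDerivWithinAt_pi.2 fun i =>
        (hq_der i t ⟨ht.1, ht.2.le⟩).mono_of_mem_nhdsWithin (hnhds t ht))
      (funext fun i => by simp [hq, h0 i, hT0 i]) (fun t ht _ => ?_) (by rw [hQ]; linarith)
    · exact fun t ht => (this t ht).trans hκε
    · refine (pi_norm_le_iff_of_nonneg (by positivity)).2 fun i => ?_
      have ht' : t ∈ Icc 0 τ := ⟨ht.1, ht.2.le⟩
      have hi : ‖x i t - X i t‖ ≤ R * δ := (norm_le_pi_norm (e t) i).trans (he_le t ht')
      have hqi : ‖q t i‖ ≤ ‖q t‖ := norm_le_pi_norm (q t) i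
      obtain ⟨x₀, x₁, -⟩ := hexp₂ _ (hXC i t ht') _ (hi.trans hη2)
      obtain ⟨-, l₁, -⟩ := hlip _ (hXC i t ht') _ (hi.trans hη1.le)
      have hvt : ‖v t‖ ≤ (1 + L * R) * δ := by
        refine (hv_le t ht' ((he_le t ht').trans hη1.le)).trans ?_
        have := he_le t ht'
        nlinarith
      have hB := (hM₃ _ (hXC i t ht')).trans hMM₃
      have hD₀ := (hM₀ _ (hXC i t ht')).trans hMM₀
      have hD₁ := (hM₁ _ (hXC i t ht')).trans hMM₁
      have hdecomp : (b₀ (x i t) - b₀ (X i t))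
          + (b₁ (x i t) - b₁ (X i t)) (u t) + b₁ (x i t) (v t) - (fderiv ℝ b₀ (X i t) (T i t)
          + fderiv ℝ b₁ (X i t) (T i t) (u t) + b₁ (X i t) (w t)) =
          (b₀ (x i t) - b₀ (X i t) - fderiv ℝ b₀ (X i t) (x i t - X i t))
          + (b₁ (x i t) - b₁ (X i t) - fderiv ℝ b₁ (X i t) (x i t - X i t)) (u t)
          + fderiv ℝ b₀ (X i t) (q t i) + fderiv ℝ b₁ (X i t) (q t i) (u t)
          + (b₁ (x i t) - b₁ (X i t)) (v t) + b₁ (X i t) (v t - w t) := by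
        simp only [hq, map_sub, sub_apply]
        abel
      rw [hdecomp]
      calc _ ≤ ε' * (R * δ) + ε' * (R * δ) * U + M * ‖q t‖ + M * ‖q t‖ * U
              + L * (R * δ) * ((1 + L * R) * δ) + M * (ε' * (R * δ) + M * ‖q t‖ + η * δ) := by
            refine norm_add_le_of_le (norm_add_le_of_le (norm_add_le_of_le (norm_add_le_of_le
              (norm_add_le_of_le ?_ ?_) ?_) ?_) ?_) ?_
            · exact x₀.trans (by gcongr)
            · exact le_opNorm_of_le' (x₁.trans (by gcongr)) (hu t ht')
            · exact le_opNorm_of_le' hD₀ hqi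
            · exact le_opNorm_of_le' (le_opNorm_of_le' hD₁ hqi) (hu t ht')
            · exact le_opNorm_of_le' (l₁.trans (by gcongr)) hvt
            · exact le_opNorm_of_le' hB (hvw t ht')
        _ ≤ K₂ * ‖q t‖ + κ := by
            have h1 : L * (R * δ) * ((1 + L * R) * δ) ≤ L * R * (1 + L * R) * η * δ := by
              calc _ = L * R * (1 + L * R) * δ * δ := by ring
                _ ≤ _ := by gcongr
            refine le_of_le_of_eq (add_le_add_left (add_le_add_right h1 _) _) ?_
            rw [hκ, hK₂, hS]; ring
  exact fun i t ht => ⟨(norm_le_pi_norm (e t) i).trans (he_le t ht),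
    (norm_le_pi_norm (q t) i).trans (hq_le t ht)⟩

end Linearization

/-! ### Isonormal Gaussian processes -/

section Isonormal

/-- Every real Hilbert space embeds isometrically into a space of centered Gaussian variables. -/
theorem exists_isonormal (H : Type) [NormedAddCommGroup H] [InnerProductSpace ℝ H]
    [CompleteSpace H] :
    ∃ (S : Type) (_ : MeasurableSpace S) (P : Measure S) (_ : IsProbabilityMeasure P)
      (I : H →ₗᵢ[ℝ] Lp ℝ 2 P), ∀ f, P.map (I f) = gaussianReal 0 (‖f‖₊ ^ 2) := by
  obtain ⟨w, b, -⟩ := exists_hilbertBasis ℝ H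
  set P : Measure (w → ℝ) := Measure.infinitePi fun _ => gaussianReal 0 1 with hP
  have hmp : ∀ i, MeasurePreserving (Function.eval i) P (gaussianReal 0 1) := fun i =>
    measurePreserving_eval_infinitePi _ i
  have hmem : ∀ i : w, MemLp (fun s : w → ℝ => s i) 2 P := fun i =>
    (memLp_id_gaussianReal (μ := 0) (v := 1) 2).comp_measurePreserving (hmp i)
  have hind : iIndepFun (fun (i : w) (s : w → ℝ) => s i) P :=
    iIndepFun_infinitePi (X := fun _ x => x) fun _ => measurable_id
  have hlaw : ∀ i : w, HasLaw (fun s : w → ℝ => s i) (gaussianReal 0 1) P := fun i =>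
    ⟨(hmp i).aemeasurable, (hmp i).map_eq⟩
  have hmean : ∀ i : w, ∫ s, s i ∂P = 0 := fun i => by
    rw [(hlaw i).integral_eq, integral_id_gaussianReal]
  have hvar : ∀ i : w, ∫ s, s i * s i ∂P = 1 := fun i => by
    have h1 := (hlaw i).variance_eq
    rw [variance_id_gaussianReal, variance_of_integral_eq_zero (hmp i).aemeasurable (hmean i)] at h1
    simpa [sq] using h1
  set ξ : w → Lp ℝ 2 P := fun i => (hmem i).toLp _ with hξ
  have hinner : ∀ i j, inner ℝ (ξ i) (ξ j) = ∫ s, s i * s j ∂P := by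
    intro i j
    rw [L2.inner_def]
    refine integral_congr_ae ?_
    filter_upwards [(hmem i).coeFn_toLp, (hmem j).coeFn_toLp] with s hi hj
    simp only [hξ, hi, hj]
    simp [mul_comm]
  have hort : Orthonormal ℝ ξ := by
    classical
    rw [orthonormal_iff_ite]
    intro i j
    rw [hinner]
    split_ifs with hij
    · subst hij; exact hvar i
    · have := (hind.indepFun hij).integral_mul_eq_mul_integral (hmem i).1 (hmem j).1
      rw [hmean, zero_mul] at this
      exact this
  classical
  obtain ⟨J, hJ⟩ : ∃ J : lp (fun _ : w => ℝ) 2 →ₗᵢ[ℝ] Lp ℝ 2 P,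
      ∀ i, J (lp.single 2 i (1 : ℝ)) = ξ i :=
    ⟨hort.orthogonalFamily.linearIsometry, fun i => by
      rw [OrthogonalFamily.linearIsometry_apply_single]
      simp⟩
  set I : H →ₗᵢ[ℝ] Lp ℝ 2 P := J.comp b.repr.toLinearIsometry with hI
  have hIb : ∀ i, I (b i) = ξ i := by
    intro i
    change J (b.repr (b i)) = ξ i
    rw [b.repr_self, hJ]
  -- Gaussian laws are closed under `L²`-limits, and finite linear combinations of the
  -- independent coordinates are Gaussian
  have hchar : ∀ f : H, ∀ t : ℝ,
      charFun (P.map (I f)) t = Complex.exp (-((‖f‖ : ℂ) ^ 2 * t ^ 2 / 2)) := by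
    intro f
    have hdense : Dense (Submodule.span ℝ (range b) : Set H) :=
      Submodule.dense_iff_topologicalClosure_eq_top.2 b.dense_span
    obtain ⟨u, hu, hlim⟩ := mem_closure_iff_seq_limit.1 (hdense f)
    have hspan : ∀ g ∈ Submodule.span ℝ (range b), ∀ t : ℝ,
        charFun (P.map (I g)) t = Complex.exp (-((‖g‖ : ℂ) ^ 2 * t ^ 2 / 2)) := by
      intro g hg t
      obtain ⟨c, rfl⟩ := Finsupp.mem_span_range_iff_exists_finsupp.1 hg
      have hae : (I (c.sum fun i a => a • b i) : (w → ℝ) → ℝ) =ᵐ[P]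
          fun s => ∑ i ∈ c.support, c i * s i := by
        rw [Finsupp.sum, map_sum]
        simp_rw [map_smul, hIb]
        have h1 := Lp.coeFn_fun_finsetSum (μ := P) c.support fun i => c i • ξ i
        have h2 : ∀ᵐ s ∂P, ∀ i ∈ c.support, (c i • ξ i : Lp ℝ 2 P) s = c i * s i := by
          refine (ae_ball_iff c.support.countable_toSet).2 fun i _ => ?_
          filter_upwards [Lp.coeFn_smul (c i) (ξ i), (hmem i).coeFn_toLp] with s e1 e2
          rw [e1, Pi.smul_apply, hξ, e2, smul_eq_mul]
        filter_upwards [h1, h2] with s e1 e2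
        rw [e1]
        exact Finset.sum_congr rfl e2
      have hnorm : ‖c.sum fun i a => a • b i‖ ^ 2 = ∑ i ∈ c.support, c i ^ 2 := by
        rw [← real_inner_self_eq_norm_sq, Finsupp.sum, b.orthonormal.inner_sum]
        simp [sq]
      rw [Measure.map_congr hae]
      have hind' : iIndepFun (fun (i : w) (s : w → ℝ) => c i * s i) P :=
        hind.comp (fun i x => c i * x) fun i => by fun_prop
      rw [(hind'.restrict c.support).charFun_map_fun_finsetSum_eq_prod
        (fun i _ => (hmem i).1.aemeasurable.const_mul (c i)), Finset.prod_apply]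
      have hone : ∀ i, charFun (P.map fun s : w → ℝ => c i * s i) t
          = Complex.exp (-((c i : ℂ) ^ 2 * t ^ 2 / 2)) := by
        intro i
        rw [charFun_map_mul_comp (hmem i).1.aemeasurable, (hlaw i).map_eq, charFun_gaussianReal]
        push_cast
        ring_nf
      simp_rw [hone]
      rw [← Complex.exp_sum]
      have : ((‖c.sum fun i a => a • b i‖ : ℝ) : ℂ) ^ 2 = ∑ i ∈ c.support, (c i : ℂ) ^ 2 := by
        exact_mod_cast congrArg (Complex.ofReal) hnorm
      rw [this, Finset.sum_neg_distrib, Finset.sum_mul, Finset.sum_div]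
    have hd : TendstoInDistribution (fun n => (I (u n) : (w → ℝ) → ℝ)) atTop (I f) (fun _ => P) P :=
      (tendstoInMeasure_of_tendsto_Lp
        ((I.continuous.tendsto f).comp hlim)).tendstoInDistribution
        fun n => (Lp.aestronglyMeasurable _).aemeasurable
    intro t
    have h1 := (ProbabilityMeasure.tendsto_iff_tendsto_charFun.1 hd.tendsto) t
    have h2 : Tendsto (fun n => Complex.exp (-((‖u n‖ : ℂ) ^ 2 * t ^ 2 / 2))) atTop
        (𝓝 (Complex.exp (-((‖f‖ : ℂ) ^ 2 * t ^ 2 / 2)))) := by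
      have : Continuous fun g : H => Complex.exp (-((‖g‖ : ℂ) ^ 2 * t ^ 2 / 2)) := by fun_prop
      exact (this.tendsto f).comp hlim
    refine tendsto_nhds_unique h1 (h2.congr fun n => ?_)
    exact (hspan _ (hu n) t).symm
  refine ⟨w → ℝ, inferInstance, P, inferInstance, I, fun f => Measure.ext_of_charFun ?_⟩
  ext t
  rw [hchar, charFun_gaussianReal]
  simp

end Isonormal

/-! ### The Gaussian fluctuation field -/

section Fluctuation

/-- An isonormal process on the orthogonal complement of the constants: a continuous linear map
into a space of centered Gaussian variables whose covariance form is that of `μ`. -/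
theorem exists_centered_isonormal {α : Type} [MeasurableSpace α] (μ : Measure α)
    [IsProbabilityMeasure μ] :
    ∃ (S : Type) (_ : MeasurableSpace S) (P : Measure S) (_ : IsProbabilityMeasure P)
      (Z : Lp ℝ 2 μ →L[ℝ] Lp ℝ 2 P), (∀ f, HasGaussianLaw (Z f) P) ∧ (∀ f, ∫ s, Z f s ∂P = 0) ∧
      ∀ f g, inner ℝ (Z f) (Z g) = ∫ θ, f θ * g θ ∂μ - (∫ θ, f θ ∂μ) * ∫ θ, g θ ∂μ := by
  obtain ⟨S, _, P, hP, I, hI⟩ := exists_isonormal (Lp ℝ 2 μ)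
  set e : Lp ℝ 2 μ := (memLp_const (1 : ℝ)).toLp _ with he
  have hint : ∀ f : Lp ℝ 2 μ, inner ℝ e f = ∫ θ, f θ ∂μ := by
    intro f
    rw [L2.inner_def]
    refine integral_congr_ae ?_
    filter_upwards [(memLp_const (μ := μ) (p := 2) (1 : ℝ)).coeFn_toLp] with θ hθ
    rw [he, hθ]; simp
  have hee : inner ℝ e e = (1 : ℝ) := by
    rw [hint, integral_congr_ae (memLp_const (μ := μ) (p := 2) (1 : ℝ)).coeFn_toLp]
    simp
  set c : Lp ℝ 2 μ →L[ℝ] Lp ℝ 2 μ :=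
    ContinuousLinearMap.id ℝ _ - (innerSL ℝ e).smulRight e with hc
  have hcc : ∀ f g, inner ℝ (c f) (c g) = inner ℝ f g - inner ℝ e f * inner ℝ e g := by
    intro f g
    have happ : ∀ f, c f = f - (inner ℝ e f : ℝ) • e := fun f => by simp [hc]
    rw [happ, happ, inner_sub_left, inner_sub_right, inner_sub_right, inner_smul_left,
      inner_smul_right, inner_smul_left, inner_smul_right, hee, real_inner_comm e f]
    simp
    ring
  have hlaw : ∀ f, HasLaw (I (c f)) (gaussianReal 0 (‖c f‖₊ ^ 2)) P := fun f =>
    ⟨(Lp.aestronglyMeasurable _).aemeasurable, hI _⟩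
  refine ⟨S, inferInstance, P, hP, I.toContinuousLinearMap ∘L c, fun f => (hlaw f).hasGaussianLaw,
    fun f => ?_, fun f g => ?_⟩
  · exact (hlaw f).integral_eq.trans integral_id_gaussianReal
  · change inner ℝ (I (c f)) (I (c g)) = _
    rw [I.inner_map_map, hcc, hint, hint, L2.inner_def]
    simp [mul_comm]

variable {α S : Type} [MeasurableSpace α] [MeasurableSpace S] {μ : Measure α}
  {P : Measure S}

open Classical in
/-- The process indexed by functions which is induced by a map defined on `L²`-classes; it
vanishes on functions that are not square-integrable. -/
def processOfLp (Z : Lp ℝ 2 μ →L[ℝ] Lp ℝ 2 P) (f : α → ℝ) : S → ℝ :=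
  if h : MemLp f 2 μ then Z (h.toLp f) else 0

lemma processOfLp_of_memLp (Z : Lp ℝ 2 μ →L[ℝ] Lp ℝ 2 P) {f : α → ℝ} (h : MemLp f 2 μ) :
    processOfLp Z f = Z (h.toLp f) := dif_pos h

lemma processOfLp_congr (Z : Lp ℝ 2 μ →L[ℝ] Lp ℝ 2 P) {f g : α → ℝ} (hf : MemLp f 2 μ)
    (hfg : f =ᵐ[μ] g) : processOfLp Z f = processOfLp Z g := by
  have hg : MemLp g 2 μ := (memLp_congr_ae hfg).1 hf
  rw [processOfLp_of_memLp Z hf, processOfLp_of_memLp Z hg, MemLp.toLp_congr hf hg hfg]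

lemma processOfLp_add (Z : Lp ℝ 2 μ →L[ℝ] Lp ℝ 2 P) {f g : α → ℝ} (hf : MemLp f 2 μ)
    (hg : MemLp g 2 μ) :
    processOfLp Z (fun θ => f θ + g θ) =ᵐ[P] fun s => processOfLp Z f s + processOfLp Z g s := by
  rw [processOfLp_of_memLp Z hf, processOfLp_of_memLp Z hg,
    processOfLp_of_memLp Z (f := fun θ => f θ + g θ) (hf.add hg),
    show MemLp.toLp (fun θ => f θ + g θ) (hf.add hg) = hf.toLp f + hg.toLp g from rfl, map_add]
  exact Lp.coeFn_add _ _

lemma processOfLp_sum_smul (Z : Lp ℝ 2 μ →L[ℝ] Lp ℝ 2 P) {J : Type*} (s : Finset J) (a : J → ℝ)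
    {f : J → α → ℝ} (hf : ∀ j, MemLp (f j) 2 μ) :
    processOfLp Z (fun θ => ∑ j ∈ s, a j * f j θ)
      =ᵐ[P] fun ω => ∑ j ∈ s, a j * processOfLp Z (f j) ω := by
  classical
  have hm : ∀ s : Finset J, MemLp (fun θ => ∑ j ∈ s, a j * f j θ) 2 μ := fun s =>
    memLp_finsetSum s fun j _ => (hf j).const_mul (a j)
  induction s using Finset.induction_on with
  | empty =>
    have h0 : MemLp (fun _ : α => (0 : ℝ)) 2 μ := MemLp.zero
    simp only [Finset.sum_empty]
    rw [processOfLp_of_memLp Z h0, show h0.toLp _ = 0 from rfl, map_zero]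
    exact Lp.coeFn_zero _ _ _
  | insert j s hj ih =>
    have h1 : processOfLp Z (fun θ => a j * f j θ) =ᵐ[P] fun ω => a j * processOfLp Z (f j) ω := by
      rw [processOfLp_of_memLp Z (hf j), processOfLp_of_memLp Z ((hf j).const_mul (a j)),
        show MemLp.toLp (fun θ => a j * f j θ) ((hf j).const_mul (a j)) = a j • (hf j).toLp (f j)
        from rfl, map_smul]
      exact Lp.coeFn_smul _ _
    simp_rw [Finset.sum_insert hj]
    filter_upwards [processOfLp_add Z ((hf j).const_mul (a j)) (hm s), h1, ih] with ω e1 e2 e3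
    rw [e1, e2, e3]

/-- Linear functionals of an `L²` random vector `Ψ` with values in a separable Hilbert space
have Gaussian counterparts `Z (ℓ ∘ Ψ)`; these are the linear functionals of a single random
vector `Y`. The coordinates of `Y` in a Hilbert basis are square-summable because
`∑ ‖Z ⟪bⱼ, Ψ⟫‖² ≤ ‖Z‖² 𝔼 ‖Ψ‖²`. -/
theorem exists_hilbert_counterpart [IsFiniteMeasure P] {H : Type*} [NormedAddCommGroup H]
    [InnerProductSpace ℝ H] [CompleteSpace H] [TopologicalSpace.SeparableSpace H]
    (Z : Lp ℝ 2 μ →L[ℝ] Lp ℝ 2 P) {Ψ : α → H} (hΨ : MemLp Ψ 2 μ) :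
    ∃ Y : S → H, ∀ L : H →L[ℝ] ℝ, ∀ᵐ s ∂P, L (Y s) = processOfLp Z (fun θ => L (Ψ θ)) s := by
  obtain ⟨w, b, hb⟩ := exists_hilbertBasis ℝ H
  have hcount : Countable w := by
    have hdist : ∀ i j : w, i ≠ j → (1 : ℝ) ≤ dist (b i) (b j) := by
      intro i j hij
      have h1 : ‖b i - b j‖ ^ 2 = 2 := by
        rw [norm_sub_sq_real, b.orthonormal.2 hij, b.orthonormal.1 i, b.orthonormal.1 j]
        norm_num
      rw [dist_eq_norm]
      nlinarith [norm_nonneg (b i - b j)]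
    have hdisj : (univ : Set w).PairwiseDisjoint fun i => Metric.ball (b i) (1 / 2) :=
      fun i _ j _ hij => Metric.ball_disjoint_ball (by linarith [hdist i j hij])
    exact countable_univ_iff.1 (hdisj.countable_of_isOpen (fun i _ => Metric.isOpen_ball)
      fun i _ => ⟨b i, Metric.mem_ball_self (by norm_num)⟩)
  -- the map `h ↦ Z ⟪h, Ψ⟫`
  set ψ : Lp H 2 μ := hΨ.toLp Ψ with hψ
  set q : H →L[ℝ] Lp ℝ 2 μ := LinearMap.mkContinuous
    { toFun := fun h => (innerSL ℝ h).compLpL 2 μ ψ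
      map_add' := fun x y => by simp [ContinuousLinearMap.add_compLpL]
      map_smul' := fun r x => by simp [ContinuousLinearMap.smul_compLpL] } ‖ψ‖
    (fun h => by
      refine (((innerSL ℝ h).compLpL 2 μ).le_opNorm ψ).trans ?_
      rw [mul_comm]
      gcongr
      exact (ContinuousLinearMap.norm_compLpL_le _).trans (by simp)) with hq
  have hq_ae : ∀ h, (q h : α → ℝ) =ᵐ[μ] fun θ => inner ℝ h (Ψ θ) := by
    intro h
    have h1 := ContinuousLinearMap.coeFn_compLpL (p := 2) (μ := μ) (innerSL ℝ h) ψ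
    filter_upwards [h1, hΨ.coeFn_toLp] with θ e1 e2
    change ((innerSL ℝ h).compLpL 2 μ ψ) θ = _
    rw [e1, hψ, e2]; rfl
  have hW : ∀ h, processOfLp Z (fun θ => inner ℝ h (Ψ θ)) = Z (q h) := by
    intro h
    have hm : MemLp (fun θ => inner ℝ h (Ψ θ)) 2 μ := (memLp_congr_ae (hq_ae h)).1 (Lp.memLp _)
    rw [processOfLp_of_memLp Z hm]
    rw [Lp.ext (hm.coeFn_toLp.trans (hq_ae h).symm)]
  have hnorm : ∀ {T : Type} [MeasurableSpace T] (ν : Measure T) (f : Lp ℝ 2 ν),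
      ‖f‖ ^ 2 = ∫ t, f t ^ 2 ∂ν := by
    intro T _ ν f
    rw [← real_inner_self_eq_norm_sq, L2.inner_def]
    simp [sq]
  have hsq : ∀ {T : Type} [MeasurableSpace T] (ν : Measure T) (f : Lp ℝ 2 ν),
      Integrable (fun t => f t ^ 2) ν := fun ν f => (Lp.memLp f).integrable_sq
  -- square-summability
  have hbound : ∀ s : Finset w, ∑ j ∈ s, ‖q (b j)‖ ^ 2 ≤ ∫ θ, ‖Ψ θ‖ ^ 2 ∂μ := by
    intro s
    simp_rw [hnorm μ]
    rw [← integral_finsetSum _ fun j _ => hsq μ _]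
    refine integral_mono_ae (integrable_finsetSum _ fun j _ => hsq μ _) ((memLp_two_iff_integrable_sq_norm hΨ.1).1 hΨ) ?_
    have hall : ∀ᵐ θ ∂μ, ∀ j, q (b j) θ = inner ℝ (b j) (Ψ θ) := ae_all_iff.2 fun j => hq_ae _
    filter_upwards [hall] with θ hθ
    simp_rw [hθ]
    have := b.orthonormal.sum_inner_products_le (x := Ψ θ) (s := s)
    simpa using this
  have hsumm : Summable fun j => ‖Z (q (b j))‖ ^ 2 := by
    have h1 : Summable fun j => ‖q (b j)‖ ^ 2 :=
      summable_of_sum_le (fun j => by positivity) hbound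
    refine (h1.mul_left (‖Z‖ ^ 2)).of_nonneg_of_le (fun j => by positivity) fun j => ?_
    rw [← mul_pow]
    exact pow_le_pow_left₀ (norm_nonneg _) (Z.le_opNorm _) 2
  have hae : ∀ᵐ s ∂P, Summable fun j => (Z (q (b j)) s) ^ 2 := by
    have h1 : ∫⁻ s, ∑' j, ENNReal.ofReal ((Z (q (b j)) s) ^ 2) ∂P ≠ ⊤ := by
      rw [lintegral_tsum fun j =>
        ((Lp.aestronglyMeasurable (Z (q (b j)))).aemeasurable.pow_const 2).ennreal_ofReal]
      have : ∀ j, ∫⁻ s, ENNReal.ofReal ((Z (q (b j)) s) ^ 2) ∂P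
          = ENNReal.ofReal (‖Z (q (b j))‖ ^ 2) := fun j => by
        rw [hnorm P, ofReal_integral_eq_lintegral_ofReal (hsq P _) (ae_of_all _ fun s => sq_nonneg _)]
      simp_rw [this]
      exact hsumm.tsum_ofReal_ne_top
    filter_upwards [ae_lt_top' (AEMeasurable.tsum fun j =>
      ((Lp.aestronglyMeasurable (Z (q (b j)))).aemeasurable.pow_const 2).ennreal_ofReal) h1] with s hs
    have := ENNReal.summable_toReal hs.ne
    simpa [ENNReal.toReal_ofReal (sq_nonneg _)] using this
  set Y : S → H := fun s => ∑' j, Z (q (b j)) s • b j with hY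
  have hYsum : ∀ᵐ s ∂P, HasSum (fun j => Z (q (b j)) s • b j) (Y s) := by
    filter_upwards [hae] with s hs
    have h1 := (b.orthonormal.orthogonalFamily.summable_iff_norm_sq_summable
      (fun j => Z (q (b j)) s)).2 (by simpa using hs)
    have h2 : Summable fun j => Z (q (b j)) s • b j := by simpa using h1
    exact h2.hasSum
  refine ⟨Y, fun L => ?_⟩
  obtain ⟨h, rfl⟩ := (InnerProductSpace.toDual ℝ H).surjective L
  simp only [InnerProductSpace.toDual_apply_apply]
  rw [hW]
  -- the partial sums converge both almost surely and in `L²`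
  obtain ⟨σ, hσ⟩ := (atTop : Filter (Finset w)).exists_seq_tendsto
  have hpart : ∀ n, (Z (q (∑ j ∈ σ n, b.repr h j • b j)) : S → ℝ) =ᵐ[P]
      fun s => inner ℝ h (∑ j ∈ σ n, Z (q (b j)) s • b j) := by
    intro n
    simp_rw [map_sum, map_smul]
    have h1 := Lp.coeFn_fun_finsetSum (μ := P) (σ n) fun j => b.repr h j • Z (q (b j))
    have h2 : ∀ᵐ s ∂P, ∀ j, (b.repr h j • Z (q (b j)) : Lp ℝ 2 P) s = b.repr h j * Z (q (b j)) s :=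
      ae_all_iff.2 fun j => Lp.coeFn_smul _ _
    filter_upwards [h1, h2] with s e1 e2
    rw [e1, inner_sum]
    refine Finset.sum_congr rfl fun j _ => ?_
    rw [e2, inner_smul_right, b.repr_apply_apply, real_inner_comm, mul_comm]
  have lim1 : TendstoInMeasure P (fun n => (Z (q (∑ j ∈ σ n, b.repr h j • b j)) : S → ℝ)) atTop
      (Z (q h)) :=
    tendstoInMeasure_of_tendsto_Lp
      (((Z ∘L q).continuous.tendsto h).comp ((b.hasSum_repr h).comp hσ))
  have lim2 : TendstoInMeasure P (fun n => (Z (q (∑ j ∈ σ n, b.repr h j • b j)) : S → ℝ)) atTop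
      (fun s => inner ℝ h (Y s)) := by
    refine tendstoInMeasure_of_tendsto_ae (fun n => Lp.aestronglyMeasurable _) ?_
    filter_upwards [ae_all_iff.2 hpart, hYsum] with s e1 e2
    simp_rw [e1]
    exact ((continuous_const.inner continuous_id).tendsto (Y s)).comp (e2.comp hσ)
  exact tendstoInMeasure_ae_unique lim2 lim1

/-- A centered isonormal process is a Gaussian random measure with the covariance of an empirical
fluctuation. -/
theorem isGaussianFluctuation_processOfLp {k : ℕ} {μ₀ : Measure (Euc k)} [IsProbabilityMeasure P]
    {Z : Lp ℝ 2 μ₀ →L[ℝ] Lp ℝ 2 P} (hgauss : ∀ f, HasGaussianLaw (Z f) P)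
    (hmean : ∀ f, ∫ s, Z f s ∂P = 0)
    (hcov : ∀ f g, inner ℝ (Z f) (Z g) = ∫ θ, f θ * g θ ∂μ₀ - (∫ θ, f θ ∂μ₀) * ∫ θ, g θ ∂μ₀) :
    IsGaussianFluctuation μ₀ P (processOfLp Z) where
  gaussian := by
    classical
    refine ⟨fun J => ⟨isGaussian_of_map_eq_gaussianReal fun L => ?_⟩⟩
    have haem : ∀ j : J, AEMeasurable (processOfLp Z j.1.1) P := fun j => by
      rw [processOfLp_of_memLp Z j.1.2]
      exact (Lp.aestronglyMeasurable _).aemeasurable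
    have hae := processOfLp_sum_smul Z Finset.univ (fun j : J => L (Pi.single j 1))
      (f := fun j => j.1.1) fun j => j.1.2
    have hm : MemLp (fun θ => ∑ j : J, L (Pi.single j 1) * j.1.1 θ) 2 μ₀ :=
      memLp_finsetSum _ fun j _ => j.1.2.const_mul _
    rw [processOfLp_of_memLp Z hm] at hae
    have h1 := (hgauss (hm.toLp _)).map_eq_gaussianReal
    refine ⟨_, _, Eq.trans ?_ h1⟩
    have haev : AEMeasurable (fun ω => J.restrict fun x => processOfLp Z x.1 ω) P :=
      aemeasurable_pi_lambda _ fun j => haem j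
    rw [AEMeasurable.map_map_of_aemeasurable (by fun_prop) haev]
    refine Measure.map_congr ?_
    filter_upwards [hae] with s hs
    rw [hs]
    have : ∀ v : J → ℝ, L v = ∑ j, L (Pi.single j 1) * v j := by
      intro v
      conv_lhs => rw [← Finset.univ_sum_single v, map_sum]
      refine Finset.sum_congr rfl fun j _ => ?_
      rw [mul_comm, ← smul_eq_mul, ← map_smul]
      congr 1
      ext i
      by_cases hij : i = j
      · subst hij; simp
      · simp [hij]
    rw [Function.comp_apply, this]
    rfl
  mean_eq_zero f hf := by rw [processOfLp_of_memLp Z hf, hmean]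
  covariance_eq f g hf hg := by
    rw [processOfLp_of_memLp Z hf, processOfLp_of_memLp Z hg,
      covariance_eq_sub (Lp.memLp _) (Lp.memLp _), hmean, hmean, mul_zero, sub_zero]
    have h1 := hcov (hf.toLp f) (hg.toLp g)
    rw [L2.inner_def] at h1
    simp only [RCLike.inner_apply, conj_trivial] at h1
    have h2 : ∫ s, (Z (hf.toLp f) * Z (hg.toLp g) : S → ℝ) s ∂P
        = ∫ s, Z (hg.toLp g) s * Z (hf.toLp f) s ∂P := by simp [mul_comm]
    rw [h2, h1, integral_congr_ae hf.coeFn_toLp, integral_congr_ae hg.coeFn_toLp]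
    congr 1
    refine integral_congr_ae ?_
    filter_upwards [hf.coeFn_toLp, hg.coeFn_toLp] with θ e1 e2
    rw [e1, e2]

end Fluctuation

/-! ### Differentiable paths as vectors of a Hilbert space -/

section PathEmbedding

lemma lp_dist_sq {F : Type*} [NormedAddCommGroup F] [InnerProductSpace ℝ F] {f g : ℝ → F}
    (hf : MemLp f 2 (volume : Measure ℝ)) (hg : MemLp g 2 (volume : Measure ℝ)) :
    dist (hf.toLp f) (hg.toLp g) ^ 2 = ∫ s, ‖f s - g s‖ ^ 2 := by
  rw [dist_eq_norm, ← MemLp.toLp_sub hf hg, ← real_inner_self_eq_norm_sq, L2.inner_def]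
  refine integral_congr_ae ?_
  filter_upwards [(hf.sub hg).coeFn_toLp] with s hs
  rw [hs, real_inner_self_eq_norm_sq]; rfl

/-- Dominated convergence for families in `L²(ℝ)`. -/
lemma continuousAt_toLp {X F : Type*} [TopologicalSpace X] [FirstCountableTopology X]
    [NormedAddCommGroup F] [InnerProductSpace ℝ F] {f : X → ℝ → F}
    (hf : ∀ x, MemLp (f x) 2 (volume : Measure ℝ)) {x₀ : X} {g : ℝ → ℝ}
    (hg : Integrable fun s => g s ^ 2)
    (hfg : ∀ᶠ x in 𝓝 x₀, ∀ s, ‖f x s‖ ≤ g s)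
    (hlim : ∀ᵐ s, ContinuousAt (fun x => f x s) x₀) :
    ContinuousAt (fun x => (hf x).toLp (f x)) x₀ := by
  have h0 : ContinuousAt (fun x => ∫ s, ‖f x s - f x₀ s‖ ^ 2) x₀ := by
    refine continuousAt_of_dominated (bound := fun s => 4 * g s ^ 2)
      (Eventually.of_forall fun x => ((hf x).1.sub (hf x₀).1).norm.pow 2) ?_ (hg.const_mul 4) ?_
    · filter_upwards [hfg] with x hx
      refine ae_of_all _ fun s => ?_
      rw [Real.norm_of_nonneg (by positivity)]
      have h1 : ‖f x s - f x₀ s‖ ≤ 2 * g s := by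
        have := norm_sub_le (f x s) (f x₀ s)
        have := hfg.self_of_nhds s
        linarith [hx s]
      calc _ ≤ (2 * g s) ^ 2 := pow_le_pow_left₀ (norm_nonneg _) h1 2
        _ = _ := by ring
    · filter_upwards [hlim] with s hs
      exact (hs.sub continuousAt_const).norm.pow 2
  rw [ContinuousAt, tendsto_iff_dist_tendsto_zero]
  have h1 : Tendsto (fun x => √(∫ s, ‖f x s - f x₀ s‖ ^ 2)) (𝓝 x₀) (𝓝 0) := by
    have := (Real.continuous_sqrt.continuousAt.comp h0).tendsto
    simpa [Function.comp_def] using this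
  refine h1.congr fun x => ?_
  rw [← lp_dist_sq (hf x) (hf x₀), Real.sqrt_sq dist_nonneg]

/-- A compact family of `C¹` paths `t ↦ φ k + ∫₀ᵗ ψ (s, k) ds`, seen as a compact subset of a
Hilbert space on which the evaluations at times `t ≥ 0` are bounded and norm-continuous in `t`.
The Hilbert space is `L²(ℝ)`; it contains the derivative of the path, divided by a weight `κ (1+s²)`
that dominates all derivatives in the family, and the initial value is stored on negative times:
the path, continued by `(1 + t) φ k` to `[-1, 0]`, is the integral of its derivative from `-1`. -/
theorem exists_path_embedding {𝒦 : Type*} [TopologicalSpace 𝒦] [CompactSpace 𝒦]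
    [FirstCountableTopology 𝒦] {n : ℕ} {φ : 𝒦 → Euc n} (hφ : Continuous φ) {ψ : ℝ × 𝒦 → Euc n}
    (hψ : Continuous ψ) :
    ∃ (Ψ : 𝒦 → Lp (Euc n) 2 (volume : Measure ℝ))
      (G : ℝ → Lp (Euc n) 2 (volume : Measure ℝ) →L[ℝ] Euc n), Continuous Ψ ∧ Continuous G ∧
      ∀ t, 0 ≤ t → ∀ k, G t (Ψ k) = φ k + ∫ s in (0 : ℝ)..t, ψ (s, k) := by
  obtain ⟨κ, hκc, hκ1, hκφ, hκψ⟩ : ∃ κ : ℝ → ℝ, Continuous κ ∧ (∀ t, 1 ≤ κ t) ∧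
      (∀ t k, ‖φ k‖ ≤ κ t) ∧ ∀ t k, ‖ψ (t, k)‖ ≤ κ t := by
    let φ' : C(𝒦, Euc n) := ⟨φ, hφ⟩
    let ψ' : C(ℝ, C(𝒦, Euc n)) := ContinuousMap.curry ⟨ψ, hψ⟩
    refine ⟨fun t => 1 + ‖φ'‖ + ‖ψ' t‖, by fun_prop, fun t => ?_, fun t k => ?_, fun t k => ?_⟩
    · linarith [norm_nonneg φ', norm_nonneg (ψ' t)]
    · have : ‖φ k‖ ≤ ‖φ'‖ := φ'.norm_coe_le_norm k
      linarith [norm_nonneg (ψ' t)]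
    · have : ‖ψ (t, k)‖ ≤ ‖ψ' t‖ := (ψ' t).norm_coe_le_norm k
      linarith [norm_nonneg φ']
  have hκ0 : ∀ t, 0 < κ t := fun t => one_pos.trans_le (hκ1 t)
  set ρ : ℝ → ℝ := fun s => (1 + s ^ 2)⁻¹ with hρ
  have hρ0 : ∀ s, 0 < ρ s := fun s => by positivity
  have hρ1 : ∀ s, ρ s ≤ 1 := fun s => inv_le_one_of_one_le₀ (by nlinarith [sq_nonneg s])
  have hρc : Continuous ρ := by
    rw [hρ]; exact Continuous.inv₀ (by fun_prop) fun s => by positivity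
  have hρint : Integrable fun s => ρ s ^ 2 := by
    refine integrable_inv_one_add_sq.mono' (by fun_prop) (ae_of_all _ fun s => ?_)
    rw [Real.norm_of_nonneg (by positivity), sq]
    exact mul_le_of_le_one_left (hρ0 s).le (hρ1 s)
  -- the derivatives of the continued paths
  set d : 𝒦 → ℝ → Euc n := fun k s => if s ≤ 0 then φ k else ψ (s, k) with hd
  have hdmeas : ∀ k, Measurable (d k) := fun k =>
    Measurable.ite measurableSet_Iic measurable_const
      (hψ.comp (by fun_prop : Continuous fun s : ℝ => (s, k))).measurable
  have hdκ : ∀ k s, ‖d k s‖ ≤ κ s := by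
    intro k s
    simp only [hd]; split_ifs
    · exact hκφ s k
    · exact hκψ s k
  have hdc : ∀ s, Continuous fun k => d k s := by
    intro s
    simp only [hd]; split_ifs
    · exact hφ
    · fun_prop
  set f : 𝒦 → ℝ → Euc n := fun k s => (ρ s / κ s) • d k s with hf
  have hfρ : ∀ k s, ‖f k s‖ ≤ ρ s := by
    intro k s
    rw [hf, norm_smul, Real.norm_of_nonneg (div_nonneg (hρ0 s).le (hκ0 s).le), div_mul_eq_mul_div,
      div_le_iff₀ (hκ0 s)]
    exact mul_le_mul_of_nonneg_left (hdκ k s) (hρ0 s).le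
  have hfmem : ∀ k, MemLp (f k) 2 (volume : Measure ℝ) := by
    intro k
    have hm : AEStronglyMeasurable (f k) volume :=
      ((hρc.div hκc fun s => (hκ0 s).ne').measurable.smul (hdmeas k)).aestronglyMeasurable
    refine (memLp_two_iff_integrable_sq_norm hm).2 (hρint.mono' (hm.norm.pow 2)
      (ae_of_all _ fun s => ?_))
    rw [Real.norm_of_nonneg (by positivity)]
    exact pow_le_pow_left₀ (norm_nonneg _) (hfρ k s) 2
  -- the kernels representing the evaluations
  set w : ℝ → ℝ := fun s => κ s / ρ s with hw
  have hwc : Continuous w := hκc.div hρc fun s => (hρ0 s).ne'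
  have hw0 : ∀ s, 0 ≤ w s := fun s => div_nonneg (hκ0 s).le (hρ0 s).le
  set e : Fin n → Euc n := fun i => EuclideanSpace.basisFun (Fin n) ℝ i with he
  have he1 : ∀ i, ‖e i‖ = 1 := fun i => (EuclideanSpace.basisFun (Fin n) ℝ).orthonormal.1 i
  set c : Fin n → ℝ → ℝ → Euc n := fun i t => (Ioc (-1) t).indicator fun s => w s • e i with hc
  have hcle : ∀ i t T, t ≤ T → ∀ s, ‖c i t s‖ ≤ (Ioc (-1) T).indicator w s := by
    intro i t T htT s
    simp only [hc]
    by_cases hs : s ∈ Ioc (-1) t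
    · rw [indicator_of_mem hs, indicator_of_mem (Ioc_subset_Ioc_right htT hs), norm_smul, he1,
        mul_one, Real.norm_of_nonneg (hw0 s)]
    · rw [indicator_of_notMem hs, norm_zero]
      exact indicator_nonneg (fun s _ => hw0 s) s
  have hwint : ∀ T, Integrable fun s => (Ioc (-1) T).indicator w s ^ 2 := by
    intro T
    have h1 : (fun s => (Ioc (-1) T).indicator w s ^ 2) = (Ioc (-1) T).indicator fun s => w s ^ 2 := by
      funext s
      by_cases hs : s ∈ Ioc (-1) T
      · simp [hs]
      · simp [hs]
    rw [h1, integrable_indicator_iff measurableSet_Ioc]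
    exact ((hwc.pow 2).integrableOn_Icc (a := -1) (b := T)).mono_set Ioc_subset_Icc_self
  have hcmem : ∀ i t, MemLp (c i t) 2 (volume : Measure ℝ) := by
    intro i t
    have hm : AEStronglyMeasurable (c i t) volume :=
      (Measurable.indicator (by fun_prop) measurableSet_Ioc).aestronglyMeasurable
    refine (memLp_two_iff_integrable_sq_norm hm).2 ((hwint t).mono' (hm.norm.pow 2)
      (ae_of_all _ fun s => ?_))
    rw [Real.norm_of_nonneg (by positivity)]
    exact pow_le_pow_left₀ (norm_nonneg _) (hcle i t t le_rfl s) 2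
  set G : ℝ → Lp (Euc n) 2 (volume : Measure ℝ) →L[ℝ] Euc n := fun t =>
    ∑ i, (innerSL ℝ ((hcmem i t).toLp (c i t))).smulRight (e i) with hG
  refine ⟨fun k => (hfmem k).toLp (f k), G, ?_, ?_, fun t ht k => ?_⟩
  · refine continuous_iff_continuousAt.2 fun k₀ => continuousAt_toLp hfmem hρint
      (Eventually.of_forall fun k s => hfρ k s) (ae_of_all _ fun s => ?_)
    exact ((hdc s).const_smul (ρ s / κ s)).continuousAt
  · have hk : ∀ i, Continuous fun t => (hcmem i t).toLp (c i t) := by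
      intro i
      refine continuous_iff_continuousAt.2 fun t₀ => continuousAt_toLp (hcmem i) (hwint (t₀ + 1))
        (eventually_of_mem (Iic_mem_nhds (lt_add_one t₀)) fun t ht s => hcle i t _ ht s) ?_
      filter_upwards [(countable_singleton t₀).ae_notMem volume] with s hs
      have hne : s ≠ t₀ := by simpa using hs
      rcases lt_or_gt_of_ne hne with h | h
      · have : (fun t => c i t s) =ᶠ[𝓝 t₀] fun _ => (Ioi (-1)).indicator (fun s => w s • e i) s := by
          filter_upwards [Ioi_mem_nhds h] with t ht
          simp only [hc, indicator_apply, mem_Ioc, mem_Ioi, (mem_Ioi.1 ht).le, and_true]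
        exact continuousAt_const.congr this.symm
      · have : (fun t => c i t s) =ᶠ[𝓝 t₀] fun _ => 0 := by
          filter_upwards [Iio_mem_nhds h] with t ht
          simp only [hc, indicator_apply, mem_Ioc, not_le.2 (mem_Iio.1 ht), and_false, if_false]
        exact continuousAt_const.congr this.symm
    refine continuous_finsetSum _ fun i _ => ?_
    have h1 : Continuous fun x : Lp (Euc n) 2 (volume : Measure ℝ) →L[ℝ] ℝ => x.smulRight (e i) :=
      (ContinuousLinearMap.smulRightL ℝ (Lp (Euc n) 2 (volume : Measure ℝ)) (Euc n)).flip
        (e i) |>.continuous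
    exact h1.comp ((innerSL ℝ).continuous.comp (hk i))
  · have hdint : IntegrableOn (d k) (Ioc (-1) t) := by
      refine Integrable.mono' (g := κ) ((hκc.integrableOn_Icc (a := -1) (b := t)).mono_set
        Ioc_subset_Icc_self) (hdmeas k).aestronglyMeasurable (ae_of_all _ fun s => hdκ k s)
    have hinner : ∀ i, inner ℝ ((hcmem i t).toLp (c i t)) ((hfmem k).toLp (f k))
        = inner ℝ (e i) (∫ s in Ioc (-1) t, d k s) := by
      intro i
      rw [L2.inner_def, ← integral_inner hdint, ← integral_indicator measurableSet_Ioc]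
      refine integral_congr_ae ?_
      filter_upwards [(hcmem i t).coeFn_toLp, (hfmem k).coeFn_toLp] with s h1 h2
      rw [h1, h2]
      by_cases hs : s ∈ Ioc (-1) t
      · simp only [hc, hf, indicator_of_mem hs, hw]
        rw [inner_smul_left, inner_smul_right, ← mul_assoc]
        have : (starRingEnd ℝ) (κ s / ρ s) * (ρ s / κ s) = 1 := by
          have := (hκ0 s).ne'; have := (hρ0 s).ne'
          rw [conj_trivial]; field_simp
        rw [this, one_mul]
      · simp only [hc, indicator_of_notMem hs, inner_zero_left]
    have hGt : G t ((hfmem k).toLp (f k)) = ∫ s in Ioc (-1) t, d k s := by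
      simp only [hG, sum_apply, ContinuousLinearMap.smulRight_apply,
        innerSL_apply_apply, hinner]
      exact (EuclideanSpace.basisFun (Fin n) ℝ).sum_repr' _
    have hsplit : Ioc (-1 : ℝ) t = Ioc (-1) 0 ∪ Ioc 0 t := (Ioc_union_Ioc_eq_Ioc (by norm_num) ht).symm
    rw [hGt, hsplit, setIntegral_union (Ioc_disjoint_Ioc_of_le le_rfl) measurableSet_Ioc
      (hdint.mono_set (Ioc_subset_Ioc_right ht)) (hdint.mono_set (Ioc_subset_Ioc_left (by norm_num))),
      intervalIntegral.integral_of_le ht]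
    congr 1
    · rw [setIntegral_congr_fun (g := fun _ => φ k) measurableSet_Ioc fun s hs => if_pos hs.2]
      simp
    · exact setIntegral_congr_fun measurableSet_Ioc fun s hs => if_neg (not_le.2 hs.1)

end PathEmbedding

/-! ### The linear response of the mean-field flow -/

/-- The Hilbert space into which the paths of observables are embedded. -/
abbrev PathSpace (n : ℕ) : Type := Lp (Euc n) 2 (volume : Measure ℝ)

/-- A mean-field characteristic flow: every point of `D₀` moves in `D` with the velocity
`b₀ + b₁ u`, where `u` is the mean of the observables `Φ` over the population with initial
law `μ₀`. The coefficients are `C¹` near each point of `D`, and `μ₀` has compact support in `D₀`. -/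
structure IsMeanFieldSolution {k n : ℕ} (b₀ : Euc k → Euc k) (b₁ : Euc k → Euc n →L[ℝ] Euc k)
    (Φ : Euc k → Euc n) (D D₀ : Set (Euc k)) (μ₀ : Measure (Euc k)) (Θ : ℝ → Euc k → Euc k) :
    Prop where
  contDiff_drift : ∀ x ∈ D, ContDiffAt ℝ 1 b₀ x
  contDiff_coupling : ∀ x ∈ D, ContDiffAt ℝ 1 b₁ x
  contDiff_observable : ∀ x ∈ D, ContDiffAt ℝ 1 Φ x
  isCompact_support : IsCompact μ₀.support
  support_subset : μ₀.support ⊆ D₀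
  continuousOn : ContinuousOn (fun q : ℝ × Euc k => Θ q.1 q.2) (Ici 0 ×ˢ D₀)
  mem : ∀ t, 0 ≤ t → ∀ θ ∈ D₀, Θ t θ ∈ D
  init : ∀ θ ∈ D₀, Θ 0 θ = θ
  hasDerivWithinAt : ∀ t, 0 ≤ t → ∀ θ ∈ D₀, HasDerivWithinAt (fun s => Θ s θ)
    (b₀ (Θ t θ) + b₁ (Θ t θ) (∫ θ', Φ (Θ t θ') ∂μ₀)) (Ici 0) t

section SupportIntegral

variable {X : Type*} [TopologicalSpace X] [MeasurableSpace X]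

lemma restrict_support_eq_self [HereditarilyLindelofSpace X] (μ : Measure X) :
    μ.restrict μ.support = μ :=
  Measure.restrict_eq_self_of_ae_mem Measure.support_mem_ae

variable [BorelSpace X]

lemma integral_comap_support [HereditarilyLindelofSpace X] {G : Type*} [NormedAddCommGroup G]
    [NormedSpace ℝ G] (μ : Measure X) (g : X → G) :
    ∫ x : μ.support, g x ∂(μ.comap Subtype.val) = ∫ x, g x ∂μ :=
  (integral_subtype_comap Measure.isClosed_support.measurableSet g).trans
    (congrArg (fun ν => ∫ x, g x ∂ν) (restrict_support_eq_self μ))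

lemma isFiniteMeasure_comap_support (μ : Measure X) [IsFiniteMeasure μ] :
    IsFiniteMeasure (μ.comap (Subtype.val : μ.support → X)) := by
  refine ⟨?_⟩
  rw [comap_subtype_coe_apply Measure.isClosed_support.measurableSet]
  exact measure_lt_top _ _

end SupportIntegral

namespace IsMeanFieldSolution

variable {k n : ℕ} {b₀ : Euc k → Euc k} {b₁ : Euc k → Euc n →L[ℝ] Euc k}
  {Φ : Euc k → Euc n} {D D₀ : Set (Euc k)} {μ₀ : Measure (Euc k)} {Θ : ℝ → Euc k → Euc k}

/-- Composition with the flow of a map that is continuous at every point of `D`; times are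
truncated to `[0, ∞)`. -/
lemma continuous_comp (h : IsMeanFieldSolution b₀ b₁ Φ D D₀ μ₀ Θ) {Y : Type*} [TopologicalSpace Y]
    {f : Euc k → Y} (hf : ∀ x ∈ D, ContinuousAt f x) :
    Continuous fun q : ℝ × D₀ => f (Θ (max q.1 0) q.2) := by
  have h1 : Continuous fun q : ℝ × D₀ => Θ (max q.1 0) q.2 :=
    h.continuousOn.comp_continuous (f := fun q : ℝ × D₀ => (max q.1 0, (q.2 : Euc k)))
      (by fun_prop) fun q => ⟨mem_Ici.2 (le_max_right _ _), q.2.2⟩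
  exact continuous_iff_continuousAt.2 fun q =>
    (hf _ (h.mem _ (le_max_right _ _) _ q.2.2)).comp_of_eq h1.continuousAt rfl

lemma continuous_comp_support (h : IsMeanFieldSolution b₀ b₁ Φ D D₀ μ₀ Θ) {Y : Type*}
    [TopologicalSpace Y] {f : Euc k → Y} (hf : ∀ x ∈ D, ContinuousAt f x) :
    Continuous fun q : ℝ × μ₀.support => f (Θ (max q.1 0) q.2) :=
  (h.continuous_comp hf).comp
    (by fun_prop : Continuous fun q : ℝ × μ₀.support => (q.1, Set.inclusion h.support_subset q.2))

lemma continuousOn_comp (h : IsMeanFieldSolution b₀ b₁ Φ D D₀ μ₀ Θ) {Y : Type*}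
    [TopologicalSpace Y] {f : Euc k → Y} (hf : ∀ x ∈ D, ContinuousAt f x) {t : ℝ} (ht : 0 ≤ t) :
    ContinuousOn (fun θ => f (Θ t θ)) D₀ := by
  rw [continuousOn_iff_continuous_domRestrict]
  have := (h.continuous_comp hf).comp (by fun_prop : Continuous fun θ : D₀ => (t, θ))
  simpa [Function.comp_def, max_eq_left ht, Set.domRestrict_def] using this

/-- Means over the population depend continuously on time. -/
lemma continuous_mean (h : IsMeanFieldSolution b₀ b₁ Φ D D₀ μ₀ Θ) [IsFiniteMeasure μ₀]
    {Y : Type*} [NormedAddCommGroup Y] [NormedSpace ℝ Y] {f : Euc k → Y}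
    (hf : ∀ x ∈ D, ContinuousAt f x) :
    Continuous fun t : ℝ => ∫ θ, f (Θ (max t 0) θ) ∂μ₀ := by
  have := isCompact_iff_compactSpace.1 h.isCompact_support
  have := isFiniteMeasure_comap_support μ₀
  have h1 := continuous_parametric_integral_of_continuous (X := ℝ) (Y := μ₀.support)
    (μ := μ₀.comap Subtype.val) (f := fun t θ => f (Θ (max t 0) θ)) (s := univ)
    (h.continuous_comp_support hf) isCompact_univ
  simp only [Measure.restrict_univ] at h1
  exact h1.congr fun t => integral_comap_support μ₀ fun θ => f (Θ (max t 0) θ)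

/-- The paths of the observables along the flow, as evaluations of vectors of the path space. -/
lemma exists_path_representation (h : IsMeanFieldSolution b₀ b₁ Φ D D₀ μ₀ Θ) [IsFiniteMeasure μ₀] :
    ∃ (Ψ : Euc k → PathSpace n) (G : ℝ → PathSpace n →L[ℝ] Euc n),
      ContinuousOn Ψ μ₀.support ∧ Continuous G ∧
      ∀ t, 0 ≤ t → ∀ θ ∈ μ₀.support, G t (Ψ θ) = Φ (Θ t θ) := by
  classical
  have hcompact := isCompact_iff_compactSpace.1 h.isCompact_support
  have cb₀ : ∀ x ∈ D, ContinuousAt b₀ x := fun x hx => (h.contDiff_drift x hx).continuousAt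
  have cb₁ : ∀ x ∈ D, ContinuousAt b₁ x := fun x hx => (h.contDiff_coupling x hx).continuousAt
  have cΦ : ∀ x ∈ D, ContinuousAt Φ x := fun x hx => (h.contDiff_observable x hx).continuousAt
  have cdΦ : ∀ x ∈ D, ContinuousAt (fderiv ℝ Φ) x := fun x hx =>
    (h.contDiff_observable x hx).continuousAt_fderiv_one
  set u : ℝ → Euc n := fun t => ∫ θ, Φ (Θ (max t 0) θ) ∂μ₀ with hu
  have huc : Continuous u := h.continuous_mean cΦ
  -- embedding of the paths `t ↦ Φ (Θ t θ)`
  set ψ : ℝ × μ₀.support → Euc n := fun q => fderiv ℝ Φ (Θ (max q.1 0) q.2)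
    (b₀ (Θ (max q.1 0) q.2) + b₁ (Θ (max q.1 0) q.2) (u q.1)) with hψ
  have hψc : Continuous ψ := (h.continuous_comp_support cdΦ).clm_apply
    ((h.continuous_comp_support cb₀).add
      ((h.continuous_comp_support cb₁).clm_apply (huc.comp continuous_fst)))
  have hφc : Continuous fun θ : μ₀.support => Φ θ := by
    refine continuous_iff_continuousAt.2 fun θ => ?_
    have hθD : (θ : Euc k) ∈ D := by
      have := h.mem 0 le_rfl θ (h.support_subset θ.2)
      rwa [h.init θ (h.support_subset θ.2)] at this
    exact (cΦ _ hθD).comp continuous_subtype_val.continuousAt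
  obtain ⟨Ψ₀, G, hΨ₀, hG, heval⟩ := exists_path_embedding hφc hψc
  set Ψ : Euc k → PathSpace n := fun θ => if hθ : θ ∈ μ₀.support then Ψ₀ ⟨θ, hθ⟩ else 0 with hΨ
  have hΨval : ∀ θ : μ₀.support, Ψ θ = Ψ₀ θ := fun θ => dif_pos θ.2
  have hΨc : ContinuousOn Ψ μ₀.support :=
    continuousOn_iff_continuous_domRestrict.2 (hΨ₀.congr fun θ => (hΨval θ).symm)
  refine ⟨Ψ, G, hΨc, hG, fun t ht θ hθ => ?_⟩
  have hθ₀ := h.support_subset hθ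
  have hder : ∀ s, 0 ≤ s → HasDerivWithinAt (fun s => Φ (Θ s θ)) (ψ (s, ⟨θ, hθ⟩)) (Ici 0) s := by
    intro s hs
    have h1 := h.hasDerivWithinAt s hs θ hθ₀
    have h2 := ((h.contDiff_observable _ (h.mem s hs θ hθ₀)).differentiableAt
      (by norm_num)).hasFDerivAt.comp_hasDerivWithinAt s h1
    have h3 : ψ (s, ⟨θ, hθ⟩) = fderiv ℝ Φ (Θ s θ)
        (b₀ (Θ s θ) + b₁ (Θ s θ) (∫ θ', Φ (Θ s θ') ∂μ₀)) := by
      simp only [hψ, hu, max_eq_left hs]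
    rw [h3]
    exact h2
  have hftc : ∫ s in (0 : ℝ)..t, ψ (s, ⟨θ, hθ⟩) = Φ (Θ t θ) - Φ (Θ 0 θ) := by
    refine intervalIntegral.integral_eq_sub_of_hasDeriv_right_of_le ht
      (fun s hs => (hder s hs.1).continuousWithinAt.mono fun x hx => hx.1)
      (fun s hs => ((hder s hs.1.le).mono_of_mem_nhdsWithin ?_))
      (Continuous.intervalIntegrable (by fun_prop) _ _)
    exact mem_nhdsWithin_of_mem_nhds (Ici_mem_nhds hs.1)
  rw [hΨval ⟨θ, hθ⟩, heval t ht, hftc, h.init θ hθ₀]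
  simp

/-- The linear response operators `T t θ` of the mean-field flow. A fluctuation of the initial
population is encoded by a vector `η`, whose evaluation `G t η` is the resulting fluctuation of
the mean observables along the unperturbed flow; `T t θ η` is then the first-order displacement of
the trajectory started from `θ`. -/
theorem exists_response (h : IsMeanFieldSolution b₀ b₁ Φ D D₀ μ₀ Θ) [IsFiniteMeasure μ₀]
    {H : Type*} [NormedAddCommGroup H] [NormedSpace ℝ H] {G : ℝ → H →L[ℝ] Euc n}
    (hG : Continuous G) :
    ∃ T : ℝ → Euc k → H →L[ℝ] Euc k,
      ContinuousOn (fun q : ℝ × Euc k => T q.1 q.2) (Ici 0 ×ˢ D₀) ∧ (∀ θ ∈ D₀, T 0 θ = 0) ∧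
      ∀ t, 0 ≤ t → ∀ θ ∈ D₀, HasDerivWithinAt (fun s => T s θ)
        ((fderiv ℝ b₀ (Θ t θ) + (fderiv ℝ b₁ (Θ t θ)).flip (∫ θ', Φ (Θ t θ') ∂μ₀)) ∘L T t θ
          + b₁ (Θ t θ) ∘L (∫ θ', fderiv ℝ Φ (Θ t θ') ∘L T t θ' ∂μ₀ + G t)) (Ici 0) t := by
  classical
  have hcompact := isCompact_iff_compactSpace.1 h.isCompact_support
  have hfinite := isFiniteMeasure_comap_support μ₀
  have cb₀ : ∀ x ∈ D, ContinuousAt b₀ x := fun x hx => (h.contDiff_drift x hx).continuousAt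
  have cb₁ : ∀ x ∈ D, ContinuousAt b₁ x := fun x hx => (h.contDiff_coupling x hx).continuousAt
  have cΦ : ∀ x ∈ D, ContinuousAt Φ x := fun x hx => (h.contDiff_observable x hx).continuousAt
  have cdb₀ : ∀ x ∈ D, ContinuousAt (fderiv ℝ b₀) x := fun x hx =>
    (h.contDiff_drift x hx).continuousAt_fderiv_one
  have cdb₁ : ∀ x ∈ D, ContinuousAt (fun x => (fderiv ℝ b₁ x).flip) x := fun x hx =>
    (ContinuousLinearMap.flipₗᵢ ℝ (Euc k) (Euc n) (Euc k)).continuous.continuousAt.comp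
      (h.contDiff_coupling x hx).continuousAt_fderiv_one
  have cdΦ : ∀ x ∈ D, ContinuousAt (fderiv ℝ Φ) x := fun x hx =>
    (h.contDiff_observable x hx).continuousAt_fderiv_one
  set u : ℝ → Euc n := fun t => ∫ θ, Φ (Θ (max t 0) θ) ∂μ₀ with hu
  have huc : Continuous u := h.continuous_mean cΦ
  -- the linearized equation, for operators acting on `H`
  set A : ℝ × D₀ → (H →L[ℝ] Euc k) →L[ℝ] (H →L[ℝ] Euc k) := fun q =>
    ContinuousLinearMap.compL ℝ H (Euc k) (Euc k)
      (fderiv ℝ b₀ (Θ (max q.1 0) q.2) + (fderiv ℝ b₁ (Θ (max q.1 0) q.2)).flip (u q.1)) with hA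
  set B : ℝ × D₀ → (H →L[ℝ] Euc n) →L[ℝ] (H →L[ℝ] Euc k) := fun q =>
    ContinuousLinearMap.compL ℝ H (Euc n) (Euc k) (b₁ (Θ (max q.1 0) q.2)) with hB
  set C : ℝ × μ₀.support → (H →L[ℝ] Euc k) →L[ℝ] (H →L[ℝ] Euc n) := fun q =>
    ContinuousLinearMap.compL ℝ H (Euc k) (Euc n) (fderiv ℝ Φ (Θ (max q.1 0) q.2))
    with hC
  have hAc : Continuous A := (ContinuousLinearMap.continuous _).comp
    ((h.continuous_comp cdb₀).add ((h.continuous_comp cdb₁).clm_apply (huc.comp continuous_fst)))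
  have hBc : Continuous B := (ContinuousLinearMap.continuous _).comp (h.continuous_comp cb₁)
  have hCc : Continuous C := (ContinuousLinearMap.continuous _).comp (h.continuous_comp_support cdΦ)
  have hhc : Continuous fun q : ℝ × D₀ => b₁ (Θ (max q.1 0) q.2) ∘L G q.1 :=
    (h.continuous_comp cb₁).clm_comp (hG.comp continuous_fst)
  obtain ⟨x, hxc, hx0, hxder⟩ := exists_linear_flow (ν := μ₀.comap Subtype.val)
    (ι := Set.inclusion h.support_subset) (continuous_inclusion _) hAc hBc hCc hhc
  set T : ℝ → Euc k → H →L[ℝ] Euc k := fun t θ =>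
    if hθ : θ ∈ D₀ then x (t, ⟨θ, hθ⟩) else 0 with hT
  have hTval : ∀ t, ∀ θ : D₀, T t θ = x (t, θ) := fun t θ => dif_pos θ.2
  refine ⟨T, ?_, fun θ hθ => (hTval 0 ⟨θ, hθ⟩).trans (hx0 _), ?_⟩
  · rw [continuousOn_iff_continuous_domRestrict]
    have h1 : Continuous fun q : (Ici (0 : ℝ) ×ˢ D₀ : Set (ℝ × Euc k)) =>
        x (q.1.1, ⟨q.1.2, q.2.2⟩) := by fun_prop
    exact h1.congr fun q => (hTval q.1.1 ⟨q.1.2, q.2.2⟩).symm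
  · intro t ht θ hθ
    have h1 := hxder t ht ⟨θ, hθ⟩
    have hfun : (fun s => T s θ) = fun s => x (s, ⟨θ, hθ⟩) := funext fun s => hTval s ⟨θ, hθ⟩
    rw [hfun]
    have hint : ∫ θ', fderiv ℝ Φ (Θ t θ') ∘L T t θ' ∂μ₀
        = ∫ κ : μ₀.support, C (t, κ) (x (t, Set.inclusion h.support_subset κ))
          ∂(μ₀.comap Subtype.val) := by
      rw [← integral_comap_support]
      refine integral_congr_ae (ae_of_all _ fun κ => ?_)
      simp only [hC, max_eq_left ht, ContinuousLinearMap.compL_apply]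
      rw [hTval t ⟨κ, h.support_subset κ.2⟩]
    rw [hint, ContinuousLinearMap.comp_add, hTval t ⟨θ, hθ⟩, ← add_assoc]
    simpa only [hA, hB, hu, max_eq_left ht, ContinuousLinearMap.compL_apply] using h1

end IsMeanFieldSolution

/-! ### Empirical means of independent samples -/

section Sampling

variable {X S : Type*} [MeasurableSpace X] [MeasurableSpace S] {μ : Measure X} {P : Measure S}
  {ξ : ℕ → S → X}

lemma avg_fin_eq_sum_range {E : Type*} [NormedAddCommGroup E] [NormedSpace ℝ E]
    (f : ℕ → E) (m : ℕ) :
    (avg fun i : Fin m => f i) = (m : ℝ)⁻¹ • ∑ i ∈ Finset.range m, f i := by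
  rw [avg, Finset.sum_range]

/-- Strong law of large numbers for the empirical means of an integrable vector-valued function. -/
lemma ae_tendsto_avg {E : Type*} [NormedAddCommGroup E] [NormedSpace ℝ E] [CompleteSpace E]
    (hlaw : ∀ i, HasLaw (ξ i) μ P) (hindep : iIndepFun ξ P) {f : X → E} (hf : Integrable f μ) :
    ∀ᵐ s ∂P, Tendsto (fun m : ℕ => avg fun i : Fin m => f (ξ i s)) atTop (𝓝 (∫ x, f x ∂μ)) := by
  borelize E
  have haem : ∀ i, AEMeasurable f (P.map (ξ i)) := fun i => by
    rw [(hlaw i).map_eq]; exact hf.aestronglyMeasurable.aemeasurable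
  have h := strong_law_ae (fun i s => f (ξ i s)) (μ := P) ?_ ?_ ?_
  · filter_upwards [h] with s hs
    have h0 : ∫ s, f (ξ 0 s) ∂P = ∫ x, f x ∂μ := (hlaw 0).integral_comp hf.aestronglyMeasurable
    rw [h0] at hs
    exact hs.congr fun m => (avg_fin_eq_sum_range (fun i => f (ξ i s)) m).symm
  · exact ((hlaw 0).map_eq ▸ hf : Integrable f (P.map (ξ 0))).comp_aemeasurable (hlaw 0).aemeasurable
  · exact fun i j hij => (hindep.indepFun hij).comp₀ (hlaw i).aemeasurable (hlaw j).aemeasurable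
      (haem i) (haem j)
  · exact fun i => (⟨(hlaw i).aemeasurable, (hlaw 0).aemeasurable,
      (hlaw i).map_eq.trans (hlaw 0).map_eq.symm⟩ : IdentDistrib (ξ i) (ξ 0) P P).comp_of_aemeasurable
        (haem i)

/-- The normalized deviation of an empirical mean is bounded in `L²`, because independent centered
vectors are orthogonal. -/
lemma integral_norm_sq_sqrt_smul_avg_sub_le [IsProbabilityMeasure μ] {H : Type*}
    [NormedAddCommGroup H] [InnerProductSpace ℝ H] [CompleteSpace H]
    (hlaw : ∀ i, HasLaw (ξ i) μ P) (hindep : iIndepFun ξ P) {f : X → H} (hf : MemLp f 2 μ) (m : ℕ) :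
    Integrable (fun s => ‖√(m : ℝ) • ((avg fun i : Fin m => f (ξ i s)) - ∫ x, f x ∂μ)‖ ^ 2) P ∧
      ∫ s, ‖√(m : ℝ) • ((avg fun i : Fin m => f (ξ i s)) - ∫ x, f x ∂μ)‖ ^ 2 ∂P
        ≤ ∫ x, ‖f x - ∫ y, f y ∂μ‖ ^ 2 ∂μ := by
  set c : X → H := fun x => f x - ∫ y, f y ∂μ with hc
  have hc2 : MemLp c 2 μ := hf.sub (memLp_const _)
  have hc1 : Integrable c μ := hc2.integrable (by norm_num)
  have hc0 : ∫ x, c x ∂μ = 0 := by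
    rw [hc, integral_sub (hf.integrable (by norm_num)) (integrable_const _)]
    simp
  have hmap : ∀ i, P.map (ξ i) = μ := fun i => (hlaw i).map_eq
  have hcξ : ∀ i, MemLp (fun s => c (ξ i s)) 2 P := fun i =>
    (((hmap i).symm ▸ hc2 : MemLp c 2 (P.map (ξ i)))).comp_of_map (hlaw i).aemeasurable
  have hexp : ∀ s, ‖√(m : ℝ) • ((avg fun i : Fin m => f (ξ i s)) - ∫ x, f x ∂μ)‖ ^ 2
      = (m : ℝ)⁻¹ * ∑ i : Fin m, ∑ j : Fin m, inner ℝ (c (ξ i s)) (c (ξ j s)) := by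
    intro s
    rcases Nat.eq_zero_or_pos m with rfl | hm
    · simp
    have hm' : (0 : ℝ) < m := by exact_mod_cast hm
    have h1 : (avg fun i : Fin m => f (ξ i s)) - ∫ x, f x ∂μ
        = (m : ℝ)⁻¹ • ∑ i : Fin m, c (ξ i s) := by
      simp only [hc, Finset.sum_sub_distrib, smul_sub, avg]
      simp [← Nat.cast_smul_eq_nsmul ℝ, smul_smul, inv_mul_cancel₀ hm'.ne']
    rw [h1, smul_smul, norm_smul, mul_pow,
      ← real_inner_self_eq_norm_sq (∑ i : Fin m, c (ξ i s)), sum_inner]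
    simp only [inner_sum]
    congr 1
    rw [Real.norm_eq_abs, sq_abs, mul_pow, Real.sq_sqrt hm'.le]
    field_simp
  have hint : ∀ i j : ℕ, Integrable (fun s => inner ℝ (c (ξ i s)) (c (ξ j s))) P := fun i j =>
    ((hcξ i).norm.integrable_mul (hcξ j).norm).mono' ((hcξ i).1.inner (hcξ j).1)
      (ae_of_all _ fun s => norm_inner_le_norm _ _)
  have hval : ∀ i j : Fin m, ∫ s, inner ℝ (c (ξ i s)) (c (ξ j s)) ∂P
      = if i = j then ∫ x, ‖c x‖ ^ 2 ∂μ else 0 := by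
    intro i j
    split_ifs with hij
    · subst hij
      simp only [real_inner_self_eq_norm_sq]
      exact (hlaw i).integral_comp (f := fun x => ‖c x‖ ^ 2) (hc2.1.norm.pow 2)
    · have h1 := (hindep.indepFun (Fin.val_ne_of_ne hij)).integral_bilin_comp_comp
        (hlaw i).aemeasurable (hlaw j).aemeasurable ((hmap i).symm ▸ hc1) ((hmap j).symm ▸ hc1)
        (innerSL ℝ (E := H))
      have h2 : ∫ s, c (ξ i s) ∂P = 0 := 
        ((hlaw i).integral_comp hc1.1).trans hc0
      rw [h2, map_zero, zero_apply] at h1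
      exact h1
  simp only [hexp]
  have hsum : ∀ i : Fin m, Integrable (fun s => ∑ j : Fin m, inner ℝ (c (ξ i s)) (c (ξ j s))) P :=
    fun i => integrable_finsetSum _ fun j _ => hint i j
  refine ⟨(integrable_finsetSum _ fun i _ => hsum i).const_mul _, ?_⟩
  rw [integral_const_mul, integral_finsetSum _ fun i _ => hsum i]
  simp_rw [integral_finsetSum Finset.univ fun (j : Fin m) _ => hint _ j, hval]
  simp only [Finset.sum_ite_eq, Finset.mem_univ, if_true, Finset.sum_const, Finset.card_univ,
    Fintype.card_fin, nsmul_eq_mul, ← mul_assoc]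
  exact mul_le_of_le_one_left (integral_nonneg fun x => by positivity)
    (inv_mul_le_one_of_le₀ le_rfl (Nat.cast_nonneg m))

lemma charFun_map_eq_charFun_map_inner {E : Type*} [NormedAddCommGroup E] [InnerProductSpace ℝ E]
    [MeasurableSpace E] [BorelSpace E] [SecondCountableTopology E] {f : S → E}
    (hf : AEMeasurable f P) (v : E) :
    charFun (P.map f) v = charFun (P.map fun s => inner ℝ v (f s)) 1 := by
  rw [charFun_apply, charFun_apply_real, integral_map hf (by fun_prop),
    integral_map (by fun_prop) (by fun_prop)]
  simp [real_inner_comm]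

/-- Cramér–Wold for limits in law of random vectors. -/
lemma tendstoInDistribution_of_inner {E : Type*} [NormedAddCommGroup E] [InnerProductSpace ℝ E]
    [FiniteDimensional ℝ E] [MeasurableSpace E] [BorelSpace E] [IsProbabilityMeasure P]
    {S' : Type*} [MeasurableSpace S'] {P' : Measure S'} [IsProbabilityMeasure P']
    {U : ℕ → S → E} {V : S' → E} (hU : ∀ m, AEMeasurable (U m) P) (hV : AEMeasurable V P')
    (h : ∀ v : E, TendstoInDistribution (fun m s => inner ℝ v (U m s)) atTop
      (fun s => inner ℝ v (V s)) (fun _ => P) P') :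
    TendstoInDistribution U atTop V (fun _ => P) P' where
  forall_aemeasurable := hU
  aemeasurable_limit := hV
  tendsto := by
    refine ProbabilityMeasure.tendsto_of_tendsto_charFun fun v => ?_
    have h1 := ProbabilityMeasure.tendsto_iff_tendsto_charFun.1 (h v).tendsto 1
    simp only [ProbabilityMeasure.coe_mk] at h1 ⊢
    rw [charFun_map_eq_charFun_map_inner hV]
    simp only [fun m => charFun_map_eq_charFun_map_inner (hU m) v]
    exact h1

/-- The central limit theorem for a square-integrable function of independent samples, with values
in a Euclidean space. The limit is described by its one-dimensional marginals. -/
theorem tendstoInDistribution_sqrt_smul_avg_sub [IsProbabilityMeasure P] [IsProbabilityMeasure μ]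
    {E : Type*} [NormedAddCommGroup E] [InnerProductSpace ℝ E]
    [FiniteDimensional ℝ E] [MeasurableSpace E] [BorelSpace E]
    {S' : Type*} [MeasurableSpace S'] {P' : Measure S'} [IsProbabilityMeasure P']
    (hlaw : ∀ i, HasLaw (ξ i) μ P) (hindep : iIndepFun ξ P) {f : X → E} (hf : MemLp f 2 μ)
    {V : S' → E} (hV : AEMeasurable V P')
    (hgauss : ∀ v : E, HasLaw (fun s => inner ℝ v (V s))
      (gaussianReal 0 Var[fun x => inner ℝ v (f x); μ].toNNReal) P') :
    TendstoInDistribution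
      (fun (m : ℕ) s => √(m : ℝ) • ((avg fun i : Fin m => f (ξ i s)) - ∫ x, f x ∂μ)) atTop V
      (fun _ => P) P' := by
  have hfξ : ∀ i, AEMeasurable (fun s => f (ξ i s)) P := fun i =>
    ((hlaw i).map_eq.symm ▸ hf.1.aemeasurable : AEMeasurable f (P.map (ξ i))).comp_aemeasurable
      (hlaw i).aemeasurable
  refine tendstoInDistribution_of_inner (fun m => ?_) hV fun v => ?_
  · have h1 : AEMeasurable (fun s => ∑ i : Fin m, f (ξ i s)) P :=
      Finset.aemeasurable_fun_sum _ fun i _ => hfξ i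
    exact ((h1.const_smul (m : ℝ)⁻¹).sub_const _).const_smul √(m : ℝ)
  set g : X → ℝ := fun x => inner ℝ v (f x) with hg
  have hg2 : MemLp g 2 μ := hf.const_inner v
  have hgae : ∀ i, AEMeasurable g (P.map (ξ i)) := fun i => by
    rw [(hlaw i).map_eq]; exact hg2.1.aemeasurable
  have hident : ∀ i, IdentDistrib (fun s => g (ξ i s)) (fun s => g (ξ 0 s)) P P := fun i =>
    (⟨(hlaw i).aemeasurable, (hlaw 0).aemeasurable,
      (hlaw i).map_eq.trans (hlaw 0).map_eq.symm⟩ : IdentDistrib (ξ i) (ξ 0) P P).comp_of_aemeasurable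
        (hgae i)
  have hvar : Var[fun s => g (ξ 0 s); P] = Var[g; μ] := by
    rw [← (hlaw 0).map_eq] at hg2 ⊢
    exact (variance_map hg2.1.aemeasurable (hlaw 0).aemeasurable).symm
  have hmean : ∫ s, g (ξ 0 s) ∂P = ∫ x, g x ∂μ := (hlaw 0).integral_comp hg2.1
  have hclt := tendstoInDistribution_inv_sqrt_mul_sum_sub (X := fun i s => g (ξ i s)) (P := P)
    (Y := fun s => inner ℝ v (V s)) (P' := P') (by rw [hvar]; exact hgauss v)
    (((hlaw 0).map_eq.symm ▸ hg2 : MemLp g 2 (P.map (ξ 0))).comp_of_map (hlaw 0).aemeasurable)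
    (hindep.comp₀ (fun _ => g) (fun i => (hlaw i).aemeasurable) hgae) hident
  convert hclt using 3 with m s
  rw [hmean, inner_smul_right, inner_sub_right, hg, integral_inner (hf.integrable (by norm_num)),
    avg, inner_smul_right, inner_sum, Finset.sum_range]
  rcases Nat.eq_zero_or_pos m with rfl | hm
  · simp
  have hm' : (0 : ℝ) < m := by exact_mod_cast hm
  have h2 : √(m : ℝ) * √(m : ℝ) = m := Real.mul_self_sqrt hm'.le
  have h3 : √(m : ℝ) ≠ 0 := (Real.sqrt_pos.2 hm').ne'
  field_simp
  rw [pow_two, h2]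

/-- A sequence that is almost surely negligible compared with a sequence bounded in `L²` tends to
zero in probability. -/
lemma tendstoInMeasure_zero_of_ae_eventually_le [IsProbabilityMeasure P] {E : Type*}
    [NormedAddCommGroup E] {r : ℕ → S → E} {y : ℕ → S → ℝ} {M : ℝ}
    (hr : ∀ m, AEStronglyMeasurable (r m) P) (hy0 : ∀ m s, 0 ≤ y m s)
    (hy : ∀ m, AEStronglyMeasurable (y m) P)
    (hyint : ∀ m, Integrable (fun s => y m s ^ 2) P) (hyM : ∀ m, ∫ s, y m s ^ 2 ∂P ≤ M)
    (h : ∀ᵐ s ∂P, ∀ ε > 0, ∀ᶠ m in atTop, ‖r m s‖ ≤ ε * y m s) :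
    TendstoInMeasure P r atTop 0 := by
  set q : ℕ → S → ℝ := fun m s => ‖r m s‖ / (1 + y m s) with hq
  have hqm : TendstoInMeasure P q atTop 0 := by
    refine tendstoInMeasure_of_tendsto_ae
      (fun m => ((hr m).norm.aemeasurable.div
        (aemeasurable_const.add (hy m).aemeasurable)).aestronglyMeasurable) ?_
    filter_upwards [h] with s hs
    rw [Pi.zero_apply, Metric.tendsto_nhds]
    intro ε hε
    filter_upwards [hs (ε / 2) (half_pos hε)] with m hm
    have h1 : 0 < 1 + y m s := by linarith [hy0 m s]
    rw [Real.dist_eq, sub_zero, abs_of_nonneg (div_nonneg (norm_nonneg _) h1.le), div_lt_iff₀ h1]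
    nlinarith [hy0 m s]
  rw [tendstoInMeasure_iff_norm] at hqm ⊢
  intro ε hε
  have hM0 : 0 ≤ M := (integral_nonneg fun s => sq_nonneg (y 0 s)).trans (hyM 0)
  refine ENNReal.tendsto_nhds_zero.2 fun κ hκ => ?_
  obtain ⟨κ', hκ', hκκ'⟩ : ∃ κ' : ℝ, 0 < κ' ∧ ENNReal.ofReal κ' ≤ κ / 2 := by
    rcases eq_or_ne κ ⊤ with rfl | hκt
    · exact ⟨1, one_pos, by simp [ENNReal.top_div]⟩
    · exact ⟨(κ / 2).toReal, ENNReal.toReal_pos (ENNReal.half_pos hκ.ne').ne' (by finiteness),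
        ENNReal.ofReal_toReal_le⟩
  -- the threshold comes from Chebyshev's inequality
  set N : ℝ := √(M / κ') + 1 with hN
  have hN0 : 0 < N := by positivity
  have hN2 : M / N ^ 2 ≤ κ' := by
    rw [div_le_iff₀ (by positivity), ← div_le_iff₀' hκ']
    calc M / κ' = √(M / κ') ^ 2 := (Real.sq_sqrt (by positivity)).symm
      _ ≤ N ^ 2 := by gcongr; linarith
  filter_upwards [ENNReal.tendsto_nhds_zero.1 (hqm (ε / (1 + N)) (by positivity)) (κ / 2)
    (ENNReal.half_pos hκ.ne')] with m hm
  have hsub : {s | ε ≤ ‖r m s - (0 : S → E) s‖}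
      ⊆ {s | ε / (1 + N) ≤ ‖q m s - (0 : S → ℝ) s‖} ∪ {s | N ^ 2 ≤ y m s ^ 2} := by
    intro s hs
    simp only [mem_union, mem_ofPred_eq, Pi.zero_apply, sub_zero] at hs ⊢
    by_cases hyN : N ≤ y m s
    · exact Or.inr (by gcongr)
    · left
      have h1 : 0 < 1 + y m s := by linarith [hy0 m s]
      rw [Real.norm_eq_abs, abs_of_nonneg (div_nonneg (norm_nonneg _) h1.le)]
      exact div_le_div₀ (norm_nonneg _) hs h1 (by linarith)
  have hcheb : P {s | N ^ 2 ≤ y m s ^ 2} ≤ κ / 2 := by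
    have h1 := mul_meas_ge_le_integral_of_nonneg
      (ae_of_all P fun s => sq_nonneg (y m s)) (hyint m) (N ^ 2)
    have h2 : P.real {s | N ^ 2 ≤ y m s ^ 2} ≤ κ' := by
      refine le_trans ?_ hN2
      rw [le_div_iff₀ (by positivity), mul_comm]
      exact h1.trans (hyM m)
    rw [← ofReal_measureReal]
    exact (ENNReal.ofReal_le_ofReal h2).trans hκκ'
  calc P {s | ε ≤ ‖r m s - (0 : S → E) s‖} ≤ κ / 2 + κ / 2 :=
        (measure_mono hsub).trans ((measure_union_le _ _).trans (add_le_add hm hcheb))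
    _ = κ := ENNReal.add_halves κ

end Sampling

/-! ### First-order expansion of the particle system -/

section CompactSupport

variable {X : Type*} [TopologicalSpace X] [MeasurableSpace X] [BorelSpace X]
  [SecondCountableTopology X] {μ : Measure X} {E : Type*} [NormedAddCommGroup E]

lemma ContinuousOn.aestronglyMeasurable_of_support {f : X → E} (hf : ContinuousOn f μ.support) :
    AEStronglyMeasurable f μ := by
  have h := hf.aestronglyMeasurable (μ := μ) Measure.isClosed_support.measurableSet
  rwa [restrict_support_eq_self] at h

lemma ContinuousOn.memLp_of_isCompact_support [IsFiniteMeasure μ] (hK : IsCompact μ.support)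
    {f : X → E} (hf : ContinuousOn f μ.support) (p : ℝ≥0∞) : MemLp f p μ := by
  obtain ⟨M, hM⟩ := hK.exists_bound_of_continuousOn hf
  refine MemLp.of_bound hf.aestronglyMeasurable_of_support M ?_
  filter_upwards [Measure.support_mem_ae] with x hx using hM x hx

lemma ContinuousOn.integrable_of_isCompact_support [IsFiniteMeasure μ] (hK : IsCompact μ.support)
    {f : X → E} (hf : ContinuousOn f μ.support) : Integrable f μ :=
  memLp_one_iff_integrable.1 (hf.memLp_of_isCompact_support hK 1)

/-- A strong law of large numbers, uniform with respect to a parameter in a compact space `Y`: the law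
of large numbers in the Banach space `C(Y, E)`. -/
lemma ae_eventually_norm_avg_sub_le [IsFiniteMeasure μ] [NormedSpace ℝ E] [CompleteSpace E]
    {S : Type*} [MeasurableSpace S] {P : Measure S} {ξ : ℕ → S → X}
    (hlaw : ∀ i, HasLaw (ξ i) μ P) (hindep : iIndepFun ξ P) (hK : IsCompact μ.support)
    {Y : Type*} [TopologicalSpace Y] [CompactSpace Y] {f : Y → X → E}
    (hf : Continuous fun q : Y × μ.support => f q.1 q.2) :
    ∀ᵐ s ∂P, ∀ ε > 0, ∀ᶠ m : ℕ in atTop, ∀ y,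
      ‖(avg fun i : Fin m => f y (ξ i s)) - ∫ x, f y x ∂μ‖ ≤ ε := by
  classical
  set F : C(μ.support, C(Y, E)) := ContinuousMap.curry ⟨fun q => f q.2 q.1,
    hf.comp continuous_swap⟩ with hF
  set g : X → C(Y, E) := fun x => if hx : x ∈ μ.support then F ⟨x, hx⟩ else 0 with hg
  have hgF : ∀ x : μ.support, g x = F x := fun x => dif_pos x.2
  have hgval : ∀ x ∈ μ.support, ∀ y, g x y = f y x := fun x hx y => by
    rw [hgF ⟨x, hx⟩]; rfl
  have hgc : ContinuousOn g μ.support := continuousOn_iff_continuous_domRestrict.2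
    (F.continuous.congr fun x => (hgF x).symm)
  have hgi : Integrable g μ := hgc.integrable_of_isCompact_support hK
  have hmem : ∀ᵐ s ∂P, ∀ i, ξ i s ∈ μ.support := ae_all_iff.2 fun i => by
    have h1 : ∀ᵐ x ∂(P.map (ξ i)), x ∈ μ.support := by
      rw [(hlaw i).map_eq]; exact Measure.support_mem_ae
    exact ae_of_ae_map (hlaw i).aemeasurable h1
  filter_upwards [ae_tendsto_avg hlaw hindep hgi, hmem] with s hs hsm ε hε
  filter_upwards [Metric.tendsto_nhds.1 hs ε hε] with m hm y
  have h1 : (avg fun i : Fin m => g (ξ i s)) y = avg fun i : Fin m => f y (ξ i s) := by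
    rw [avg, avg, ContinuousMap.smul_apply, ContinuousMap.sum_apply]
    exact congrArg _ (Finset.sum_congr rfl fun i _ => hgval _ (hsm i) y)
  have h2 : (∫ x, g x ∂μ) y = ∫ x, f y x ∂μ := by
    rw [ContinuousMap.integral_apply hgi]
    refine integral_congr_ae ?_
    filter_upwards [Measure.support_mem_ae] with x hx using hgval x hx y
  rw [← h1, ← h2, ← ContinuousMap.sub_apply]
  rw [dist_eq_norm] at hm
  exact (ContinuousMap.norm_coe_le_norm _ y).trans hm.le

end CompactSupport

/-- First-order expansion of an average of values of a `C¹` function, uniform in the number of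
points. -/
lemma exists_avg_expansion {E F : Type*} [NormedAddCommGroup E] [NormedSpace ℝ E]
    [NormedAddCommGroup F] [NormedSpace ℝ F] {χ : E → F} {C : Set E} (hC : IsCompact C)
    (hχ : ∀ x ∈ C, ContDiffAt ℝ 1 χ x) {R ε : ℝ} (hR : 0 ≤ R) (hε : 0 < ε) :
    ∃ η > 0, ∀ (m : ℕ) (x X v : Fin m → E) (δ : ℝ), 0 ≤ δ → δ ≤ η → (∀ i, X i ∈ C) →
      (∀ i, ‖x i - X i‖ ≤ R * δ) → (∀ i, ‖x i - X i - v i‖ ≤ η * δ) →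
      ‖(avg fun i => χ (x i)) - (avg fun i => χ (X i)) - avg fun i => fderiv ℝ χ (X i) (v i)‖
        ≤ ε * δ := by
  obtain ⟨M, hM⟩ := exists_fderiv_bound hC hχ
  obtain ⟨r, hr, hdiff⟩ := exists_uniform_differentiable hC hχ
    (show 0 < ε / (2 * (R + 1)) by positivity)
  refine ⟨min (r / (R + 1)) (ε / (2 * (|M| + 1))), by positivity,
    fun m x X v δ hδ hδη hX hx hv => ?_⟩
  rw [← avg_sub, ← avg_sub]
  refine norm_avg_le (by positivity) fun i => ?_
  have h1 : ‖x i - X i‖ ≤ r := by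
    have h2 : δ ≤ r / (R + 1) := hδη.trans (min_le_left _ _)
    rw [le_div_iff₀ (by positivity)] at h2
    nlinarith [hx i]
  have h3 : ‖fderiv ℝ χ (X i) (x i - X i - v i)‖ ≤ (|M| + 1) * (ε / (2 * (|M| + 1)) * δ) := by
    refine (ContinuousLinearMap.le_opNorm _ _).trans (mul_le_mul ?_ ?_ (norm_nonneg _)
      (by positivity))
    · linarith [hM _ (hX i), le_abs_self M]
    · exact (hv i).trans (by gcongr; exact min_le_right _ _)
  calc ‖χ (x i) - χ (X i) - fderiv ℝ χ (X i) (v i)‖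
      = ‖(χ (x i) - χ (X i) - fderiv ℝ χ (X i) (x i - X i))
        + fderiv ℝ χ (X i) (x i - X i - v i)‖ := by
        congr 1; simp only [map_sub]; abel
    _ ≤ ε / (2 * (R + 1)) * (R * δ) + (|M| + 1) * (ε / (2 * (|M| + 1)) * δ) :=
        (norm_add_le _ _).trans (add_le_add ((hdiff _ (hX i) _ h1).trans
          (mul_le_mul_of_nonneg_left (hx i) (by positivity))) h3)
    _ = ε / 2 * (R / (R + 1)) * δ + ε / 2 * δ := by field_simp
    _ ≤ ε / 2 * 1 * δ + ε / 2 * δ := by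
        gcongr
        exact div_le_one_of_le₀ (by linarith) (by positivity)
    _ = ε * δ := by ring

namespace IsMeanFieldSolution

variable {k n : ℕ} {b₀ : Euc k → Euc k} {b₁ : Euc k → Euc n →L[ℝ] Euc k}
  {Φ : Euc k → Euc n} {D D₀ : Set (Euc k)} {μ₀ : Measure (Euc k)} {Θ : ℝ → Euc k → Euc k}
  {H : Type*} [NormedAddCommGroup H] [NormedSpace ℝ H] [CompleteSpace H]
  {Ψ : Euc k → H} {G : ℝ → H →L[ℝ] Euc n} {T : ℝ → Euc k → H →L[ℝ] Euc k}

/-- Along a sample for which the laws of large numbers hold, the trajectories of the particle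
system, and the trajectories from finitely many further points, follow the mean-field flow up to
the linear response to the sampling error `Δ`, with a remainder `o(‖Δ‖)` that is uniform over the
particles. -/
theorem eventually_linearization (h : IsMeanFieldSolution b₀ b₁ Φ D D₀ μ₀ Θ) [IsFiniteMeasure μ₀]
    (hΨ : ContinuousOn Ψ μ₀.support) (hG : Continuous G)
    (hGΨ : ∀ t, 0 ≤ t → ∀ θ ∈ μ₀.support, G t (Ψ θ) = Φ (Θ t θ))
    (hT : ContinuousOn (fun q : ℝ × Euc k => T q.1 q.2) (Ici 0 ×ˢ D₀))
    (hT0 : ∀ θ ∈ D₀, T 0 θ = 0)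
    (hT' : ∀ t, 0 ≤ t → ∀ θ ∈ D₀, HasDerivWithinAt (fun s => T s θ)
      ((fderiv ℝ b₀ (Θ t θ) + (fderiv ℝ b₁ (Θ t θ)).flip (∫ θ', Φ (Θ t θ') ∂μ₀)) ∘L T t θ
        + b₁ (Θ t θ) ∘L (∫ θ', fderiv ℝ Φ (Θ t θ') ∘L T t θ' ∂μ₀ + G t)) (Ici 0) t)
    {τ : ℝ} {b : ℕ} {pt : Fin b → Euc k} (hpt : ∀ j, pt j ∈ D₀)
    {z : ℕ → Euc k} (hz : ∀ i, z i ∈ μ₀.support)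
    (hlln : Tendsto (fun m : ℕ => avg fun i : Fin m => Ψ (z i)) atTop (𝓝 (∫ θ, Ψ θ ∂μ₀)))
    (hlln' : ∀ ε > 0, ∀ᶠ m : ℕ in atTop, ∀ t ∈ Icc 0 τ,
      ‖(avg fun i : Fin m => fderiv ℝ Φ (Θ t (z i)) ∘L T t (z i))
        - ∫ θ, fderiv ℝ Φ (Θ t θ) ∘L T t θ ∂μ₀‖ ≤ ε)
    {x : ∀ m : ℕ, Fin m → ℝ → Euc k} {y : ℕ → Fin b → ℝ → Euc k}
    (hx : ∀ m i, x m i 0 = z i ∧ ∀ t ∈ Icc 0 τ, HasDerivWithinAt (x m i)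
      (b₀ (x m i t) + b₁ (x m i t) (avg fun l => Φ (x m l t))) (Icc 0 τ) t)
    (hy : ∀ᶠ m in atTop, ∀ j, y m j 0 = pt j ∧ ∀ t ∈ Icc 0 τ, HasDerivWithinAt (y m j)
      (b₀ (y m j t) + b₁ (y m j t) (avg fun l => Φ (x m l t))) (Icc 0 τ) t) :
    ∃ R, 0 ≤ R ∧ ∀ ε > 0, ∀ᶠ m : ℕ in atTop, ∀ t ∈ Icc 0 τ,
      (∀ i : Fin m, ‖x m i t - Θ t (z i)‖
          ≤ R * ‖(avg fun i : Fin m => Ψ (z i)) - ∫ θ, Ψ θ ∂μ₀‖ ∧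
        ‖x m i t - Θ t (z i) - T t (z i) ((avg fun i : Fin m => Ψ (z i)) - ∫ θ, Ψ θ ∂μ₀)‖
          ≤ ε * ‖(avg fun i : Fin m => Ψ (z i)) - ∫ θ, Ψ θ ∂μ₀‖) ∧
      ∀ j, ‖y m j t - Θ t (pt j) - T t (pt j) ((avg fun i : Fin m => Ψ (z i)) - ∫ θ, Ψ θ ∂μ₀)‖
          ≤ ε * ‖(avg fun i : Fin m => Ψ (z i)) - ∫ θ, Ψ θ ∂μ₀‖ := by
  have hΨi : Integrable Ψ μ₀ := hΨ.integrable_of_isCompact_support h.isCompact_support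
  have cΦ : ∀ θ ∈ D, ContinuousAt Φ θ := fun θ hθ => (h.contDiff_observable θ hθ).continuousAt
  have cdΦ : ∀ θ ∈ D, ContinuousAt (fderiv ℝ Φ) θ := fun θ hθ =>
    (h.contDiff_observable θ hθ).continuousAt_fderiv_one
  have hcomp : ∀ t, 0 ≤ t → Integrable (fun θ => fderiv ℝ Φ (Θ t θ) ∘L T t θ) μ₀ := by
    intro t ht
    have hTt : ContinuousOn (fun θ => T t θ) μ₀.support :=
      hT.comp (f := fun θ => (t, θ)) (by fun_prop) fun θ hθ => ⟨mem_Ici.2 ht, h.support_subset hθ⟩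
    exact (((h.continuousOn_comp cdΦ ht).mono h.support_subset).clm_comp
      hTt).integrable_of_isCompact_support h.isCompact_support
  -- a compact set of reference positions
  set K : Set (Euc k) := μ₀.support ∪ range pt with hK
  have hKD₀ : K ⊆ D₀ := union_subset h.support_subset (range_subset_iff.2 hpt)
  have hKc : IsCompact K := h.isCompact_support.union (finite_range pt).isCompact
  set C : Set (Euc k) := (fun q : ℝ × Euc k => Θ q.1 q.2) '' (Icc 0 τ ×ˢ K) with hC
  have hCc : IsCompact C := (isCompact_Icc.prod hKc).image_of_continuousOn
    (h.continuousOn.mono (prod_mono Icc_subset_Ici_self hKD₀))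
  have hCD : C ⊆ D := by
    rintro _ ⟨q, hq, rfl⟩
    exact h.mem _ hq.1.1 _ (hKD₀ hq.2)
  obtain ⟨U, hU⟩ := isCompact_Icc.exists_bound_of_continuousOn (s := Icc 0 τ)
    (h.continuous_mean cΦ).continuousOn
  obtain ⟨M, hM⟩ := isCompact_Icc.exists_bound_of_continuousOn (s := Icc 0 τ) hG.continuousOn
  set M' : ℝ := |M| + 1 with hM'
  have hM'0 : 0 < M' := by positivity
  obtain ⟨R, hR, hlin⟩ := particle_linearization hCc (fun θ hθ => h.contDiff_drift θ (hCD hθ))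
    (fun θ hθ => h.contDiff_coupling θ (hCD hθ)) (fun θ hθ => h.contDiff_observable θ (hCD hθ))
    (τ := τ) (abs_nonneg U)
  refine ⟨R * M', by positivity, fun ε hε => ?_⟩
  obtain ⟨η, hη, hlin⟩ := hlin (ε / M') (by positivity)
  have hΔ : ∀ᶠ m : ℕ in atTop,
      M' * ‖(avg fun i : Fin m => Ψ (z i)) - ∫ θ, Ψ θ ∂μ₀‖ ≤ η := by
    filter_upwards [Metric.tendsto_nhds.1 hlln (η / M') (by positivity)] with m hm
    rw [dist_eq_norm, lt_div_iff₀ hM'0] at hm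
    linarith
  filter_upwards [hy, hΔ, hlln' η hη, eventually_gt_atTop 0] with m hym hΔm hLm hm0
  set Δ : H := (avg fun i : Fin m => Ψ (z i)) - ∫ θ, Ψ θ ∂μ₀ with hΔdef
  have hzK : ∀ i, z i ∈ D₀ := fun i => h.support_subset (hz i)
  -- the particles and the further trajectories form one system
  set q : Fin m ⊕ Fin b → Euc k := Sum.elim (fun i => z i) pt with hq
  have hqK : ∀ i, q i ∈ K := by
    rintro (i | j)
    · exact Or.inl (hz i)
    · exact Or.inr (mem_range_self j)
  have hsub : Icc (0 : ℝ) τ ⊆ Ici 0 := Icc_subset_Ici_self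
  have hsys := hlin (Fin m ⊕ Fin b) m Sum.inl (Sum.elim (x m) (y m)) (fun i t => Θ t (q i))
    (fun i t => T t (q i) Δ) (fun t => ∫ θ, Φ (Θ t θ) ∂μ₀) (fun t => G t Δ)
    (fun t => (∫ θ, fderiv ℝ Φ (Θ t θ) ∘L T t θ ∂μ₀ + G t) Δ) (M' * ‖Δ‖) (by positivity) hΔm
    (fun i t ht => ⟨(t, q i), ⟨ht, hqK i⟩, rfl⟩)
    (fun t ht => by
      have := hU t ht
      rw [max_eq_left ht.1] at this
      exact this.trans (le_abs_self U))
    (fun i => by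
      rw [h.init _ (hKD₀ (hqK i))]
      rcases i with i | j
      · exact (hx m i).1.symm
      · exact (hym j).1.symm)
    (fun i => by rw [hT0 _ (hKD₀ (hqK i))]; simp)
    (fun i t ht => (h.hasDerivWithinAt t ht.1 _ (hKD₀ (hqK i))).mono hsub)
    (fun i t ht => by
      rcases i with i | j
      · exact (hx m i).2 t ht
      · exact (hym j).2 t ht)
    (fun i t ht => by
      have h1 := ((hT' t ht.1 _ (hKD₀ (hqK i))).mono hsub).clm_apply
        (hasDerivWithinAt_const t (Icc 0 τ) Δ)
      simpa using h1)
    (fun t ht => by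
      have h1 : ∫ θ, Φ (Θ t θ) ∂μ₀ = G t (∫ θ, Ψ θ ∂μ₀) := by
        rw [← ContinuousLinearMap.integral_comp_comm _ hΨi]
        refine integral_congr_ae ?_
        filter_upwards [Measure.support_mem_ae] with θ hθ using (hGΨ t ht.1 θ hθ).symm
      simp only [hΔdef, map_sub, map_avg, hGΨ t ht.1 _ (hz _), h1, hq, Sum.elim_inl])
    (fun t ht => (ContinuousLinearMap.le_opNorm _ _).trans (by
      gcongr
      linarith [hM t ht, le_abs_self M]))
    (fun t ht => by
      have h1 : (avg fun l : Fin m => fderiv ℝ Φ (Θ t (z l)) (T t (z l) Δ))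
          = (avg fun l : Fin m => fderiv ℝ Φ (Θ t (z l)) ∘L T t (z l)) Δ := by
        simp [avg]
      simp only [hq, Sum.elim_inl, h1, add_apply, add_sub_cancel_right]
      rw [norm_sub_rev, ← sub_apply]
      refine (ContinuousLinearMap.le_opNorm _ _).trans ?_
      refine mul_le_mul (hLm t ht) ?_ (norm_nonneg _) hη.le
      exact le_mul_of_one_le_left (norm_nonneg _) (by rw [hM']; linarith [abs_nonneg M]))
  refine fun t ht => ⟨fun i => ⟨?_, ?_⟩, fun j => ?_⟩
  · rw [mul_assoc]; exact (hsys (Sum.inl i) t ht).1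
  · have := (hsys (Sum.inl i) t ht).2
    rwa [← mul_assoc, div_mul_cancel₀ _ hM'0.ne'] at this
  · have := (hsys (Sum.inr j) t ht).2
    rwa [← mul_assoc, div_mul_cancel₀ _ hM'0.ne'] at this

/-- The empirical mean of a `C¹` observable of the particles is, up to `o(‖Δ‖)`, the empirical mean
of a fixed function of the initial sample: the value along the mean-field flow plus the mean
response of the observable. -/
theorem eventually_observable_expansion (h : IsMeanFieldSolution b₀ b₁ Φ D D₀ μ₀ Θ)
    [IsFiniteMeasure μ₀] (hΨ : ContinuousOn Ψ μ₀.support) {t : ℝ} (ht : 0 ≤ t)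
    {χ : Euc k → ℝ} (hχ : ∀ θ ∈ D, ContDiffAt ℝ 1 χ θ)
    {z : ℕ → Euc k} (hz : ∀ i, z i ∈ μ₀.support) {L : H →L[ℝ] ℝ}
    (hlln : Tendsto (fun m : ℕ => avg fun i : Fin m => Ψ (z i)) atTop (𝓝 (∫ θ, Ψ θ ∂μ₀)))
    (hlln' : Tendsto (fun m : ℕ => avg fun i : Fin m => fderiv ℝ χ (Θ t (z i)) ∘L T t (z i)) atTop
      (𝓝 L))
    {x : ∀ m : ℕ, Fin m → Euc k} {R : ℝ} (hR : 0 ≤ R)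
    (hx : ∀ ε > 0, ∀ᶠ m : ℕ in atTop, ∀ i : Fin m,
      ‖x m i - Θ t (z i)‖ ≤ R * ‖(avg fun i : Fin m => Ψ (z i)) - ∫ θ, Ψ θ ∂μ₀‖ ∧
      ‖x m i - Θ t (z i) - T t (z i) ((avg fun i : Fin m => Ψ (z i)) - ∫ θ, Ψ θ ∂μ₀)‖
        ≤ ε * ‖(avg fun i : Fin m => Ψ (z i)) - ∫ θ, Ψ θ ∂μ₀‖) :
    ∀ ε > 0, ∀ᶠ m : ℕ in atTop,
      ‖((avg fun i : Fin m => χ (x m i)) - ∫ θ, χ (Θ t θ) ∂μ₀)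
        - ((avg fun i : Fin m => χ (Θ t (z i)) + L (Ψ (z i)))
          - ∫ θ, (χ (Θ t θ) + L (Ψ θ)) ∂μ₀)‖
      ≤ ε * ‖(avg fun i : Fin m => Ψ (z i)) - ∫ θ, Ψ θ ∂μ₀‖ := by
  intro ε hε
  have hΨi : Integrable Ψ μ₀ := hΨ.integrable_of_isCompact_support h.isCompact_support
  have hχc : ContinuousOn (fun θ => χ (Θ t θ)) μ₀.support :=
    (h.continuousOn_comp (fun θ hθ => (hχ θ hθ).continuousAt) ht).mono h.support_subset
  have hΘc : ContinuousOn (fun θ => Θ t θ) μ₀.support :=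
    (h.continuousOn_comp (f := id) (fun θ _ => continuousAt_id) ht).mono h.support_subset
  have hCc : IsCompact (Θ t '' μ₀.support) := h.isCompact_support.image_of_continuousOn hΘc
  have hCD : Θ t '' μ₀.support ⊆ D := by
    rintro _ ⟨θ, hθ, rfl⟩
    exact h.mem t ht θ (h.support_subset hθ)
  obtain ⟨η, hη, hexp⟩ := exists_avg_expansion hCc (fun θ hθ => hχ θ (hCD hθ)) hR (half_pos hε)
  filter_upwards [hx η hη, Metric.tendsto_nhds.1 hlln η hη,
    Metric.tendsto_nhds.1 hlln' (ε / 2) (half_pos hε)] with m hxm hΔm hLm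
  set Δ : H := (avg fun i : Fin m => Ψ (z i)) - ∫ θ, Ψ θ ∂μ₀ with hΔ
  rw [dist_eq_norm] at hΔm hLm
  have h1 := hexp m (x m) (fun i => Θ t (z i)) (fun i => T t (z i) Δ) ‖Δ‖ (norm_nonneg _) hΔm.le
    (fun i => mem_image_of_mem _ (hz i)) (fun i => (hxm i).1) (fun i => (hxm i).2)
  have h2 : (avg fun i : Fin m => fderiv ℝ χ (Θ t (z i)) (T t (z i) Δ))
      = (avg fun i : Fin m => fderiv ℝ χ (Θ t (z i)) ∘L T t (z i)) Δ := by simp [avg]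
  have h3 : ‖((avg fun i : Fin m => fderiv ℝ χ (Θ t (z i)) ∘L T t (z i)) - L) Δ‖
      ≤ ε / 2 * ‖Δ‖ :=
    (ContinuousLinearMap.le_opNorm _ _).trans (by gcongr)
  have h4 : ∫ θ, (χ (Θ t θ) + L (Ψ θ)) ∂μ₀ = ∫ θ, χ (Θ t θ) ∂μ₀ + L (∫ θ, Ψ θ ∂μ₀) := by
    rw [integral_add (hχc.integrable_of_isCompact_support h.isCompact_support)
      (L.integrable_comp hΨi), L.integral_comp_comm hΨi]
  rw [h2] at h1
  calc _ = ‖((avg fun i : Fin m => χ (x m i)) - (avg fun i : Fin m => χ (Θ t (z i)))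
          - (avg fun i : Fin m => fderiv ℝ χ (Θ t (z i)) ∘L T t (z i)) Δ)
        + ((avg fun i : Fin m => fderiv ℝ χ (Θ t (z i)) ∘L T t (z i)) - L) Δ‖ := by
        rw [h4, avg_add, ← map_avg]
        congr 1
        simp only [sub_apply, hΔ, map_sub]
        ring
    _ ≤ ε / 2 * ‖Δ‖ + ε / 2 * ‖Δ‖ := (norm_add_le _ _).trans (add_le_add h1 h3)
    _ = ε * ‖Δ‖ := by ring

end IsMeanFieldSolution

/-! ### The fluctuation limit -/

section FiniteDimensional

variable {E : Type*} [NormedAddCommGroup E] [NormedSpace ℝ E] [FiniteDimensional ℝ E]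
  [MeasurableSpace E] [BorelSpace E] {S : Type*} [MeasurableSpace S] {P : Measure S}

lemma aemeasurable_of_forall_dual {f : S → E}
    (hf : ∀ L : E →L[ℝ] ℝ, AEMeasurable (fun s => L (f s)) P) : AEMeasurable f P := by
  set b := Module.finBasis ℝ E
  have h : f = fun s => ∑ i, (b.coord i).toContinuousLinearMap (f s) • b i := by
    funext s
    exact (b.sum_repr (f s)).symm
  rw [h]
  have := FiniteDimensional.proper_real E
  exact Finset.aemeasurable_fun_sum _ fun i _ => (hf _).smul_const (b i)

/-- The central limit theorem in a finite-dimensional space, with the limit described by the laws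
of its linear functionals. -/
theorem tendstoInDistribution_sqrt_smul_avg_sub_of_dual {X : Type*} [MeasurableSpace X]
    {μ : Measure X} {ξ : ℕ → S → X} [IsProbabilityMeasure P] [IsProbabilityMeasure μ]
    {S' : Type*} [MeasurableSpace S'] {P' : Measure S'} [IsProbabilityMeasure P']
    (hlaw : ∀ i, HasLaw (ξ i) μ P) (hindep : iIndepFun ξ P) {f : X → E} (hf : MemLp f 2 μ)
    {V : S' → E} (hgauss : ∀ L : E →L[ℝ] ℝ, HasLaw (fun s => L (V s))
      (gaussianReal 0 Var[fun x => L (f x); μ].toNNReal) P') :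
    TendstoInDistribution
      (fun (m : ℕ) s => √(m : ℝ) • ((avg fun i : Fin m => f (ξ i s)) - ∫ x, f x ∂μ)) atTop V
      (fun _ => P) P' := by
  set e : E ≃L[ℝ] EuclideanSpace ℝ (Fin (Module.finrank ℝ E)) := toEuclidean with he
  set e' : E →L[ℝ] EuclideanSpace ℝ (Fin (Module.finrank ℝ E)) := e.toContinuousLinearMap
  have hV : AEMeasurable V P' := aemeasurable_of_forall_dual fun L => (hgauss L).aemeasurable
  have hef : MemLp (fun x => e (f x)) 2 μ := e'.comp_memLp' hf
  have h := tendstoInDistribution_sqrt_smul_avg_sub hlaw hindep hef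
    (V := fun s => e (V s)) (e.continuous.measurable.comp_aemeasurable hV)
    fun v => hgauss (innerSL ℝ v ∘L e')
  have h' := h.continuous_comp e.symm.continuous
  have hint : ∫ x, e (f x) ∂μ = e (∫ x, f x ∂μ) :=
    e'.integral_comp_comm (hf.integrable (by norm_num))
  convert h' using 2
  · funext s
    simp [hint, avg]
  · funext s
    simp

end FiniteDimensional

/-- The marginals of the limiting Gaussian measure. -/
lemma hasLaw_processOfLp {α S : Type} [MeasurableSpace α] [MeasurableSpace S] {μ : Measure α}
    {P : Measure S} [IsProbabilityMeasure μ] [IsProbabilityMeasure P] {Z : Lp ℝ 2 μ →L[ℝ] Lp ℝ 2 P}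
    (hgauss : ∀ f, HasGaussianLaw (Z f) P) (hmean : ∀ f, ∫ s, Z f s ∂P = 0)
    (hcov : ∀ f g, inner ℝ (Z f) (Z g) = ∫ θ, f θ * g θ ∂μ - (∫ θ, f θ ∂μ) * ∫ θ, g θ ∂μ)
    {f : α → ℝ} (hf : MemLp f 2 μ) :
    HasLaw (processOfLp Z f) (gaussianReal 0 Var[f; μ].toNNReal) P := by
  have hvar : Var[Z (hf.toLp f); P] = Var[f; μ] := by
    rw [variance_eq_sub (Lp.memLp _), hmean, variance_eq_sub hf]
    have h1 := hcov (hf.toLp f) (hf.toLp f)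
    rw [L2.inner_def] at h1
    have h2 : ∫ s, (Z (hf.toLp f) ^ 2 : S → ℝ) s ∂P
        = ∫ s, inner ℝ (Z (hf.toLp f) s) (Z (hf.toLp f) s) ∂P := by
      refine integral_congr_ae (ae_of_all _ fun s => ?_)
      simp [pow_two]
    have h3 : ∫ θ, hf.toLp f θ * hf.toLp f θ ∂μ = ∫ θ, (f ^ 2) θ ∂μ := by
      refine integral_congr_ae ?_
      filter_upwards [hf.coeFn_toLp] with θ hθ
      rw [hθ]; simp [pow_two]
    have h4 : ∫ θ, hf.toLp f θ ∂μ = ∫ θ, f θ ∂μ := integral_congr_ae hf.coeFn_toLp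
    rw [h2, h1, h3, h4]
    ring
  rw [processOfLp_of_memLp Z hf]
  exact ⟨(Lp.aestronglyMeasurable _).aemeasurable, by
    rw [(hgauss _).map_eq_gaussianReal, hmean, hvar]⟩

namespace IsMeanFieldSolution

variable {k n : ℕ} {b₀ : Euc k → Euc k} {b₁ : Euc k → Euc n →L[ℝ] Euc k}
  {Φ : Euc k → Euc n} {D D₀ : Set (Euc k)} {μ₀ : Measure (Euc k)} {Θ : ℝ → Euc k → Euc k}
  {H : Type*} [NormedAddCommGroup H] [InnerProductSpace ℝ H] [CompleteSpace H]
  {Ψ : Euc k → H} {G : ℝ → H →L[ℝ] Euc n} {T : ℝ → Euc k → H →L[ℝ] Euc k}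

/-- Joint convergence in law of the rescaled fluctuations of finitely many observables of the
particle system and of finitely many further trajectories. -/
theorem tendstoInDistribution_fluctuation (h : IsMeanFieldSolution b₀ b₁ Φ D D₀ μ₀ Θ)
    [IsProbabilityMeasure μ₀] (hΨ : ContinuousOn Ψ μ₀.support) (hG : Continuous G)
    (hGΨ : ∀ t, 0 ≤ t → ∀ θ ∈ μ₀.support, G t (Ψ θ) = Φ (Θ t θ))
    (hT : ContinuousOn (fun q : ℝ × Euc k => T q.1 q.2) (Ici 0 ×ˢ D₀))
    (hT0 : ∀ θ ∈ D₀, T 0 θ = 0)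
    (hT' : ∀ t, 0 ≤ t → ∀ θ ∈ D₀, HasDerivWithinAt (fun s => T s θ)
      ((fderiv ℝ b₀ (Θ t θ) + (fderiv ℝ b₁ (Θ t θ)).flip (∫ θ', Φ (Θ t θ') ∂μ₀)) ∘L T t θ
        + b₁ (Θ t θ) ∘L (∫ θ', fderiv ℝ Φ (Θ t θ') ∘L T t θ' ∂μ₀ + G t)) (Ici 0) t)
    -- the sample and the systems started from it
    {S : Type*} [MeasurableSpace S] {P : Measure S} [IsProbabilityMeasure P]
    {ξ : ℕ → S → Euc k} (hlaw : ∀ i, HasLaw (ξ i) μ₀ P) (hindep : iIndepFun ξ P)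
    {b : ℕ} {pt : Fin b → Euc k} (hpt : ∀ j, pt j ∈ D₀)
    {x : ∀ m : ℕ, Fin m → ℝ → S → Euc k} {y : ℕ → Fin b → ℝ → S → Euc k} {τ : ℝ}
    (hx : ∀ m, ∀ᵐ s ∂P, ∀ i, x m i 0 s = ξ i s ∧ ∀ t ∈ Icc 0 τ,
      HasDerivWithinAt (fun t => x m i t s)
        (b₀ (x m i t s) + b₁ (x m i t s) (avg fun l => Φ (x m l t s))) (Icc 0 τ) t)
    (hy : ∀ j, ∀ᵐ s ∂P, ∀ᶠ m in atTop, y m j 0 s = pt j ∧ ∀ t ∈ Icc 0 τ,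
      HasDerivWithinAt (fun t => y m j t s)
        (b₀ (y m j t s) + b₁ (y m j t s) (avg fun l => Φ (x m l t s))) (Icc 0 τ) t)
    -- the Gaussian limit
    {S' : Type} [MeasurableSpace S'] {P' : Measure S'} [IsProbabilityMeasure P']
    {Z : Lp ℝ 2 μ₀ →L[ℝ] Lp ℝ 2 P'}
    (hgauss : ∀ f, HasGaussianLaw (Z f) P') (hmean : ∀ f, ∫ s, Z f s ∂P' = 0)
    (hcov : ∀ f g, inner ℝ (Z f) (Z g) = ∫ θ, f θ * g θ ∂μ₀ - (∫ θ, f θ ∂μ₀) * ∫ θ, g θ ∂μ₀)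
    {Y : S' → H}
    (hY : ∀ L : H →L[ℝ] ℝ, ∀ᵐ s ∂P', L (Y s) = processOfLp Z (fun θ => L (Ψ θ)) s)
    {t : ℝ} (ht : t ∈ Icc 0 τ) {a : ℕ} {χ : Fin a → Euc k → ℝ}
    (hχ : ∀ i, ∀ θ ∈ D, ContDiffAt ℝ 1 (χ i) θ)
    (hmeas : ∀ m : ℕ, AEMeasurable (fun s =>
      (((fun i => √(m : ℝ) * ((avg fun l : Fin m => χ i (x m l t s)) - ∫ θ, χ i (Θ t θ) ∂μ₀)),
        fun j => √(m : ℝ) • (y m j t s - Θ t (pt j))) : (Fin a → ℝ) × (Fin b → Euc k))) P) :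
    TendstoInDistribution (fun (m : ℕ) s =>
        (((fun i => √(m : ℝ) * ((avg fun l : Fin m => χ i (x m l t s)) - ∫ θ, χ i (Θ t θ) ∂μ₀)),
          fun j => √(m : ℝ) • (y m j t s - Θ t (pt j))) : (Fin a → ℝ) × (Fin b → Euc k))) atTop
      (fun s => ((fun i => processOfLp Z (fun θ => χ i (Θ t θ)) s
          + (∫ θ, fderiv ℝ (χ i) (Θ t θ) ∘L T t θ ∂μ₀) (Y s)), fun j => T t (pt j) (Y s)))
      (fun _ => P) P' := by
  have hK := h.isCompact_support
  have hχc : ∀ i, ContinuousOn (fun θ => χ i (Θ t θ)) μ₀.support := fun i =>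
    (h.continuousOn_comp (fun θ hθ => (hχ i θ hθ).continuousAt) ht.1).mono h.support_subset
  set L : Fin a → H →L[ℝ] ℝ := fun i => ∫ θ, fderiv ℝ (χ i) (Θ t θ) ∘L T t θ ∂μ₀ with hL
  -- the function of the initial point whose normalized sums carry the limit
  set Λ : H →L[ℝ] (Fin a → ℝ) × (Fin b → Euc k) :=
    (ContinuousLinearMap.pi L).prod (ContinuousLinearMap.pi fun j => T t (pt j)) with hΛ
  set f : Euc k → (Fin a → ℝ) × (Fin b → Euc k) :=
    fun θ => ((fun i => χ i (Θ t θ)), 0) + Λ (Ψ θ) with hf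
  have hfc : ContinuousOn f μ₀.support :=
    ((continuousOn_pi.2 hχc).prodMk continuousOn_const).add (Λ.continuous.comp_continuousOn hΨ)
  have hf2 : MemLp f 2 μ₀ := hfc.memLp_of_isCompact_support hK 2
  have hΨ2 : MemLp Ψ 2 μ₀ := hΨ.memLp_of_isCompact_support hK 2
  have hΨi : Integrable Ψ μ₀ := hΨ2.integrable (by norm_num)
  have hclt := tendstoInDistribution_sqrt_smul_avg_sub_of_dual hlaw hindep hf2 (P' := P')
    (V := fun s => ((fun i => processOfLp Z (fun θ => χ i (Θ t θ)) s + L i (Y s)),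
      fun j => T t (pt j) (Y s))) fun ℓ => by
    set c : Fin a → ℝ := fun i => ℓ (Pi.single i 1, 0) with hc
    have hdec : ∀ (u : Fin a → ℝ) (η : H), ℓ ((u, 0) + Λ η) = ∑ i, c i * u i + (ℓ ∘L Λ) η := by
      intro u η
      have hu : ((u, 0) : (Fin a → ℝ) × (Fin b → Euc k)) = ∑ i, u i • (Pi.single i 1, 0) := by
        refine Prod.ext ?_ ?_
        · simp only [Prod.fst_sum, Prod.smul_fst]
          exact pi_eq_sum_univ' u
        · simp [Prod.snd_sum]
      rw [map_add, hu, map_sum]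
      refine congrArg (· + (ℓ ∘L Λ) η) (Finset.sum_congr rfl fun i _ => ?_)
      rw [map_smul, smul_eq_mul, mul_comm]
    have hchi : ∀ i, MemLp (fun θ => χ i (Θ t θ)) 2 μ₀ := fun i =>
      (hχc i).memLp_of_isCompact_support hK 2
    have hsum : MemLp (fun θ => ∑ i, c i * χ i (Θ t θ)) 2 μ₀ :=
      memLp_finsetSum _ fun i _ => (hchi i).const_mul (c i)
    have hrest : MemLp (fun θ => (ℓ ∘L Λ) (Ψ θ)) 2 μ₀ := (ℓ ∘L Λ).comp_memLp' hΨ2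
    have hfun : (fun θ => ℓ (f θ)) = fun θ => ∑ i, c i * χ i (Θ t θ) + (ℓ ∘L Λ) (Ψ θ) :=
      funext fun θ => hdec _ _
    rw [hfun]
    refine (hasLaw_processOfLp hgauss hmean hcov (hsum.add hrest)).congr ?_
    filter_upwards [processOfLp_add Z hsum hrest,
      processOfLp_sum_smul Z Finset.univ c hchi, hY (ℓ ∘L Λ)] with s h1 h2 h3
    have h4 : processOfLp Z ((fun θ => ∑ i, c i * χ i (Θ t θ)) + fun θ => (ℓ ∘L Λ) (Ψ θ)) s
        = _ := h1
    rw [h4, h2, ← h3, ← hdec]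
    congr 1
    exact Prod.ext rfl (by simp [hΛ])
  refine tendstoInDistribution_of_tendstoInMeasure_sub _ _ hclt ?_ hmeas
  -- the remainder is negligible compared with the sampling error, which is bounded in `L²`
  have hmom := integral_norm_sq_sqrt_smul_avg_sub_le hlaw hindep hΨ2
  have hΨξ : ∀ i, AEStronglyMeasurable (fun s => Ψ (ξ i s)) P := fun i =>
    AEStronglyMeasurable.comp_aemeasurable (by rw [(hlaw i).map_eq]; exact hΨ2.1)
      (hlaw i).aemeasurable
  have hΔm : ∀ m : ℕ, AEStronglyMeasurable
      (fun s => √(m : ℝ) • ((avg fun i : Fin m => Ψ (ξ i s)) - ∫ θ, Ψ θ ∂μ₀)) P := fun m => by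
    have h1 : AEStronglyMeasurable (fun s => ∑ i : Fin m, Ψ (ξ i s)) P :=
      Finset.aestronglyMeasurable_fun_sum _ fun i _ => hΨξ i
    exact ((h1.const_smul (m : ℝ)⁻¹).sub aestronglyMeasurable_const).const_smul √(m : ℝ)
  refine tendstoInMeasure_zero_of_ae_eventually_le
    (y := fun m s => ‖√(m : ℝ) • ((avg fun i : Fin m => Ψ (ξ i s)) - ∫ θ, Ψ θ ∂μ₀)‖)
    (fun m => ((hmeas m).sub (hclt.forall_aemeasurable m)).aestronglyMeasurable)
    (fun m s => norm_nonneg _) (fun m => (hΔm m).norm) (fun m => (hmom m).1) (fun m => (hmom m).2) ?_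
  -- laws of large numbers
  have cdΦ : ∀ θ ∈ D, ContinuousAt (fderiv ℝ Φ) θ := fun θ hθ =>
    (h.contDiff_observable θ hθ).continuousAt_fderiv_one
  have hTs : Continuous fun q : Icc 0 τ × μ₀.support => T q.1 q.2 :=
    hT.comp_continuous (f := fun q : Icc 0 τ × μ₀.support => ((q.1 : ℝ), (q.2 : Euc k)))
      (by fun_prop) fun q => ⟨mem_Ici.2 q.1.2.1, h.support_subset q.2.2⟩
  have hlln₁ := ae_tendsto_avg hlaw hindep hΨi
  have hlln₂ := ae_eventually_norm_avg_sub_le hlaw hindep hK (Y := Icc 0 τ)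
    (f := fun t θ => fderiv ℝ Φ (Θ t θ) ∘L T t θ) (by
      have h1 := (h.continuous_comp_support cdΦ).comp
        (by fun_prop : Continuous fun q : Icc 0 τ × μ₀.support => ((q.1 : ℝ), q.2))
      have h2 := h1.clm_comp hTs
      refine h2.congr fun q => ?_
      simp only [Function.comp_apply, max_eq_left q.1.2.1])
  have hlln₃ : ∀ i, ∀ᵐ s ∂P, Tendsto (fun m : ℕ => avg fun l : Fin m =>
      fderiv ℝ (χ i) (Θ t (ξ l s)) ∘L T t (ξ l s)) atTop (𝓝 (L i)) := fun i => by
    refine ae_tendsto_avg hlaw hindep (ContinuousOn.integrable_of_isCompact_support hK ?_)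
    refine ((h.continuousOn_comp (fun θ hθ => (hχ i θ hθ).continuousAt_fderiv_one) ht.1).mono
      h.support_subset).clm_comp ?_
    exact hT.comp (f := fun θ => (t, θ)) (by fun_prop)
      fun θ hθ => ⟨mem_Ici.2 ht.1, h.support_subset hθ⟩
  have hmem : ∀ᵐ s ∂P, ∀ i, ξ i s ∈ μ₀.support := ae_all_iff.2 fun i => by
    have h1 : ∀ᵐ θ ∂(P.map (ξ i)), θ ∈ μ₀.support := by
      rw [(hlaw i).map_eq]; exact Measure.support_mem_ae
    exact ae_of_ae_map (hlaw i).aemeasurable h1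
  filter_upwards [hlln₁, hlln₂, ae_all_iff.2 hlln₃, hmem, ae_all_iff.2 hx, ae_all_iff.2 hy]
    with s h₁ h₂ h₃ hs hxs hys ε hε
  obtain ⟨R, hR, hlin⟩ := h.eventually_linearization hΨ hG hGΨ hT hT0 hT' hpt hs h₁
    (fun ε hε => (h₂ ε hε).mono fun m hm t ht => hm ⟨t, ht⟩)
    (x := fun m i t => x m i t s) (y := fun m j t => y m j t s)
    (fun m i => hxs m i) (eventually_all.2 hys)
  have hobs := fun i => h.eventually_observable_expansion hΨ ht.1 (hχ i) hs h₁ (h₃ i)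
    (x := fun m i => x m i t s) hR (fun ε hε => (hlin ε hε).mono fun m hm => (hm t ht).1) ε hε
  filter_upwards [hlin ε hε, eventually_all.2 hobs] with m hm hm'
  set Δ : H := (avg fun i : Fin m => Ψ (ξ i s)) - ∫ θ, Ψ θ ∂μ₀ with hΔ
  have hmean_f : ∫ θ, f θ ∂μ₀ = ((fun i => ∫ θ, (χ i (Θ t θ) + L i (Ψ θ)) ∂μ₀),
      fun j => T t (pt j) (∫ θ, Ψ θ ∂μ₀)) := by
    have hfi := hf2.integrable (by norm_num : (1 : ℝ≥0∞) ≤ 2)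
    refine Prod.ext (funext fun i => ?_) (funext fun j => ?_)
    · exact (((ContinuousLinearMap.proj (R := ℝ) (φ := fun _ : Fin a => ℝ) i) ∘L
        ContinuousLinearMap.fst ℝ (Fin a → ℝ) (Fin b → Euc k)).integral_comp_comm hfi).symm
    · have h1 := (((ContinuousLinearMap.proj (R := ℝ) (φ := fun _ : Fin b => Euc k) j) ∘L
        ContinuousLinearMap.snd ℝ (Fin a → ℝ) (Fin b → Euc k)).integral_comp_comm hfi).symm
      have h2 := (T t (pt j)).integral_comp_comm hΨi
      refine h1.trans (Eq.trans ?_ h2)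
      refine integral_congr_ae (ae_of_all _ fun θ => ?_)
      simp [hf, hΛ]
  have hsqrt : ‖√(m : ℝ) • Δ‖ = √(m : ℝ) * ‖Δ‖ := by
    rw [norm_smul, Real.norm_of_nonneg (Real.sqrt_nonneg _)]
  rw [hsqrt, Prod.norm_def, max_le_iff, hmean_f]
  constructor
  · refine (pi_norm_le_iff_of_nonneg (by positivity)).2 fun i => ?_
    have h1 := mul_le_mul_of_nonneg_left (hm' i) (Real.sqrt_nonneg (m : ℝ))
    calc _ = √(m : ℝ) * ‖((avg fun l : Fin m => χ i (x m l t s)) - ∫ θ, χ i (Θ t θ) ∂μ₀)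
        - ((avg fun l : Fin m => χ i (Θ t (ξ l s)) + L i (Ψ (ξ l s)))
          - ∫ θ, (χ i (Θ t θ) + L i (Ψ θ)) ∂μ₀)‖ := by
          have hn : ∀ v : ℝ, √(m : ℝ) * ‖v‖ = ‖√(m : ℝ) * v‖ := fun v => by
            rw [norm_mul, Real.norm_of_nonneg (Real.sqrt_nonneg _)]
          rw [hn, mul_sub √(m : ℝ) (_ - _)]
          congr 1
          simp [hf, hΛ, avg, Prod.fst_sum]
      _ ≤ √(m : ℝ) * (ε * ‖Δ‖) := h1
      _ = ε * (√(m : ℝ) * ‖Δ‖) := by ring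
  · refine (pi_norm_le_iff_of_nonneg (by positivity)).2 fun j => ?_
    have h1 := mul_le_mul_of_nonneg_left ((hm t ht).2 j) (Real.sqrt_nonneg (m : ℝ))
    calc _ = √(m : ℝ) * ‖y m j t s - Θ t (pt j) - T t (pt j) Δ‖ := by
          have hn : ∀ v : Euc k, √(m : ℝ) * ‖v‖ = ‖√(m : ℝ) • v‖ := fun v => by
            rw [norm_smul, Real.norm_of_nonneg (Real.sqrt_nonneg _)]
          rw [hn, smul_sub √(m : ℝ) (_ - _)]
          congr 1
          simp [hf, hΛ, hΔ, avg, Prod.snd_sum]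
      _ ≤ √(m : ℝ) * (ε * ‖Δ‖) := h1
      _ = ε * (√(m : ℝ) * ‖Δ‖) := by ring

end IsMeanFieldSolution

/-! ### The finite-rank structure of the regression problem -/

section EmpiricalMeasure

variable {α : Type*} [MeasurableSpace α] [MeasurableSingletonClass α] {E : Type*}
  [NormedAddCommGroup E]

lemma integrable_sum_dirac {m : ℕ} (q : Fin m → α) (g : α → E) :
    Integrable g (∑ i, Measure.dirac (q i)) :=
  integrable_finsetSum_measure.2 fun i _ => integrable_dirac (by simp)

lemma integral_empiricalMeasure [NormedSpace ℝ E] [CompleteSpace E] {m : ℕ} (q : Fin m → α)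
    (g : α → E) : ∫ x, g x ∂(empiricalMeasure q) = avg fun i => g (q i) := by
  rw [empiricalMeasure, integral_smul_measure, avg,
    integral_finsetSum_measure fun i _ => integrable_dirac (by simp)]
  simp

lemma integrable_empiricalMeasure {m : ℕ} (q : Fin m → α) (g : α → E) :
    Integrable g (empiricalMeasure q) := by
  rcases Nat.eq_zero_or_pos m with rfl | hm
  · simp [empiricalMeasure]
  · exact (integrable_sum_dirac q g).smul_measure (by simp [hm.ne'])

end EmpiricalMeasure

section Gradient

variable {E : Type*} [NormedAddCommGroup E] [InnerProductSpace ℝ E] [CompleteSpace E]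

lemma ContDiffAt.gradient_one {f : E → ℝ} {x : E} (hf : ContDiffAt ℝ 2 f x) :
    ContDiffAt ℝ 1 (∇ f) x :=
  (InnerProductSpace.toDual ℝ E).symm.contDiff.contDiffAt.comp x
    (hf.fderiv_right (m := 1) (by norm_num))

lemma gradient_avg_mul {n : ℕ} {f : Fin n → E → ℝ} {x : E} (hf : ∀ l, DifferentiableAt ℝ (f l) x)
    (c : Fin n → ℝ) :
    HasGradientAt (fun a => avg fun l => f l a * c l) (avg fun l => c l • ∇ (f l) x) x := by
  rw [hasGradientAt_iff_hasFDerivAt]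
  have h1 : HasFDerivAt (fun a => (n : ℝ)⁻¹ • ∑ l, f l a * c l)
      ((n : ℝ)⁻¹ • ∑ l, c l • fderiv ℝ (f l) x) x :=
    (HasFDerivAt.fun_sum fun l _ => (hf l).hasFDerivAt.mul_const (c l)).fun_const_smul _
  have h2 : InnerProductSpace.toDual ℝ E (avg fun l => c l • ∇ (f l) x)
      = (n : ℝ)⁻¹ • ∑ l, c l • fderiv ℝ (f l) x := by
    simp [avg]
  rw [h2]
  exact h1

end Gradient

namespace RegressionProblem

variable {k d n : ℕ} (p : RegressionProblem k d n)

/-- The values `φ(θ, x_l)` at the data points. -/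
def observable (θ : Euc k) : Euc n := WithLp.toLp 2 fun l => p.phi θ (p.data l)

/-- The velocity `-(1/n) ∑ l, u l ∇φ(θ, x_l)` that a population with mean observables `u` adds to
the drift `∇F`. -/
def coupling (θ : Euc k) : Euc n →L[ℝ] Euc k :=
  -avg fun l => (EuclideanSpace.proj l : Euc n →L[ℝ] ℝ).smulRight (∇ (fun a => p.phi a (p.data l)) θ)

lemma coupling_apply (θ : Euc k) (u : Euc n) :
    p.coupling θ u = -avg fun l => u l • ∇ (fun a => p.phi a (p.data l)) θ := by
  simp [coupling, avg]

lemma K_eq (θ θ' : Euc k) :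
    p.K θ θ' = avg fun l => p.phi θ (p.data l) * p.phi θ' (p.data l) :=
  integral_empiricalMeasure _ _

variable {p} {θ : Euc k}

lemma contDiffAt_observable (hphi : ∀ l, ContDiffAt ℝ 2 (fun a => p.phi a (p.data l)) θ) :
    ContDiffAt ℝ 1 p.observable θ :=
  contDiffAt_euclidean.2 fun l => (hphi l).of_le (by norm_num)

lemma contDiffAt_coupling (hphi : ∀ l, ContDiffAt ℝ 2 (fun a => p.phi a (p.data l)) θ) :
    ContDiffAt ℝ 1 p.coupling θ :=
  (ContDiffAt.const_smul _ (ContDiffAt.sum fun l _ =>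
    contDiffAt_const.smulRight (hphi l).gradient_one)).neg

lemma contDiffAt_F (hphi : ∀ l, ContDiffAt ℝ 2 (fun a => p.phi a (p.data l)) θ)
    (hreg : ContDiffAt ℝ 2 p.reg θ) : ContDiffAt ℝ 2 p.F θ := by
  have h1 : p.F = fun a => (n : ℝ)⁻¹ • ∑ l, p.target (p.data l) * p.phi a (p.data l)
      - p.lam * p.reg a := by
    funext a
    rw [F, dataMeasure, integral_empiricalMeasure]
    rfl
  rw [h1]
  exact (ContDiffAt.const_smul _ (ContDiffAt.sum fun l _ => contDiffAt_const.mul (hphi l))).sub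
    (contDiffAt_const.mul hreg)

/-- The kernel has finite rank: `∇K(θ, θ')` depends on `θ'` only through the observables. -/
lemma gradK_eq (hphi : ∀ l, ContDiffAt ℝ 2 (fun a => p.phi a (p.data l)) θ) (θ' : Euc k) :
    p.gradK θ θ' = -p.coupling θ (p.observable θ') := by
  rw [gradK, coupling_apply, neg_neg]
  simp only [K_eq]
  exact (gradient_avg_mul (fun l => (hphi l).differentiableAt (by norm_num)) _).gradient

lemma hessK_eq (hphi : ∀ l, ContDiffAt ℝ 2 (fun a => p.phi a (p.data l)) θ) (θ' : Euc k) :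
    p.hessK θ θ' = -(fderiv ℝ p.coupling θ).flip (p.observable θ') := by
  have h1 : (fun a => p.gradK a θ') =ᶠ[𝓝 θ] fun a => -p.coupling a (p.observable θ') := by
    filter_upwards [eventually_all.2 fun l => (hphi l).eventually (by simp)] with a ha
    exact gradK_eq ha θ'
  have h2 := ((contDiffAt_coupling hphi).differentiableAt (by norm_num)).hasFDerivAt.clm_apply
    (hasFDerivAt_const (p.observable θ') θ)
  rw [hessK, h1.fderiv_eq, h2.fun_neg.fderiv]
  simp

lemma mixedK_eq (hphi : ∀ l, ContDiffAt ℝ 2 (fun a => p.phi a (p.data l)) θ) {θ' : Euc k}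
    (hphi' : ∀ l, ContDiffAt ℝ 2 (fun a => p.phi a (p.data l)) θ') :
    p.mixedK θ θ' = -(p.coupling θ ∘L fderiv ℝ p.observable θ') := by
  have h1 : (fun a' => p.gradK θ a') = fun a' => -p.coupling θ (p.observable a') :=
    funext fun a' => gradK_eq hphi a'
  have h2 := (p.coupling θ).hasFDerivAt.comp θ'
    ((contDiffAt_observable hphi').differentiableAt (by norm_num)).hasFDerivAt
  rw [mixedK, h1]
  exact h2.neg.fderiv

lemma gradV_eq (hphi : ∀ l, ContDiffAt ℝ 2 (fun a => p.phi a (p.data l)) θ)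
    (hreg : ContDiffAt ℝ 2 p.reg θ) {μ : Measure (Euc k)} (hμ : Integrable p.observable μ) :
    p.gradV θ μ = -(∇ p.F θ + p.coupling θ (∫ θ', p.observable θ' ∂μ)) := by
  have hcoord : ∀ l, Integrable (fun θ' => p.phi θ' (p.data l)) μ := fun l =>
    (EuclideanSpace.proj l : Euc n →L[ℝ] ℝ).integrable_comp hμ
  have hint : ∀ l, ∫ θ', p.phi θ' (p.data l) ∂μ = (∫ θ', p.observable θ' ∂μ) l := fun l =>
    (EuclideanSpace.proj l : Euc n →L[ℝ] ℝ).integral_comp_comm hμ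
  have hV : (fun a => p.V a μ) = fun a => -p.F a
      + avg fun l => p.phi a (p.data l) * (∫ θ', p.observable θ' ∂μ) l := by
    funext a
    simp only [V, K_eq, avg]
    rw [integral_smul, integral_finsetSum _ fun l _ => (hcoord l).const_mul _]
    simp only [integral_const_mul, hint]
  have h1 := gradient_avg_mul (fun l => (hphi l).differentiableAt (by norm_num))
    (fun l => (∫ θ', p.observable θ' ∂μ) l)
  have h2 := ((contDiffAt_F hphi hreg).differentiableAt (by norm_num)).hasGradientAt
  have h3 : HasGradientAt (fun a => -p.F a
      + avg fun l => p.phi a (p.data l) * (∫ θ', p.observable θ' ∂μ) l)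
      (-∇ p.F θ + avg fun l =>
        (∫ θ', p.observable θ' ∂μ) l • ∇ (fun a => p.phi a (p.data l)) θ) θ := by
    rw [hasGradientAt_iff_hasFDerivAt] at h1 h2 ⊢
    rw [map_add, map_neg]
    exact h2.neg.add h1
  rw [gradV, hV, h3.gradient, coupling_apply, neg_add, neg_neg]

end RegressionProblem

section MapIntegral

variable {X Y : Type*} [TopologicalSpace X] [MeasurableSpace X] [BorelSpace X]
  [SecondCountableTopology X] [TopologicalSpace Y] [MeasurableSpace Y] [BorelSpace Y]
  [SecondCountableTopology Y] [T2Space Y]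
  {μ : Measure X} [IsFiniteMeasure μ]

/-- Integration with respect to the image of a compactly supported measure, of a function that is
only known to be continuous on the image of the support. -/
lemma integrable_map_and_integral_map {E : Type*} [NormedAddCommGroup E] [NormedSpace ℝ E]
    (hK : IsCompact μ.support) {g : X → Y} (hg : ContinuousOn g μ.support) {f : Y → E}
    (hf : ContinuousOn f (g '' μ.support)) :
    Integrable f (μ.map g) ∧ ∫ y, f y ∂(μ.map g) = ∫ x, f (g x) ∂μ := by
  have hgm : AEMeasurable g μ := by
    have h := hg.aemeasurable (μ := μ) Measure.isClosed_support.measurableSet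
    rwa [restrict_support_eq_self] at h
  have hC : MeasurableSet (g '' μ.support) := (hK.image_of_continuousOn hg).measurableSet
  have hmem : ∀ᵐ y ∂(μ.map g), y ∈ g '' μ.support := by
    refine (ae_map_iff hgm hC).2 ?_
    filter_upwards [Measure.support_mem_ae] with x hx using mem_image_of_mem g hx
  have hfm : AEStronglyMeasurable f (μ.map g) := by
    have h := hf.aestronglyMeasurable (μ := μ.map g) hC
    rwa [Measure.restrict_eq_self_of_ae_mem hmem] at h
  refine ⟨(integrable_map_measure hfm hgm).2 ?_, integral_map hgm hfm⟩
  exact (hf.comp hg (mapsTo_image _ _)).integrable_of_isCompact_support hK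

end MapIntegral

/-! ### Fluctuations of the particle system -/

section Reduction

variable {k d n : ℕ} {p : RegressionProblem k d n} {D D₀ : Set (Euc k)} {μ₀ : Measure (Euc k)}
  {Θ : ℝ → Euc k → Euc k}

/-- On `D`, the gradient flow in the potential of a finite population is driven by the population
only through its mean observables. -/
lemma RegressionProblem.neg_gradV_empiricalMeasure
    (hphi : ∀ l, ∀ θ ∈ D, ContDiffAt ℝ 2 (fun a => p.phi a (p.data l)) θ)
    (hreg : ∀ θ ∈ D, ContDiffAt ℝ 2 p.reg θ) {m : ℕ} (q : Fin m → Euc k) {θ : Euc k} (hθ : θ ∈ D) :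
    -p.gradV θ (empiricalMeasure q)
      = ∇ p.F θ + p.coupling θ (avg fun i => p.observable (q i)) := by
  rw [RegressionProblem.gradV_eq (fun l => hphi l θ hθ) (hreg θ hθ)
    (integrable_empiricalMeasure _ _), integral_empiricalMeasure, neg_neg]

lemma IsMeanFieldFlow.isMeanFieldSolution [IsProbabilityMeasure μ₀]
    (hphi : ∀ l, ∀ θ ∈ D, ContDiffAt ℝ 2 (fun a => p.phi a (p.data l)) θ)
    (hreg : ∀ θ ∈ D, ContDiffAt ℝ 2 p.reg θ) (hμ₀ : IsCompact μ₀.support) (hD₀ : μ₀.support ⊆ D₀)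
    (hΘ : IsMeanFieldFlow p D D₀ μ₀ Θ) :
    IsMeanFieldSolution (∇ p.F) p.coupling p.observable D D₀ μ₀ Θ where
  contDiff_drift x hx :=
    (RegressionProblem.contDiffAt_F (fun l => hphi l x hx) (hreg x hx)).gradient_one
  contDiff_coupling x hx := RegressionProblem.contDiffAt_coupling fun l => hphi l x hx
  contDiff_observable x hx := RegressionProblem.contDiffAt_observable fun l => hphi l x hx
  isCompact_support := hμ₀
  support_subset := hD₀
  continuousOn := hΘ.continuousOn
  mem t ht θ hθ := ((hΘ.trajectory θ hθ).2 t ht).1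
  init θ hθ := (hΘ.trajectory θ hθ).1
  hasDerivWithinAt t ht θ hθ := by
    obtain ⟨hmem, hder⟩ := (hΘ.trajectory θ hθ).2 t ht
    have hΘc : ContinuousOn (Θ t) μ₀.support := hΘ.continuousOn.comp (f := fun θ => (t, θ))
      (by fun_prop) fun θ hθ => ⟨mem_Ici.2 ht, hD₀ hθ⟩
    have hobs : ContinuousOn p.observable (Θ t '' μ₀.support) := by
      rintro _ ⟨θ', hθ', rfl⟩
      exact (RegressionProblem.contDiffAt_observable fun l =>
        hphi l _ ((hΘ.trajectory θ' (hD₀ hθ')).2 t ht).1).continuousAt.continuousWithinAt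
    obtain ⟨hint, heq⟩ := integrable_map_and_integral_map hμ₀ hΘc hobs
    beta_reduce at hmem hder
    rw [RegressionProblem.gradV_eq (fun l => hphi l _ hmem) (hreg _ hmem) hint, neg_neg, heq] at hder
    exact hder

variable {H : Type*} [NormedAddCommGroup H] [NormedSpace ℝ H] {Ψ : Euc k → H}
  {G : ℝ → H →L[ℝ] Euc n} {T : ℝ → Euc k → H →L[ℝ] Euc k}
  {S : Type} [MeasurableSpace S] {P : Measure S}

/-- The linear response to the Gaussian sampling error solves the fluctuation equation. -/
lemma isFluctuationFlow_response [IsProbabilityMeasure μ₀]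
    (hphi : ∀ l, ∀ θ ∈ D, ContDiffAt ℝ 2 (fun a => p.phi a (p.data l)) θ)
    (h : IsMeanFieldSolution (∇ p.F) p.coupling p.observable D D₀ μ₀ Θ)
    (hΨ : ContinuousOn Ψ μ₀.support) (hG : Continuous G)
    (hGΨ : ∀ t, 0 ≤ t → ∀ θ ∈ μ₀.support, G t (Ψ θ) = p.observable (Θ t θ))
    (hT : ContinuousOn (fun q : ℝ × Euc k => T q.1 q.2) (Ici 0 ×ˢ D₀))
    (hT0 : ∀ θ ∈ D₀, T 0 θ = 0)
    (hT' : ∀ t, 0 ≤ t → ∀ θ ∈ D₀, HasDerivWithinAt (fun s => T s θ)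
      ((fderiv ℝ (∇ p.F) (Θ t θ)
          + (fderiv ℝ p.coupling (Θ t θ)).flip (∫ θ', p.observable (Θ t θ') ∂μ₀)) ∘L T t θ
        + p.coupling (Θ t θ) ∘L (∫ θ', fderiv ℝ p.observable (Θ t θ') ∘L T t θ' ∂μ₀ + G t))
      (Ici 0) t)
    {Z : Lp ℝ 2 μ₀ →L[ℝ] Lp ℝ 2 P} {Y : S → H}
    (hY : ∀ L : H →L[ℝ] ℝ, ∀ᵐ s ∂P, L (Y s) = processOfLp Z (fun θ => L (Ψ θ)) s) :
    IsFluctuationFlow p D₀ μ₀ P Θ (processOfLp Z) fun t θ s => T t θ (Y s) := by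
  have hΨ2 : MemLp Ψ 2 μ₀ := hΨ.memLp_of_isCompact_support h.isCompact_support 2
  have hphiΘ : ∀ t, 0 ≤ t → ∀ θ ∈ D₀, ∀ l,
      ContDiffAt ℝ 2 (fun a => p.phi a (p.data l)) (Θ t θ) := fun t ht θ hθ l =>
    hphi l _ (h.mem t ht θ hθ)
  refine ⟨fun t θ s => -p.coupling (Θ t θ) (G t (Y s)), ?_, ?_, ?_, ?_⟩
  · intro t ht θ hθ v
    set L : H →L[ℝ] ℝ := -(innerSL ℝ v ∘L p.coupling (Θ t θ) ∘L G t) with hL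
    have hcongr : processOfLp Z (fun θ' => L (Ψ θ'))
        = processOfLp Z (fun θ' => inner ℝ v (p.gradK (Θ t θ) (Θ t θ'))) := by
      refine processOfLp_congr Z (L.comp_memLp' hΨ2) ?_
      filter_upwards [Measure.support_mem_ae] with θ' hθ'
      rw [RegressionProblem.gradK_eq (hphiΘ t ht θ hθ), ← hGΨ t ht θ' hθ', inner_neg_right]
      rfl
    filter_upwards [hY L] with s hs
    rw [← hcongr, ← hs, inner_neg_right]
    rfl
  · refine ae_of_all _ fun s => ContinuousOn.neg (ContinuousOn.clm_apply ?_ ?_)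
    · intro q hq
      exact ContinuousAt.comp_continuousWithinAt (f := fun q : ℝ × Euc k => Θ q.1 q.2)
        (h.contDiff_coupling _ (h.mem q.1 hq.1 q.2 hq.2)).continuousAt (h.continuousOn q hq)
    · exact ((hG.comp continuous_fst).clm_apply continuous_const).continuousOn
  · exact ae_of_all _ fun s => hT.clm_apply continuousOn_const
  · refine ae_of_all _ fun s θ hθ => ⟨by simp only [hT0 θ hθ]; rfl, fun t ht => ?_⟩
    have hcomp : Integrable (fun θ => fderiv ℝ p.observable (Θ t θ) ∘L T t θ) μ₀ := by
      refine ContinuousOn.integrable_of_isCompact_support h.isCompact_support ?_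
      refine ((h.continuousOn_comp
        (fun θ hθ => (h.contDiff_observable θ hθ).continuousAt_fderiv_one) ht).mono
          h.support_subset).clm_comp ?_
      exact hT.comp (f := fun θ => (t, θ)) (by fun_prop)
        fun θ hθ => ⟨mem_Ici.2 ht, h.support_subset hθ⟩
    have hobs : Integrable (fun θ => p.observable (Θ t θ)) μ₀ :=
      ((h.continuousOn_comp (fun θ hθ => (h.contDiff_observable θ hθ).continuousAt) ht).mono
        h.support_subset).integrable_of_isCompact_support h.isCompact_support
    have hhess : hessVAlong p μ₀ (Θ t) θ = -(fderiv ℝ (∇ p.F) (Θ t θ)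
        + (fderiv ℝ p.coupling (Θ t θ)).flip (∫ θ', p.observable (Θ t θ') ∂μ₀)) := by
      simp only [hessVAlong, RegressionProblem.hessK_eq (hphiΘ t ht θ hθ),
        RegressionProblem.hessF]
      rw [integral_neg, ContinuousLinearMap.integral_comp_comm _ hobs, neg_add]
    have hmixed : ∫ θ', p.mixedK (Θ t θ) (Θ t θ') (T t θ' (Y s)) ∂μ₀
        = -p.coupling (Θ t θ) ((∫ θ', fderiv ℝ p.observable (Θ t θ') ∘L T t θ' ∂μ₀) (Y s)) := by
      rw [ContinuousLinearMap.integral_apply hcomp, ← ContinuousLinearMap.integral_comp_comm _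
        (hcomp.apply_continuousLinearMap _), ← integral_neg]
      refine integral_congr_ae ?_
      filter_upwards [Measure.support_mem_ae] with θ' hθ'
      rw [RegressionProblem.mixedK_eq (hphiΘ t ht θ hθ)
        (hphiΘ t ht θ' (h.support_subset hθ'))]
      rfl
    have h1 := (hT' t ht θ hθ).clm_apply (hasDerivWithinAt_const t (Ici 0) (Y s))
    have h2 : ((fderiv ℝ (∇ p.F) (Θ t θ)
          + (fderiv ℝ p.coupling (Θ t θ)).flip (∫ θ', p.observable (Θ t θ') ∂μ₀)) ∘L T t θ
        + p.coupling (Θ t θ) ∘L (∫ θ', fderiv ℝ p.observable (Θ t θ') ∘L T t θ' ∂μ₀ + G t)) (Y s)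
        + T t θ 0
      = -(hessVAlong p μ₀ (Θ t) θ (T t θ (Y s)))
        - ∫ θ', p.mixedK (Θ t θ) (Θ t θ') (T t θ' (Y s)) ∂μ₀
        - -p.coupling (Θ t θ) (G t (Y s)) := by
      rw [hhess, hmixed]
      simp only [neg_apply, add_apply, ContinuousLinearMap.comp_apply, map_add, map_zero, neg_neg,
        sub_neg_eq_add, add_zero, add_assoc]
    rw [h2] at h1
    exact h1

lemma limitFluctuation_response {Z : Lp ℝ 2 μ₀ →L[ℝ] Lp ℝ 2 P} {Y : S → H} {t : ℝ}
    {χ : Euc k → ℝ}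
    (hint : Integrable (fun θ => fderiv ℝ χ (Θ t θ) ∘L T t θ) μ₀) (s : S) :
    limitFluctuation μ₀ Θ (processOfLp Z) (fun t θ s => T t θ (Y s)) t χ s
      = processOfLp Z (fun θ => χ (Θ t θ)) s
        + (∫ θ, fderiv ℝ χ (Θ t θ) ∘L T t θ ∂μ₀) (Y s) := by
  rw [limitFluctuation, ContinuousLinearMap.integral_apply hint]
  congr 1
  exact integral_congr_ae (ae_of_all _ fun θ => inner_gradient_left)

/-- A function that is continuous near the values of a random variable is measurable along it. -/
lemma aemeasurable_comp_of_contDiffAt {χ : Euc k → ℝ} (hχ : ∀ θ ∈ D, ContDiffAt ℝ 1 χ θ)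
    {S : Type*} [MeasurableSpace S] {P : Measure S} {f : S → Euc k} (hf : AEMeasurable f P)
    (hfD : ∀ᵐ s ∂P, f s ∈ D) : AEMeasurable (fun s => χ (f s)) P := by
  classical
  set U : Set (Euc k) := {θ | ContDiffAt ℝ 1 χ θ} with hU
  have hUo : IsOpen U := isOpen_iff_mem_nhds.2 fun θ hθ => ContDiffAt.eventually hθ (by simp)
  have hc : ContinuousOn χ U := fun θ hθ =>
    (show ContDiffAt ℝ 1 χ θ from hθ).continuousAt.continuousWithinAt
  have hm : Measurable (U.piecewise χ fun _ => 0) :=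
    hc.measurable_piecewise continuousOn_const hUo.measurableSet
  refine (hm.comp_aemeasurable hf).congr ?_
  filter_upwards [hfD] with s hs
  exact piecewise_eq_of_mem _ _ _ (hχ _ hs)

end Reduction

theorem proposition3
    {k d n : ℕ} (hn : 0 < n) (p : RegressionProblem k d n)
    -- data domain `Ω`, parameter domain `D`
    (Ω : Set (Euc d)) (hΩ : IsCompact Ω) (hdata : ∀ l, p.data l ∈ Ω)
    (D : Set (Euc k))
    -- `φ` is twice (continuously) differentiable in `θ`, with Lipschitz Hessian uniformly in `x`
    (hphi : ∀ x ∈ Ω, ∀ θ ∈ D, ContDiffAt ℝ 2 (fun a => p.phi a x) θ)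
    (hLip : ∃ L : ℝ≥0, ∀ x ∈ Ω,
      LipschitzOnWith L (fun θ => fderiv ℝ (∇ (fun a => p.phi a x)) θ) D)
    (hreg : ∀ θ ∈ D, ContDiffAt ℝ 2 p.reg θ)
    -- compactly supported initial law on `D`; `D₀` is a set of initial points
    (μ₀ : Measure (Euc k)) [IsProbabilityMeasure μ₀] (hμ₀ : IsCompact μ₀.support)
    (D₀ : Set (Euc k)) (hD₀ : μ₀.support ⊆ D₀) (hD₀D : D₀ ⊆ D)
    -- i.i.d. initialization
    {S : Type*} [MeasurableSpace S] (P : Measure S) [IsProbabilityMeasure P]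
    (θ₀ : ℕ → S → Euc k) (hlaw : ∀ i, HasLaw (θ₀ i) μ₀ P) (hindep : iIndepFun θ₀ P)
    -- the particle gradient flow
    (ϑ : (m : ℕ) → Fin m → ℝ → S → Euc k)
    (hϑmeas : ∀ m i t, 0 ≤ t → AEMeasurable (ϑ m i t) P)
    (hϑ : ∀ m, ∀ᵐ s ∂P, IsParticleFlow p D (fun i : Fin m => θ₀ i s) (fun i t => ϑ m i t s))
    -- the mean-field flow
    (Θ : ℝ → Euc k → Euc k) (hΘ : IsMeanFieldFlow p D D₀ μ₀ Θ)
    -- the flow `Θ^{(m)}` in the potential generated by the `m` particles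
    (Θm : ℕ → ℝ → Euc k → S → Euc k)
    (hΘmmeas : ∀ m t, 0 ≤ t → ∀ θ ∈ D₀, AEMeasurable (Θm m t θ) P)
    (hΘm : ∀ θ ∈ D₀, ∀ τ, 0 < τ → ∀ᵐ s ∂P, ∀ᶠ m in atTop,
      IsTrajectory (fun t a => -p.gradV a (empiricalMeasure fun j : Fin m => ϑ m j t s)) D
        (Icc 0 τ) θ (fun t => Θm m t θ s)) :
    ∃ (S' : Type) (_ : MeasurableSpace S') (P' : Measure S') (_ : IsProbabilityMeasure P')
      (W : (Euc k → ℝ) → S' → ℝ) (T : ℝ → Euc k → S' → Euc k),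
      IsGaussianFluctuation μ₀ P' W ∧
      IsFluctuationFlow p D₀ μ₀ P' Θ W T ∧
      ∀ t, 0 ≤ t →
        ∀ (a : ℕ) (χ : Fin a → Euc k → ℝ), (∀ i, ∀ θ ∈ D, ContDiffAt ℝ 1 (χ i) θ) →
        ∀ (b : ℕ) (pt : Fin b → Euc k), (∀ j, pt j ∈ D₀) →
        TendstoInDistribution
          (fun (m : ℕ) (s : S) =>
            ((fun i : Fin a => discrepancy (fun j : Fin m => ϑ m j t s) (μ₀.map (Θ t)) (χ i)),
              (fun j : Fin b => √(m : ℝ) • (Θm m t (pt j) s - Θ t (pt j)))))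
          atTop
          (fun s : S' =>
            ((fun i : Fin a => limitFluctuation μ₀ Θ W T t (χ i) s),
              (fun j : Fin b => T t (pt j) s)))
          (fun _ => P) P' := by
  have hphi' : ∀ l, ∀ θ ∈ D, ContDiffAt ℝ 2 (fun a => p.phi a (p.data l)) θ := fun l =>
    hphi _ (hdata l)
  have h := hΘ.isMeanFieldSolution hphi' hreg hμ₀ hD₀
  have : Fact ((2 : ℝ≥0∞) ≠ ⊤) := ⟨by simp⟩
  obtain ⟨Ψ, G, hΨ, hG, hGΨ⟩ := h.exists_path_representation
  obtain ⟨T, hT, hT0, hT'⟩ := h.exists_response hG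
  obtain ⟨S', _, P', _, Z, hgauss, hmean, hcov⟩ := exists_centered_isonormal μ₀
  obtain ⟨Y, hY⟩ := exists_hilbert_counterpart Z (hΨ.memLp_of_isCompact_support hμ₀ 2)
  refine ⟨S', _, P', ‹_›, processOfLp Z, fun t θ s => T t θ (Y s),
    isGaussianFluctuation_processOfLp hgauss hmean hcov,
    isFluctuationFlow_response hphi' h hΨ hG hGΨ hT hT0 hT' hY, fun t ht a χ hχ b pt hpt => ?_⟩
  have hΘt : ContinuousOn (Θ t) μ₀.support := hΘ.continuousOn.comp (f := fun θ => (t, θ))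
    (by fun_prop) fun θ hθ => ⟨mem_Ici.2 ht, hD₀ hθ⟩
  have hdisc : ∀ (m : ℕ) (s : S) (i : Fin a),
      discrepancy (fun j : Fin m => ϑ m j t s) (μ₀.map (Θ t)) (χ i)
        = √(m : ℝ) * ((avg fun l : Fin m => χ i (ϑ m l t s)) - ∫ θ, χ i (Θ t θ) ∂μ₀) := by
    intro m s i
    have hχc : ContinuousOn (χ i) (Θ t '' μ₀.support) := by
      rintro _ ⟨θ, hθ, rfl⟩
      exact (hχ i _ (h.mem t ht θ (hD₀ hθ))).continuousAt.continuousWithinAt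
    rw [discrepancy, integral_empiricalMeasure, (integrable_map_and_integral_map hμ₀ hΘt hχc).2]
  have hlim : ∀ (i : Fin a) (s : S'),
      limitFluctuation μ₀ Θ (processOfLp Z) (fun t θ s => T t θ (Y s)) t (χ i) s
        = processOfLp Z (fun θ => χ i (Θ t θ)) s
          + (∫ θ, fderiv ℝ (χ i) (Θ t θ) ∘L T t θ ∂μ₀) (Y s) := by
    intro i s
    refine limitFluctuation_response (ContinuousOn.integrable_of_isCompact_support hμ₀ ?_) s
    refine ((h.continuousOn_comp (fun θ hθ => (hχ i θ hθ).continuousAt_fderiv_one) ht).mono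
      hD₀).clm_comp ?_
    exact hT.comp (f := fun θ => (t, θ)) (by fun_prop) fun θ hθ => ⟨mem_Ici.2 ht, hD₀ hθ⟩
  simp only [hdisc, hlim]
  have hsub : Icc 0 (t + 1) ⊆ Ici (0 : ℝ) := Icc_subset_Ici_self
  refine h.tendstoInDistribution_fluctuation hΨ hG hGΨ hT hT0 hT' hlaw hindep hpt
    (x := ϑ) (y := fun m j t s => Θm m t (pt j) s) (τ := t + 1) ?_ ?_ hgauss hmean hcov hY
    ⟨ht, by linarith⟩ hχ ?_
  · intro m
    filter_upwards [hϑ m] with s hs i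
    refine ⟨(hs i).1, fun r hr => ?_⟩
    obtain ⟨hmem, hder⟩ := (hs i).2 r (hsub hr)
    beta_reduce at hmem hder
    rw [RegressionProblem.neg_gradV_empiricalMeasure hphi' hreg _ hmem] at hder
    exact hder.mono hsub
  · intro j
    filter_upwards [hΘm (pt j) (hpt j) (t + 1) (by linarith)] with s hs
    filter_upwards [hs] with m hm
    refine ⟨hm.1, fun r hr => ?_⟩
    obtain ⟨hmem, hder⟩ := hm.2 r hr
    beta_reduce at hmem hder
    rw [RegressionProblem.neg_gradV_empiricalMeasure hphi' hreg _ hmem] at hder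
    exact hder
  · intro m
    refine AEMeasurable.prodMk (aemeasurable_pi_lambda _ fun i => ?_)
      (aemeasurable_pi_lambda _ fun j => ?_)
    · have h1 : ∀ l : Fin m, AEMeasurable (fun s => χ i (ϑ m l t s)) P := fun l =>
        aemeasurable_comp_of_contDiffAt (hχ i) (hϑmeas m l t ht) (by
          filter_upwards [hϑ m] with s hs using ((hs l).2 t ht).1)
      have h2 : AEMeasurable (fun s => ∑ l : Fin m, χ i (ϑ m l t s)) P :=
        Finset.aemeasurable_fun_sum _ fun l _ => h1 l
      exact ((h2.const_smul (m : ℝ)⁻¹).sub_const _).const_mul _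
    · exact ((hΘmmeas m t ht (pt j) (hpt j)).sub_const _).const_smul √(m : ℝ)
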